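/- **Proposition 5.2.** Let $N\ge 2$ be an integer, let $G=D_{N+2}$ be the Dynkin diagram with vertices $1,\dots,N+2$ and edges $\{j,j+1\}$ $(1\le j\le N)$ and $\{N,N+2\}$, and let $M$ be its Cartan matrix: $m_{jj}=2$, $m_{jk}=-1$ if $j,k$ are joined by an edge, and $m_{jk}=0$ otherwise. For $\tau$ in the upper half-plane write $q=e^{2\pi i\tau}$ and $q^r=e^{2\pi i r\tau}$ $(r\in\mathbb{R})$, and put $$Z_{D_{N+2}}(q):=\frac{q^{\frac{-3(N+2)+\operatorname{tr}(M)}{2}}}{(2\pi i)^{N+2}}\,\mathrm{PV}\!\int_{|w_j|=1}\ \prod_{j}\left(w_j-w_j^{-1}\right)^2\prod_{(k,\ell)\in E}\frac{1}{(w_k-w_k^{-1})(w_\ell-w_\ell^{-1})}\ \sum_{\mathbf m\in M\mathbb{Z}^{N+2}}q^{\frac12\mathbf m^TM^{-1}\mathbf m}\prod_j w_j^{m_j}\ \prod_j\frac{dw_j}{w_j},$$ where $E$ is the edge set and PV denotes the Cauchy principal value, i.e. the limit as $\varepsilon\to0^+$ of the integrals over the points of the torus with $|w_j-1|\ge\varepsilon$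 and $|w_j+1|\ge\varepsilon$ for all $j$. For integers $j$ and $p\ge1$ let $$F_{j,p}(\tau):=\sum_{m\in\mathbb{Z}}\operatorname{sgn}^*(m)\,q^{\left(m+\frac{j}{2p}\right)^2},$$ where $\operatorname{sgn}^*(m)=\operatorname{sgn}(m)$ for $m\ne0$ and $\operatorname{sgn}^*(0)=1$. Then the integrands are integrable off the poles, the principal value exists, all the series involved converge absolutely, and the following hold. (1) If $N$ is odd, then $$Z_{D_{N+2}}(q)=q^{-\frac N2-\frac1{2N}}\left(F_{-1,N}(2N\tau)+F_{2N-1,N}(2N\tau)\right)=-2q^{-\frac N2}\sum_{m\equiv1\,(\mathrm{mod}\,2N)}\operatorname{sgn}(m)\,q^{\frac{m^2-1}{2N}}+2q^{-\frac N2},$$ and $Z_{D_{N+2}}(e^{-2\pi t})\sim\frac2N$ as $t\to0^+$ (the quotient of the two sides tends to $1$). (2) If $N$ is even, then $$\begin{aligned}Z_{D_{N+2}}(q)&=q^{-\frac N2-\frac1{2N}}\left(F_{-1,N}(2N\tau)+2F_{N+1,N}(2N\tau)+F_{2N-1,N}(2N\tau)\right)\\&=-2q^{-\frac N2}\left(\sum_{m\equiv1\,(\mathrm{mod}\,2N)}+\sum_{m\equiv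 N-1\,(\mathrm{mod}\,2N)}\right)\operatorname{sgn}(m)\,q^{\frac{m^2-1}{2N}}+2q^{-\frac N2},\end{aligned}$$ (for $N=2$ the two sums coincide and are both counted), and $Z_{D_{N+2}}(e^{-2\pi t})\sim-2\pi t$ as $t\to0^+$ (again the quotient of the two sides tends to $1$). In particular, for every $N\ge2$ the function $\Phi(\tau)=q^{\frac14+\frac1{4N^2}}Z_{D_{N+2}}(q^{\frac1{2N}})$ is a quantum modular form of weight $\frac12$ with quantum set $\mathbb{Q}$. This means: for every $x\in\mathbb{Q}$ the limit $f(x)=\lim_{t\to0^+}\Phi(x+it)$ exists, and there are a congruence subgroup $\Gamma$ of $\mathrm{SL}_2(\mathbb{Z})$ and a multiplier system $v$ of weight $\frac12$ on $\Gamma$ (unitary, with $v(\gamma)(cz+d)^{1/2}$ an automorphy factor on the lower half-plane, principal branch) such that for all $\gamma=\begin{pmatrix}a&b\\c&d\end{pmatrix}\in\Gamma$ the function $$x\mapsto f(x)-v(\gamma)^{-1}(cx+d)^{-\frac12}f\!\left(\frac{ax+b}{cx+d}\right),\qquad x\in\mathbb{Q},\ cx+d\ne0,$$ extends to a real-analytic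 function on $\{x\in\mathbb{R}:cx+d\neq0\}$. Here $(cx+d)^{-1/2}$ is the boundary value of the principal branch on the lower half-plane (the principal value if $c=0$); it is the positive root for $cx+d>0$. -/

import Mathlib

open Complex Filter Topology Asymptotics Set

noncomputable section

/-! ### Powers of `q` and plumbing data -/

/-- `q ^ r` for `q = exp (2πiτ)` and a real exponent `r`. -/
def qPow (τ : ℂ) (r : ℝ) : ℂ := cexp (2 * Real.pi * I * r * τ)

/-- The matrix of a graph with framing coefficients `a`: the diagonal entries are the `a j`, the
entry `(j, k)` is `-1` if `j` and `k` are joined by an edge, and `0` otherwise. -/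
def plumbingMatrix {n : ℕ} (G : SimpleGraph (Fin n)) [DecidableRel G.Adj] (a : Fin n → ℤ) :
    Matrix (Fin n) (Fin n) ℤ :=
  Matrix.of fun j k => if j = k then a j else if G.Adj j k then -1 else 0

/-- The exponent `(1/2) mᵀ M⁻¹ m`. -/
def thetaExponent {n : ℕ} (M : Matrix (Fin n) (Fin n) ℤ) (m : Fin n → ℤ) : ℝ :=
  1 / 2 * ((fun j => (m j : ℝ)) ⬝ᵥ ((M.map (Int.cast : ℤ → ℝ))⁻¹).mulVec (fun j => (m j : ℝ)))

/-- The term of the theta function that belongs to `m`. -/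
def thetaTerm {n : ℕ} (M : Matrix (Fin n) (Fin n) ℤ) (τ : ℂ) (w : Fin n → ℂ)
    (m : Fin n → ℤ) : ℂ :=
  qPow τ (thetaExponent M m) * ∏ j, w j ^ m j

/-- The lattice `M ℤⁿ`. -/
def plumbingLattice {n : ℕ} (M : Matrix (Fin n) (Fin n) ℤ) : Set (Fin n → ℤ) :=
  Set.range fun x : Fin n → ℤ => M.mulVec x

/-- The theta function `Θ_M(q; w) = ∑_{m ∈ M ℤⁿ} q^{(1/2) mᵀ M⁻¹ m} ∏ⱼ wⱼ^{mⱼ}`. -/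
def plumbingTheta {n : ℕ} (M : Matrix (Fin n) (Fin n) ℤ) (τ : ℂ) (w : Fin n → ℂ) : ℂ :=
  ∑' m : plumbingLattice M, thetaTerm M τ w m

/-- The Laurent polynomial `(w - w⁻¹)²` of a vertex. -/
def vertexFactor (w : ℂ) : ℂ := (w - w⁻¹) ^ 2

/-- The rational function `1 / ((w - w⁻¹)(w' - w'⁻¹))` of an edge. -/
def edgeFactor (w w' : ℂ) : ℂ := 1 / ((w - w⁻¹) * (w' - w'⁻¹))

theorem edgeFactor_comm (w w' : ℂ) : edgeFactor w w' = edgeFactor w' w := by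
  unfold edgeFactor
  rw [mul_comm]

/-- The integrand `∏ⱼ g(wⱼ) ∏_{(k,ℓ) ∈ E} f(w_k, w_ℓ) Θ_M(q; w) ∏ⱼ wⱼ⁻¹`. -/
def plumbingIntegrand {n : ℕ} (G : SimpleGraph (Fin n)) [DecidableRel G.Adj] (a : Fin n → ℤ)
    (τ : ℂ) (w : Fin n → ℂ) : ℂ :=
  (∏ j, vertexFactor (w j)) *
    (∏ e ∈ G.edgeFinset,
      Sym2.lift ⟨fun k l => edgeFactor (w k) (w l), fun _ _ => edgeFactor_comm _ _⟩ e) *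
    plumbingTheta (plumbingMatrix G a) τ w * ∏ j, (w j)⁻¹

/-- The torus points whose coordinates all have distance at least `ε` from the possible poles
`1` and `-1`. -/
def pvRegion (n : ℕ) (ε : ℝ) : Set (Fin n → ℂ) :=
  {w | ∀ j, ε ≤ ‖w j - 1‖ ∧ ε ≤ ‖w j + 1‖}

/-- The integral that defines `Z(q)`, with normalization, over the part of the torus `|wⱼ| = 1`
that is left when symmetric `ε`-neighbourhoods of the poles are cut out. -/
def plumbingZTrunc {n : ℕ} (G : SimpleGraph (Fin n)) [DecidableRel G.Adj] (a : Fin n → ℤ)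
    (τ : ℂ) (ε : ℝ) : ℂ :=
  qPow τ ((-3 * (n : ℝ) + ((plumbingMatrix G a).trace : ℝ)) / 2) / (2 * Real.pi * I) ^ n *
    torusIntegral ((pvRegion n ε).indicator (plumbingIntegrand G a τ)) 0 (fun _ => 1)

/-- `Z(q)` for `q = exp (2πiτ)`: the Cauchy principal value, that is, the limit of the truncated
integrals as `ε → 0⁺`. -/
def plumbingZ {n : ℕ} (G : SimpleGraph (Fin n)) [DecidableRel G.Adj] (a : Fin n → ℤ)
    (τ : ℂ) : ℂ :=
  limUnder (𝓝[>] (0 : ℝ)) (plumbingZTrunc G a τ)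

/-- `Z(q)` is well defined: the theta series converges absolutely on the torus, the truncated
integrals exist, and the principal value exists. -/
def PlumbingZConverges {n : ℕ} (G : SimpleGraph (Fin n)) [DecidableRel G.Adj] (a : Fin n → ℤ)
    (τ : ℂ) : Prop :=
  (∀ w : Fin n → ℂ, (∀ j, ‖w j‖ = 1) →
    Summable fun m : plumbingLattice (plumbingMatrix G a) =>
      thetaTerm (plumbingMatrix G a) τ w m) ∧
  (∀ ε : ℝ, 0 < ε →
    TorusIntegrable ((pvRegion n ε).indicator (plumbingIntegrand G a τ)) 0 (fun _ => 1)) ∧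
  Tendsto (plumbingZTrunc G a τ) (𝓝[>] 0) (𝓝 (plumbingZ G a τ))

/-- The Dynkin diagram `D_{N+2}`, `N ≥ 2`. In the numbering `0, …, N + 1` of the vertices it is the
path `0 - 1 - ⋯ - N` together with one more leaf `N + 1` that is joined to `N - 1`. -/
def dynkinD (N : ℕ) : SimpleGraph (Fin (N + 2)) where
  Adj i j :=
    (i.val + 1 = j.val ∧ j.val ≤ N) ∨ (j.val + 1 = i.val ∧ i.val ≤ N) ∨
    (i.val + 1 = N ∧ j.val = N + 1) ∨ (j.val + 1 = N ∧ i.val = N + 1)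
  symm := ⟨fun i j h => by omega⟩
  loopless := ⟨fun i h => by omega⟩

instance (N : ℕ) : DecidableRel (dynkinD N).Adj := fun i j =>
  inferInstanceAs (Decidable
    ((i.val + 1 = j.val ∧ j.val ≤ N) ∨ (j.val + 1 = i.val ∧ i.val ≤ N) ∨
    (i.val + 1 = N ∧ j.val = N + 1) ∨ (j.val + 1 = N ∧ i.val = N + 1)))

/-- `Z_{D_{N+2}}(q)` for `q = exp (2πiτ)`: all framing coefficients are `2`. -/
def ZD (N : ℕ) (τ : ℂ) : ℂ := plumbingZ (dynkinD N) (fun _ => 2) τ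

/-! ### False theta functions -/

/-- `sgn*`: the sign with `sgn*(0) = 1`. -/
def sgnStar (m : ℤ) : ℤ := if m = 0 then 1 else m.sign

/-- The terms `sgn*(m) q^{(m + j/(2p))²}` of `F_{j,p}`. -/
def falseThetaTerm (j p : ℤ) (τ : ℂ) (m : ℤ) : ℂ :=
  (sgnStar m : ℂ) * qPow τ (((m : ℝ) + (j : ℝ) / (2 * (p : ℝ))) ^ 2)

/-- The false theta function `F_{j,p}(τ)`. -/
def falseTheta (j p : ℤ) (τ : ℂ) : ℂ := ∑' m : ℤ, falseThetaTerm j p τ m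

/-- The terms `sgn(m) q^{(m² - 1)/(2N)}`. -/
def sgnTerm (N : ℕ) (τ : ℂ) (m : ℤ) : ℂ :=
  (m.sign : ℂ) * qPow τ (((m : ℝ) ^ 2 - 1) / (2 * (N : ℝ)))

/-- The sum of `sgn(m) q^{(m² - 1)/(2N)}` over all integers `m ≡ r (mod 2N)`. -/
def sgnSum (N : ℕ) (r : ℤ) (τ : ℂ) : ℂ :=
  ∑' m : {m : ℤ // m ≡ r [ZMOD 2 * (N : ℤ)]}, sgnTerm N τ m

/-! ### Quantum modular forms -/

/-- Möbius action of `γ` on a number `z` of a field. -/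
def moebius {K : Type*} [Field K] (γ : Matrix.SpecialLinearGroup (Fin 2) ℤ) (z : K) : K :=
  ((γ 0 0 : K) * z + (γ 0 1 : K)) / ((γ 1 0 : K) * z + (γ 1 1 : K))

/-- The automorphy factor `(cz + d) ^ k` on the lower half-plane, principal branch. -/
def autFactorLower (k : ℝ) (γ : Matrix.SpecialLinearGroup (Fin 2) ℤ) (z : ℂ) : ℂ :=
  ((γ 1 0 : ℂ) * z + (γ 1 1 : ℂ)) ^ (k : ℂ)

/-- The automorphy factor `(cx + d) ^ k` at a real point `x` with `cx + d ≠ 0`: the boundary value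
of the principal branch of `(cz + d) ^ k` on the lower half-plane. If `cx + d < 0`, then `cz + d`
has argument close to `-π` for `c > 0`, and to `π` for `c < 0`, when `z` in the lower half-plane is
close to `x`. (For `k ∉ ℤ` a branch has to be chosen on the negative axis; this is the one for
which the factor is continuous up to the real line from the lower half-plane, for either sign of
`c`.) -/
def autFactorReal (k : ℝ) (γ : Matrix.SpecialLinearGroup (Fin 2) ℤ) (x : ℝ) : ℂ :=
  if 0 ≤ (γ 1 0 : ℝ) * x + (γ 1 1 : ℝ) then
    ((((γ 1 0 : ℝ) * x + (γ 1 1 : ℝ)) ^ k : ℝ) : ℂ)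
  else
    (((-((γ 1 0 : ℝ) * x + (γ 1 1 : ℝ))) ^ k : ℝ) : ℂ) *
      (if 0 < γ 1 0 then cexp (-(Real.pi * k * I)) else cexp (Real.pi * k * I))

/-- `v` is a multiplier system of weight `k` on `Γ`. -/
def IsMultiplierSystem (k : ℝ) (Γ : Subgroup (Matrix.SpecialLinearGroup (Fin 2) ℤ))
    (v : Matrix.SpecialLinearGroup (Fin 2) ℤ → ℂ) : Prop :=
  (∀ γ ∈ Γ, ‖v γ‖ = 1) ∧
  ∀ γ₁ ∈ Γ, ∀ γ₂ ∈ Γ, ∀ z : ℂ, z.im < 0 →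
    v (γ₁ * γ₂) * autFactorLower k (γ₁ * γ₂) z =
      v γ₁ * v γ₂ * (autFactorLower k γ₁ (moebius γ₂ z) * autFactorLower k γ₂ z)

/-- `f`, a function on the set `S` of rational numbers, is a quantum modular form of weight `k` on
`Γ` with multiplier system `v`: for all `γ = (a b; c d)` in `Γ`, the obstruction to modularity
`f(x) - v(γ)⁻¹ (cx + d)^{-k} f(γx)`, `x ∈ S ∖ {-d/c}`, extends to a real-analytic function on
`ℝ ∖ {-d/c}`. -/
def IsQuantumModularOn (k : ℝ) (Γ : Subgroup (Matrix.SpecialLinearGroup (Fin 2) ℤ))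
    (v : Matrix.SpecialLinearGroup (Fin 2) ℤ → ℂ) (S : Set ℚ) (f : ℚ → ℂ) : Prop :=
  IsMultiplierSystem k Γ v ∧
  ∀ γ ∈ Γ, ∃ h : ℝ → ℂ,
    AnalyticOnNhd ℝ h {x : ℝ | (γ 1 0 : ℝ) * x + (γ 1 1 : ℝ) ≠ 0} ∧
    ∀ x ∈ S, (γ 1 0 : ℚ) * x + (γ 1 1 : ℚ) ≠ 0 →
      moebius γ x ∈ S ∧
      f x - (v γ)⁻¹ * autFactorReal (-k) γ x * f (moebius γ x) = h x

/-- A function `Φ` on the upper half-plane is a quantum modular form of weight `k` with quantum set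
`S`: its vertical limits at all points of `S` exist, and they form a quantum modular form of weight
`k` on some congruence subgroup of `SL₂(ℤ)`, with some multiplier system. -/
def IsQuantumModularForm (k : ℝ) (S : Set ℚ) (Φ : ℂ → ℂ) : Prop :=
  ∃ f : ℚ → ℂ,
    (∀ x ∈ S, Tendsto (fun t : ℝ => Φ ((x : ℂ) + I * (t : ℂ))) (𝓝[>] 0) (𝓝 (f x))) ∧
    ∃ Γ : Subgroup (Matrix.SpecialLinearGroup (Fin 2) ℤ),
      CongruenceSubgroup.IsCongruenceSubgroup Γ ∧
      ∃ v : Matrix.SpecialLinearGroup (Fin 2) ℤ → ℂ, IsQuantumModularOn k Γ v S f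

end

noncomputable section

/-! ### Automorphy factors on the upper half-plane -/

/-! The theta series converges uniformly on the torus, and the truncated region is a product. Hence
the truncated integral is a sum over the lattice of products of one-variable integrals, one per
vertex: the Fourier coefficients of `(w - w⁻¹) ^ (2 - d)` on a truncated circle, `d` being the
degree (`plumbingZTrunc_eq_tsum`). For `d = 1, 2` their limits are those of Laurent polynomials. For
`d = 3` a recursion with step two in the frequency `m`, together with oddness in `m`, gives the
limit `sgn(m)/2` for odd `m` and `0` for even `m`, with the bound `|m|` for every `ε`. Since the
Cartan form is positive definite (`cartanD_form`), this bound is summable against the theta terms,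
and dominated convergence yields the principal value (`tendsto_plumbingZTrunc`).

In the limit only few lattice vectors survive. Vanishing labels at the vertices of degree two force
an arithmetic progression of step `a` along the path, and the three leaves carry signs `s₁, s₂, s₃`.
The form depends only on `a` and `s₁`; summation over `s₂, s₃` turns the trivalent factor into `sgn
a` for even `a` and `-sgn a` for odd `a`. What remains is a series over the `a` with `N a` even
(`ZD_eq_tsum`). Even `a` give `evenSeries`; odd `a`, present only for even `N`, give `-oddSeries`.
The two closed formulas are reindexings of these.

For the asymptotics, both series at `τ = it` are sums of differences `h(x - u) - h(x + u)` of a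
Gaussian `h` with `u = 1/(2N)`, at positive integers or half-integers `x`. For odd `N` the sum is
compared with the telescoping case `u = 1/2` (`tendsto_tsum_gaussDiff`). For even `N` the leading
terms cancel, and the next order comes from summing third differences with step `1/2`
(`tendsto_alternating_tsum_gaussDiff`).

For quantum modularity, each signed theta series is an Eichler integral of a unary theta series `g`
of weight `3/2` (`signedTheta_eq_integral`), and its limit at a rational `x` is a constant times the
integral of `g(x + iy) y ^ (-1/2)`. The substitution `γ` turns the integral at `γx` into one from
`x` to `-d/c` with the kernel that belongs to `x`. By path independence the obstruction is the
integral over the vertical line at `-d/c` (`eichlerIntegral_sub_eq`), which is real-analytic in `x ≠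
-d/c`.

This requires cusp bounds for `g` at every rational number and one multiplier for all the unary
series. Both come from writing them as `z`-derivatives at `0` of an odd Jacobi theta function with
characteristics, whose transformation law for the full modular group follows from the generators `S`
and `T` (`exists_oddThetaLaw`). A leftover monomial in `q` is harmless, being analytic itself. -/

/-- The denominator `cτ + d` of the Möbius action. -/
def moebiusDenom (γ : Matrix.SpecialLinearGroup (Fin 2) ℤ) (τ : ℂ) : ℂ :=
  (γ 1 0 : ℂ) * τ + (γ 1 1 : ℂ)

theorem det_entries (γ : Matrix.SpecialLinearGroup (Fin 2) ℤ) :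
    γ 0 0 * γ 1 1 - γ 0 1 * γ 1 0 = 1 := by
  have h := γ.det_coe
  rwa [Matrix.det_fin_two] at h

theorem det_entries_complex (γ : Matrix.SpecialLinearGroup (Fin 2) ℤ) :
    (γ 0 0 : ℂ) * γ 1 1 - (γ 0 1 : ℂ) * γ 1 0 = 1 := by
  exact_mod_cast det_entries γ

theorem moebiusDenom_im (γ : Matrix.SpecialLinearGroup (Fin 2) ℤ) (τ : ℂ) :
    (moebiusDenom γ τ).im = (γ 1 0 : ℝ) * τ.im := by
  simp [moebiusDenom]

theorem moebiusDenom_re (γ : Matrix.SpecialLinearGroup (Fin 2) ℤ) (τ : ℂ) :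
    (moebiusDenom γ τ).re = (γ 1 0 : ℝ) * τ.re + (γ 1 1 : ℝ) := by
  simp [moebiusDenom]

theorem moebiusDenom_ne_zero (γ : Matrix.SpecialLinearGroup (Fin 2) ℤ) {τ : ℂ} (hτ : τ.im ≠ 0) :
    moebiusDenom γ τ ≠ 0 := by
  intro h
  have h1 : (γ 1 0 : ℝ) * τ.im = 0 := by rw [← moebiusDenom_im, h, Complex.zero_im]
  have h2 : (γ 1 0 : ℝ) * τ.re + (γ 1 1 : ℝ) = 0 := by rw [← moebiusDenom_re, h, Complex.zero_re]
  have h3 : (γ 1 0 : ℝ) = 0 := by simpa [hτ] using h1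
  have h4 : (γ 1 1 : ℝ) = 0 := by simpa [h3] using h2
  have h5 := det_entries γ
  rw [Int.cast_eq_zero.1 h3, Int.cast_eq_zero.1 h4] at h5
  simp at h5

theorem moebius_eq_div (γ : Matrix.SpecialLinearGroup (Fin 2) ℤ) (τ : ℂ) :
    moebius γ τ = ((γ 0 0 : ℂ) * τ + (γ 0 1 : ℂ)) / moebiusDenom γ τ := rfl

theorem moebius_im (γ : Matrix.SpecialLinearGroup (Fin 2) ℤ) (τ : ℂ) :
    (moebius γ τ).im = τ.im / normSq (moebiusDenom γ τ) := by
  have h : (γ 0 0 : ℝ) * γ 1 1 - (γ 0 1 : ℝ) * γ 1 0 = 1 := by exact_mod_cast det_entries γ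
  rw [moebius_eq_div, Complex.div_im, moebiusDenom_re, moebiusDenom_im, ← sub_div]
  congr 1
  simp
  linear_combination τ.im * h

theorem moebius_im_pos (γ : Matrix.SpecialLinearGroup (Fin 2) ℤ) {τ : ℂ} (hτ : 0 < τ.im) :
    0 < (moebius γ τ).im := by
  rw [moebius_im]
  exact div_pos hτ (normSq_pos.2 (moebiusDenom_ne_zero γ hτ.ne'))

theorem moebiusDenom_mul (γ₁ γ₂ : Matrix.SpecialLinearGroup (Fin 2) ℤ) {τ : ℂ}
    (hτ : moebiusDenom γ₂ τ ≠ 0) :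
    moebiusDenom (γ₁ * γ₂) τ = moebiusDenom γ₁ (moebius γ₂ τ) * moebiusDenom γ₂ τ := by
  conv_rhs => rw [moebiusDenom, moebius_eq_div, add_mul, mul_assoc, div_mul_cancel₀ _ hτ]
  simp only [moebiusDenom, Matrix.SpecialLinearGroup.coe_mul, Matrix.mul_apply, Fin.sum_univ_two]
  push_cast
  ring

theorem moebius_mul (γ₁ γ₂ : Matrix.SpecialLinearGroup (Fin 2) ℤ) {τ : ℂ}
    (hτ : moebiusDenom γ₂ τ ≠ 0) :
    moebius (γ₁ * γ₂) τ = moebius γ₁ (moebius γ₂ τ) := by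
  have key : ((γ₁ * γ₂) 0 0 : ℂ) * τ + ((γ₁ * γ₂) 0 1 : ℂ) =
      ((γ₁ 0 0 : ℂ) * moebius γ₂ τ + (γ₁ 0 1 : ℂ)) * moebiusDenom γ₂ τ := by
    rw [moebius_eq_div, add_mul, mul_assoc, div_mul_cancel₀ _ hτ]
    simp only [moebiusDenom, Matrix.SpecialLinearGroup.coe_mul, Matrix.mul_apply, Fin.sum_univ_two]
    push_cast
    ring
  rw [moebius_eq_div, moebiusDenom_mul _ _ hτ, key, moebius_eq_div γ₁, mul_div_mul_right _ _ hτ]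

theorem moebiusDenom_one (τ : ℂ) : moebiusDenom 1 τ = 1 := by simp [moebiusDenom]

theorem moebius_one (τ : ℂ) : moebius (1 : Matrix.SpecialLinearGroup (Fin 2) ℤ) τ = τ := by
  simp [moebius]

theorem continuousOn_moebius (γ : Matrix.SpecialLinearGroup (Fin 2) ℤ) :
    ContinuousOn (fun τ : ℂ => moebius γ τ) {τ | 0 < τ.im} := by
  unfold moebius
  refine ContinuousOn.div (by fun_prop) (by fun_prop) fun τ hτ => ?_
  exact moebiusDenom_ne_zero γ (ne_of_gt hτ)

/-- The principal branch of `(cτ + d) ^ (1/2)` is continuous on the upper half-plane. -/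
theorem continuousOn_moebiusDenom_cpow (γ : Matrix.SpecialLinearGroup (Fin 2) ℤ) (k : ℂ) :
    ContinuousOn (fun τ : ℂ => moebiusDenom γ τ ^ k) {τ | 0 < τ.im} := by
  rcases eq_or_ne (γ 1 0) 0 with h | h
  · have : (fun τ : ℂ => moebiusDenom γ τ ^ k) = fun _ => (γ 1 1 : ℂ) ^ k := by
      funext τ; simp [moebiusDenom, h]
    rw [this]; exact continuousOn_const
  · intro τ hτ
    refine ContinuousAt.continuousWithinAt (ContinuousAt.cpow ?_ continuousAt_const ?_)
    · unfold moebiusDenom; fun_prop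
    · refine Or.inr ?_
      rw [moebiusDenom_im]
      exact mul_ne_zero (Int.cast_ne_zero.2 h) (ne_of_gt hτ)

theorem cpow_half_mul_self {z : ℂ} (hz : z ≠ 0) : z ^ (1 / 2 : ℂ) * z ^ (1 / 2 : ℂ) = z := by
  rw [← cpow_add _ _ hz]; norm_num

theorem cpow_half_sq {z : ℂ} (hz : z ≠ 0) : (z ^ (1 / 2 : ℂ)) ^ 2 = z := by
  rw [sq, cpow_half_mul_self hz]

theorem cpow_half_ne_zero {z : ℂ} (hz : z ≠ 0) : z ^ (1 / 2 : ℂ) ≠ 0 := by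
  simp [cpow_eq_zero_iff, hz]

theorem isPreconnected_upperHalf : IsPreconnected {τ : ℂ | 0 < τ.im} :=
  (convex_halfSpace_im_gt 0).isPreconnected

/-- Both sides are continuous square roots of the same nonvanishing function, by the cocycle
relation for `cτ + d`. On the connected upper half-plane they therefore differ by one constant sign.
-/
theorem exists_sign_cpow_half (γ₁ γ₂ : Matrix.SpecialLinearGroup (Fin 2) ℤ) :
    ∃ σ : ℂ, ‖σ‖ = 1 ∧ starRingEnd ℂ σ = σ ∧ ∀ τ : ℂ, 0 < τ.im →
      moebiusDenom γ₁ (moebius γ₂ τ) ^ (1 / 2 : ℂ) * moebiusDenom γ₂ τ ^ (1 / 2 : ℂ) =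
        σ * moebiusDenom (γ₁ * γ₂) τ ^ (1 / 2 : ℂ) := by
  have hne : ∀ τ : ℂ, 0 < τ.im → moebiusDenom γ₂ τ ≠ 0 := fun τ h =>
    moebiusDenom_ne_zero _ h.ne'
  have hc1 : ContinuousOn (fun τ : ℂ => moebiusDenom γ₁ (moebius γ₂ τ) ^ (1 / 2 : ℂ) *
      moebiusDenom γ₂ τ ^ (1 / 2 : ℂ)) {τ | 0 < τ.im} :=
    ((continuousOn_moebiusDenom_cpow γ₁ _).comp (continuousOn_moebius γ₂)
      fun τ hτ => moebius_im_pos γ₂ hτ).mul (continuousOn_moebiusDenom_cpow γ₂ _)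
  have hc2 := continuousOn_moebiusDenom_cpow (γ₁ * γ₂) (1 / 2)
  have hsq : EqOn ((fun τ : ℂ => moebiusDenom γ₁ (moebius γ₂ τ) ^ (1 / 2 : ℂ) *
      moebiusDenom γ₂ τ ^ (1 / 2 : ℂ)) ^ 2)
      ((fun τ : ℂ => moebiusDenom (γ₁ * γ₂) τ ^ (1 / 2 : ℂ)) ^ 2) {τ | 0 < τ.im} := by
    intro τ hτ
    simp only [Pi.pow_apply]
    rw [mul_pow, cpow_half_sq (moebiusDenom_ne_zero _ (moebius_im_pos γ₂ hτ).ne'),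
      cpow_half_sq (hne τ hτ), cpow_half_sq (moebiusDenom_ne_zero _ (ne_of_gt hτ)),
      moebiusDenom_mul _ _ (hne τ hτ)]
  rcases isPreconnected_upperHalf.eq_or_eq_neg_of_sq_eq hc1 hc2 hsq
    (fun {τ} hτ => cpow_half_ne_zero (moebiusDenom_ne_zero _ (ne_of_gt hτ))) with h | h
  · exact ⟨1, by simp, by simp, fun τ hτ => by rw [one_mul]; exact h hτ⟩
  · exact ⟨-1, by simp, by simp, fun τ hτ => by rw [neg_one_mul]; exact h hτ⟩

/-! ### The odd Jacobi theta function -/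

/-- The odd Jacobi theta function, up to a constant factor. -/
def oddTheta (z τ : ℂ) : ℂ :=
  cexp (Real.pi * I * (τ / 4 + z)) * jacobiTheta₂ (z + τ / 2 + 1 / 2) τ

/-- `oddTheta` transforms under `γ` as a Jacobi form of weight and index `1/2`, with
multiplier `κ`. -/
def OddThetaLaw (γ : Matrix.SpecialLinearGroup (Fin 2) ℤ) (κ : ℂ) : Prop :=
  ∀ z τ : ℂ, 0 < τ.im → oddTheta (z / moebiusDenom γ τ) (moebius γ τ) =
    κ * moebiusDenom γ τ ^ (1 / 2 : ℂ) *
      cexp (Real.pi * I * ((γ 1 0 : ℂ) * z ^ 2 / moebiusDenom γ τ)) * oddTheta z τ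

theorem oddThetaLaw_one : OddThetaLaw 1 1 := by
  intro z τ _
  simp [moebiusDenom_one, moebius_one]

theorem oddThetaLaw_T : OddThetaLaw ModularGroup.T (cexp (Real.pi * I * (1 / 4))) := by
  intro z τ _
  have hJ : moebiusDenom ModularGroup.T τ = 1 := by simp [moebiusDenom, ModularGroup.T]
  have hm : moebius ModularGroup.T τ = τ + 1 := by
    rw [moebius_eq_div, hJ]; simp [ModularGroup.T]
  have h1 : jacobiTheta₂ (z + (τ + 1) / 2 + 1 / 2) (τ + 1) =
      jacobiTheta₂ (z + τ / 2 + 1 / 2) τ := by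
    rw [show z + (τ + 1) / 2 + 1 / 2 = (z + τ / 2) + 1 by ring, jacobiTheta₂_add_left]
    refine tsum_congr fun n => ?_
    rw [jacobiTheta₂_term, jacobiTheta₂_term, Complex.exp_eq_exp_iff_exists_int]
    -- The two exponents differ by `πi n(n - 1)`, which is a multiple of `2πi`.
    obtain ⟨k, hk⟩ := Int.even_mul_pred_self n
    refine ⟨k, ?_⟩
    have hk' : (n : ℂ) * (n - 1) = k + k := by exact_mod_cast hk
    linear_combination (Real.pi * I : ℂ) * hk'
  rw [hJ, hm]
  simp only [oddTheta, div_one]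
  rw [h1]
  have hT : ModularGroup.T 1 0 = 0 := by simp [ModularGroup.T]
  rw [hT]
  simp only [Int.cast_zero, zero_mul, mul_zero, Complex.exp_zero, one_cpow, mul_one]
  rw [← mul_assoc, ← Complex.exp_add]
  ring_nf

/-- For `τ` in the upper half-plane the arguments of `-i` and `τ` add up without leaving the
principal range, so the logarithm is additive. -/
theorem neg_I_mul_cpow_half {τ : ℂ} (hτ : 0 < τ.im) :
    (-I * τ) ^ (1 / 2 : ℂ) = cexp (-(Real.pi * I * (1 / 4))) * τ ^ (1 / 2 : ℂ) := by
  have h0 : τ ≠ 0 := fun h => by simp [h] at hτ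
  have h1 : 0 < τ.arg := by
    rcases (Complex.arg_nonneg_iff.2 hτ.le).lt_or_eq with h | h
    · exact h
    · exact absurd (Complex.arg_eq_zero_iff.1 h.symm).2 hτ.ne'
  rw [cpow_def_of_ne_zero (mul_ne_zero (by simp) h0), cpow_def_of_ne_zero h0,
    Complex.log_mul (by simp) h0, ← Complex.exp_add]
  · rw [Complex.log_neg_I]; ring_nf
  · rw [Complex.arg_neg_I]
    have := Complex.arg_le_pi τ
    constructor <;> linarith [Real.pi_pos]

theorem oddThetaLaw_S : OddThetaLaw ModularGroup.S (cexp (-(Real.pi * I * (3 / 4)))) := by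
  intro z τ hτ
  have h0 : τ ≠ 0 := fun h => by simp [h] at hτ
  have hJ : moebiusDenom ModularGroup.S τ = τ := by simp [moebiusDenom, ModularGroup.S]
  have hm : moebius ModularGroup.S τ = -1 / τ := by
    rw [moebius_eq_div, hJ]; simp [ModularGroup.S]
  have hS : ModularGroup.S 1 0 = 1 := by simp [ModularGroup.S]
  rw [hJ, hm, hS]
  set w := z + τ / 2 + 1 / 2 with hw
  -- The argument on the left exceeds `w / τ` by exactly one quasi-period `-1 / τ`; after this shift
  -- Jacobi's inversion formula applies at `w`.
  have h1 : jacobiTheta₂ (z / τ + -1 / τ / 2 + 1 / 2) (-1 / τ) =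
      cexp (-Real.pi * I * (-1 / τ + 2 * (w / τ))) * jacobiTheta₂ (w / τ) (-1 / τ) := by
    rw [← jacobiTheta₂_add_left']
    congr 1
    rw [hw]; field_simp; ring
  have h2 := jacobiTheta₂_functional_equation w τ
  have h3 : (-I * τ) ^ (1 / 2 : ℂ) ≠ 0 := cpow_half_ne_zero (mul_ne_zero (by simp) h0)
  have h4 : jacobiTheta₂ (w / τ) (-1 / τ) =
      (-I * τ) ^ (1 / 2 : ℂ) * cexp (Real.pi * I * w ^ 2 / τ) * jacobiTheta₂ w τ := by
    rw [h2]
    have : cexp (Real.pi * I * w ^ 2 / τ) * cexp (-Real.pi * I * w ^ 2 / τ) = 1 := by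
      rw [← Complex.exp_add]; ring_nf; simp
    calc _ = ((-I * τ) ^ (1 / 2 : ℂ) * (1 / (-I * τ) ^ (1 / 2 : ℂ))) *
          (cexp (Real.pi * I * w ^ 2 / τ) * cexp (-Real.pi * I * w ^ 2 / τ)) *
          jacobiTheta₂ (w / τ) (-1 / τ) := by rw [this, mul_one_div_cancel h3]; ring
      _ = _ := by ring
  simp only [oddTheta]
  rw [h1, h4, neg_I_mul_cpow_half hτ, ← hw]
  have h5 : cexp (Real.pi * I * (-1 / τ / 4 + z / τ)) * cexp (-Real.pi * I * (-1 / τ + 2 * (w / τ)))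
      * cexp (-(Real.pi * I * (1 / 4))) * cexp (Real.pi * I * w ^ 2 / τ) =
      cexp (-(Real.pi * I * (3 / 4))) * cexp (Real.pi * I * (((1 : ℤ) : ℂ) * z ^ 2 / τ)) *
        cexp (Real.pi * I * (τ / 4 + z)) := by
    simp only [← Complex.exp_add]
    congr 1
    rw [hw]; push_cast; field_simp; ring
  linear_combination (τ ^ (1 / 2 : ℂ) * jacobiTheta₂ w τ) * h5

/-- The quadratic exponents are compatible because `c₁₂ J₂ = c₁ + c₂ J₁ J₂`, a consequence of `det
γ₂ = 1`. Only the square roots fail to be multiplicative, and `σ` records that failure. -/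
theorem OddThetaLaw.mul_apply {γ₁ γ₂ : Matrix.SpecialLinearGroup (Fin 2) ℤ} {κ₁ κ₂ σ : ℂ}
    (h₁ : OddThetaLaw γ₁ κ₁) (h₂ : OddThetaLaw γ₂ κ₂)
    (hs : ∀ τ : ℂ, 0 < τ.im →
      moebiusDenom γ₁ (moebius γ₂ τ) ^ (1 / 2 : ℂ) * moebiusDenom γ₂ τ ^ (1 / 2 : ℂ) =
        σ * moebiusDenom (γ₁ * γ₂) τ ^ (1 / 2 : ℂ)) :
    OddThetaLaw (γ₁ * γ₂) (κ₁ * κ₂ * σ) := by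
  intro z τ hτ
  have hJ2 := moebiusDenom_ne_zero γ₂ hτ.ne'
  have hJ1 := moebiusDenom_ne_zero γ₁ (moebius_im_pos γ₂ hτ).ne'
  have e1 := h₁ (z / moebiusDenom γ₂ τ) (moebius γ₂ τ) (moebius_im_pos γ₂ hτ)
  rw [h₂ z τ hτ, div_div, mul_comm (moebiusDenom γ₂ τ), ← moebiusDenom_mul _ _ hJ2,
    ← moebius_mul _ _ hJ2] at e1
  rw [e1]
  have hx : cexp (Real.pi * I * (((γ₁ * γ₂) 1 0 : ℤ) * z ^ 2 / moebiusDenom (γ₁ * γ₂) τ)) =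
      cexp (Real.pi * I * ((γ₁ 1 0 : ℂ) * (z / moebiusDenom γ₂ τ) ^ 2 /
        moebiusDenom γ₁ (moebius γ₂ τ))) *
      cexp (Real.pi * I * ((γ₂ 1 0 : ℂ) * z ^ 2 / moebiusDenom γ₂ τ)) := by
    rw [← Complex.exp_add, moebiusDenom_mul _ _ hJ2]
    congr 1
    have hc : (((γ₁ * γ₂) 1 0 : ℤ) : ℂ) * moebiusDenom γ₂ τ = (γ₁ 1 0 : ℂ) +
        (γ₂ 1 0 : ℂ) * (moebiusDenom γ₁ (moebius γ₂ τ) * moebiusDenom γ₂ τ) := by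
      rw [← moebiusDenom_mul _ _ hJ2]
      simp only [moebiusDenom, Matrix.SpecialLinearGroup.coe_mul, Matrix.mul_apply,
        Fin.sum_univ_two]
      push_cast
      linear_combination (γ₁ 1 0 : ℂ) * det_entries_complex γ₂
    field_simp
    linear_combination z ^ 2 * hc
  rw [hx]
  linear_combination (κ₁ * κ₂ * cexp (Real.pi * I * ((γ₁ 1 0 : ℂ) * (z / moebiusDenom γ₂ τ) ^ 2 /
        moebiusDenom γ₁ (moebius γ₂ τ))) *
      cexp (Real.pi * I * ((γ₂ 1 0 : ℂ) * z ^ 2 / moebiusDenom γ₂ τ)) * oddTheta z τ) * hs τ hτ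

theorem OddThetaLaw.mul {γ₁ γ₂ : Matrix.SpecialLinearGroup (Fin 2) ℤ} {κ₁ κ₂ : ℂ}
    (h₁ : OddThetaLaw γ₁ κ₁) (h₂ : OddThetaLaw γ₂ κ₂) (hκ₁ : ‖κ₁‖ = 1) (hκ₂ : ‖κ₂‖ = 1) :
    ∃ κ : ℂ, ‖κ‖ = 1 ∧ OddThetaLaw (γ₁ * γ₂) κ := by
  obtain ⟨σ, hσ, -, hs⟩ := exists_sign_cpow_half γ₁ γ₂
  exact ⟨κ₁ * κ₂ * σ, by simp [hκ₁, hκ₂, hσ], h₁.mul_apply h₂ hs⟩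

/-- The law for `γ`, applied at the point `γ⁻¹τ`, is solved for the value there. The quadratic
exponentials cancel because `γ γ⁻¹ = 1`. -/
theorem OddThetaLaw.inv {γ : Matrix.SpecialLinearGroup (Fin 2) ℤ} {κ : ℂ}
    (h : OddThetaLaw γ κ) (hκ : ‖κ‖ = 1) : ∃ κ' : ℂ, ‖κ'‖ = 1 ∧ OddThetaLaw γ⁻¹ κ' := by
  obtain ⟨σ, hσ, -, hs⟩ := exists_sign_cpow_half γ γ⁻¹
  have hκ0 : κ ≠ 0 := fun h => by simp [h] at hκ
  have hσ0 : σ ≠ 0 := fun h => by simp [h] at hσ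
  refine ⟨(κ * σ)⁻¹, by simp [hκ, hσ], fun z τ hτ => ?_⟩
  have hJ := moebiusDenom_ne_zero γ⁻¹ hτ.ne'
  have hJ' := moebiusDenom_ne_zero γ (moebius_im_pos γ⁻¹ hτ).ne'
  have e := h (z / moebiusDenom γ⁻¹ τ) (moebius γ⁻¹ τ) (moebius_im_pos γ⁻¹ hτ)
  have hmul := moebiusDenom_mul γ γ⁻¹ hJ
  have hmm := moebius_mul γ γ⁻¹ hJ
  have hs' := hs τ hτ
  rw [mul_inv_cancel, moebiusDenom_one] at hmul hs'
  rw [mul_inv_cancel, moebius_one] at hmm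
  rw [div_div, mul_comm (moebiusDenom γ⁻¹ τ), ← hmul, div_one, ← hmm] at e
  have hc : ((γ⁻¹ 1 0 : ℤ) : ℂ) = -(γ 1 0 : ℂ) := by
    simp [Matrix.SpecialLinearGroup.SL2_inv_expl]
  have hx : cexp (Real.pi * I * ((γ 1 0 : ℂ) * (z / moebiusDenom γ⁻¹ τ) ^ 2 /
        moebiusDenom γ (moebius γ⁻¹ τ))) *
      cexp (Real.pi * I * (((γ⁻¹ 1 0 : ℤ) : ℂ) * z ^ 2 / moebiusDenom γ⁻¹ τ)) = 1 := by
    rw [← Complex.exp_add, hc, show moebiusDenom γ (moebius γ⁻¹ τ) = 1 / moebiusDenom γ⁻¹ τ by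
      rw [hmul, mul_div_cancel_right₀ _ hJ]]
    convert Complex.exp_zero using 2
    field_simp
    ring
  rw [e]
  rw [one_cpow, mul_one] at hs'
  calc _ = oddTheta (z / moebiusDenom γ⁻¹ τ) (moebius γ⁻¹ τ) *
        ((κ * σ)⁻¹ * κ * (moebiusDenom γ (moebius γ⁻¹ τ) ^ (1 / 2 : ℂ) *
          moebiusDenom γ⁻¹ τ ^ (1 / 2 : ℂ)) *
        (cexp (Real.pi * I * ((γ 1 0 : ℂ) * (z / moebiusDenom γ⁻¹ τ) ^ 2 /
        moebiusDenom γ (moebius γ⁻¹ τ))) *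
        cexp (Real.pi * I * (((γ⁻¹ 1 0 : ℤ) : ℂ) * z ^ 2 / moebiusDenom γ⁻¹ τ)))) := by
        rw [hs', hx]; field_simp
    _ = _ := by ring

/-- The odd theta function is a Jacobi form for the full modular group. -/
theorem exists_oddThetaLaw (γ : Matrix.SpecialLinearGroup (Fin 2) ℤ) :
    ∃ κ : ℂ, ‖κ‖ = 1 ∧ OddThetaLaw γ κ := by
  have hγ : γ ∈ Subgroup.closure {ModularGroup.S, ModularGroup.T} := by
    simp [SpecialLinearGroup.SL2Z_generators]
  have hexp : ∀ r : ℝ, ‖cexp (Real.pi * I * r)‖ = 1 := fun r => by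
    rw [show (Real.pi * I * r : ℂ) = ((Real.pi * r : ℝ) : ℂ) * I by push_cast; ring]
    exact Complex.norm_exp_ofReal_mul_I _
  induction hγ using Subgroup.closure_induction with
  | mem x hx =>
    rcases hx with rfl | rfl
    · refine ⟨_, ?_, oddThetaLaw_S⟩
      have := hexp (-(3 / 4))
      push_cast at this
      rwa [mul_neg] at this
    · refine ⟨_, ?_, oddThetaLaw_T⟩
      have := hexp (1 / 4)
      push_cast at this
      exact this
  | one => exact ⟨1, by simp, oddThetaLaw_one⟩
  | mul x y _ _ hx hy =>
    obtain ⟨κ₁, h1, h1'⟩ := hx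
    obtain ⟨κ₂, h2, h2'⟩ := hy
    exact h1'.mul h2' h1 h2
  | inv x _ hx =>
    obtain ⟨κ, h1, h1'⟩ := hx
    exact h1'.inv h1

/-! ### Theta functions with real characteristics -/

/-- The odd theta function with characteristics `(α, β)`. -/
def charTheta (α β : ℝ) (z τ : ℂ) : ℂ :=
  cexp (Real.pi * I * (α ^ 2 * τ + 2 * α * z)) * oddTheta (z + α * τ + β) τ

/-- The terms of the `z`-derivative of `charTheta α β` at `z = 0`. -/
def charThetaDerivTerm (α β : ℝ) (τ : ℂ) (n : ℤ) : ℂ :=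
  2 * Real.pi * I * (n + (α + 1 / 2 : ℝ)) * cexp (Real.pi * I * (n + 2 * (n + 1 / 2) * β)) *
    cexp (Real.pi * I * (n + (α + 1 / 2 : ℝ)) ^ 2 * τ)

/-- The `z`-derivative of `charTheta α β` at `z = 0`. -/
def charThetaDeriv (α β : ℝ) (τ : ℂ) : ℂ := ∑' n : ℤ, charThetaDerivTerm α β τ n

theorem norm_exp_pi_I_mul_ofReal (r : ℝ) : ‖cexp (Real.pi * I * r)‖ = 1 := by
  rw [show (Real.pi * I * r : ℂ) = ((Real.pi * r : ℝ) : ℂ) * I by push_cast; ring]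
  exact Complex.norm_exp_ofReal_mul_I _

theorem norm_exp_pi_I_sq_mul (r : ℝ) (τ : ℂ) :
    ‖cexp (Real.pi * I * (r : ℂ) ^ 2 * τ)‖ = Real.exp (-Real.pi * r ^ 2 * τ.im) := by
  rw [Complex.norm_exp]
  congr 1
  rw [show (Real.pi * I * (r : ℂ) ^ 2 * τ) = ((Real.pi * r ^ 2 : ℝ) : ℂ) * (I * τ) by
    push_cast; ring, Complex.re_ofReal_mul]
  simp

theorem norm_charThetaDerivTerm (α β : ℝ) (τ : ℂ) (n : ℤ) :
    ‖charThetaDerivTerm α β τ n‖ =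
      2 * Real.pi * HurwitzKernelBounds.f_int 1 (α + 1 / 2) τ.im n := by
  have h1 : ((n : ℂ) + ((α + 1 / 2 : ℝ) : ℂ)) = ((n + (α + 1 / 2) : ℝ) : ℂ) := by push_cast; ring
  have h2 : ((n : ℂ) + 2 * (n + 1 / 2) * β) = ((n + 2 * (n + 1 / 2) * β : ℝ) : ℂ) := by
    push_cast; ring
  rw [charThetaDerivTerm, h1, h2, norm_mul, norm_mul, norm_exp_pi_I_mul_ofReal,
    norm_exp_pi_I_sq_mul, HurwitzKernelBounds.f_int]
  simp only [norm_mul, Complex.norm_I, Complex.norm_real, Real.norm_eq_abs, abs_of_pos Real.pi_pos,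
    Complex.norm_two, mul_one, pow_one]
  ring

theorem hasDerivAt_charTheta (α β : ℝ) {τ : ℂ} (hτ : 0 < τ.im) :
    HasDerivAt (fun z => charTheta α β z τ) (charThetaDeriv α β τ) 0 := by
  set w : ℂ := α * τ + β + τ / 2 + 1 / 2 with hw
  have h1 : HasDerivAt (fun z : ℂ => jacobiTheta₂ (z + w) τ) (jacobiTheta₂' w τ) 0 := by
    have := hasDerivAt_jacobiTheta₂_fst (0 + w) hτ
    rw [zero_add] at this
    have h2 : HasDerivAt (fun z : ℂ => z + w) 1 0 := (hasDerivAt_id _).add_const _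
    have h3 := HasDerivAt.comp (0 : ℂ) (by rwa [zero_add]) h2
    simpa [Function.comp_def] using h3
  set c : ℂ := α ^ 2 * τ + τ / 4 + α * τ + β with hc
  have h2 : HasDerivAt (fun z : ℂ => cexp (Real.pi * I * (c + (2 * α + 1) * z)))
      (cexp (Real.pi * I * c) * (Real.pi * I * (2 * α + 1))) 0 := by
    have h : HasDerivAt (fun z : ℂ => Real.pi * I * (c + (2 * α + 1) * z))
        (Real.pi * I * ((2 * α + 1) * 1)) 0 :=
      (((hasDerivAt_id (0 : ℂ)).const_mul _).const_add _).const_mul _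
    simpa using h.cexp
  have h3 := h2.mul h1
  have hf : (fun z => charTheta α β z τ) =
      (fun z : ℂ => cexp (Real.pi * I * (c + (2 * α + 1) * z))) *
        (fun z : ℂ => jacobiTheta₂ (z + w) τ) := by
    funext z
    simp only [charTheta, oddTheta, Pi.mul_apply]
    rw [← mul_assoc, ← Complex.exp_add]
    congr 2
    · rw [hc]; ring
    · rw [hw]; ring
  rw [hf]
  refine h3.congr_deriv (Eq.symm ?_)
  rw [charThetaDeriv, zero_add, mul_zero, add_zero]
  refine HasSum.tsum_eq ?_
  have hs := ((hasSum_jacobiTheta₂_term w hτ).mul_left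
    (cexp (Real.pi * I * c) * (Real.pi * I * (2 * α + 1)))).add
    ((hasSum_jacobiTheta₂'_term w hτ).mul_left (cexp (Real.pi * I * c)))
  refine hs.congr_fun fun n => ?_
  have hx : cexp (Real.pi * I * (n + 2 * (n + 1 / 2) * β)) *
      cexp (Real.pi * I * (n + (α + 1 / 2 : ℝ)) ^ 2 * τ) =
      cexp (Real.pi * I * c) * jacobiTheta₂_term n w τ := by
    rw [jacobiTheta₂_term, ← Complex.exp_add, ← Complex.exp_add]
    congr 1
    rw [hc, hw]; push_cast; ring
  rw [charThetaDerivTerm, mul_assoc, hx, jacobiTheta₂'_term]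
  push_cast
  ring

/-- The characteristics move as the row vector `(α, β)γ`: the point `z / J + α γτ + β` equals `w /
J` with `w = z + α'τ + β'`. The quadratic exponent of the Jacobi law at `w` then splits into the
prefactor of the new characteristics, the index factor in `z`, and a constant phase. -/
theorem charTheta_moebius {γ : Matrix.SpecialLinearGroup (Fin 2) ℤ} {κ : ℂ}
    (h : OddThetaLaw γ κ) (α β : ℝ) (z : ℂ) {τ : ℂ} (hτ : 0 < τ.im) :
    charTheta α β (z / moebiusDenom γ τ) (moebius γ τ) =
      cexp (Real.pi * I * ((α * γ 0 0 + β * γ 1 0) * (α * γ 0 1 + β * γ 1 1) - α * β)) *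
      (κ * moebiusDenom γ τ ^ (1 / 2 : ℂ) *
      cexp (Real.pi * I * ((γ 1 0 : ℂ) * z ^ 2 / moebiusDenom γ τ)) *
      charTheta (α * γ 0 0 + β * γ 1 0) (α * γ 0 1 + β * γ 1 1) z τ) := by
  have hJ := moebiusDenom_ne_zero γ hτ.ne'
  set J := moebiusDenom γ τ with hJd
  set w : ℂ := z + (α * γ 0 0 + β * γ 1 0) * τ + (α * γ 0 1 + β * γ 1 1) with hw
  have e := h w τ hτ
  have h1 : z / J + α * moebius γ τ + β = w / J := by
    rw [moebius_eq_div, ← hJd, hw]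
    field_simp
    rw [hJd, moebiusDenom]; ring
  rw [charTheta, h1, e, ← hJd, charTheta]
  push_cast
  rw [← hw]
  have hx : cexp (Real.pi * I * (α ^ 2 * moebius γ τ + 2 * α * (z / J))) *
      cexp (Real.pi * I * ((γ 1 0 : ℂ) * w ^ 2 / J)) =
      cexp (Real.pi * I * ((α * γ 0 0 + β * γ 1 0) * (α * γ 0 1 + β * γ 1 1) - α * β)) *
      cexp (Real.pi * I * ((γ 1 0 : ℂ) * z ^ 2 / J)) *
      cexp (Real.pi * I * ((α * γ 0 0 + β * γ 1 0) ^ 2 * τ +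
        2 * (α * γ 0 0 + β * γ 1 0) * z)) := by
    simp only [← Complex.exp_add]
    congr 1
    have hdet := det_entries_complex γ
    rw [moebius_eq_div, ← hJd]
    field_simp
    rw [hw, hJd, moebiusDenom]
    generalize (γ 0 0 : ℂ) = a at *
    generalize (γ 0 1 : ℂ) = b at *
    generalize (γ 1 0 : ℂ) = c at *
    generalize (γ 1 1 : ℂ) = d at *
    linear_combination (-α * (2 * z + (α * a + β * c) * τ + (α * b + β * d))) * hdet
  linear_combination (κ * J ^ (1 / 2 : ℂ) * oddTheta w τ) * hx

/-- Differentiation of the Jacobi law at `z = 0`. The index factor has derivative zero there, and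
the chain rule for `z / J` supplies the extra power of `J` that raises the weight from `1/2` to
`3/2`. -/
theorem charThetaDeriv_moebius {γ : Matrix.SpecialLinearGroup (Fin 2) ℤ} {κ : ℂ}
    (h : OddThetaLaw γ κ) (α β : ℝ) {τ : ℂ} (hτ : 0 < τ.im) :
    charThetaDeriv α β (moebius γ τ) =
      cexp (Real.pi * I * ((α * γ 0 0 + β * γ 1 0) * (α * γ 0 1 + β * γ 1 1) - α * β)) *
      (κ * (moebiusDenom γ τ * moebiusDenom γ τ ^ (1 / 2 : ℂ)) *
      charThetaDeriv (α * γ 0 0 + β * γ 1 0) (α * γ 0 1 + β * γ 1 1) τ) := by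
  have hJ := moebiusDenom_ne_zero γ hτ.ne'
  have h1 := hasDerivAt_charTheta α β (moebius_im_pos γ hτ)
  have h2 := hasDerivAt_charTheta (α * γ 0 0 + β * γ 1 0) (α * γ 0 1 + β * γ 1 1) hτ
  have h3 : HasDerivAt (fun z => charTheta α β (z / moebiusDenom γ τ) (moebius γ τ))
      (charThetaDeriv α β (moebius γ τ) * (1 / moebiusDenom γ τ)) 0 := by
    refine HasDerivAt.comp (0 : ℂ) (h₂ := fun z => charTheta α β z (moebius γ τ))
      (by rwa [zero_div]) ((hasDerivAt_id (0 : ℂ)).div_const _)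
  have h4 : HasDerivAt (fun z : ℂ => κ * moebiusDenom γ τ ^ (1 / 2 : ℂ) *
      cexp (Real.pi * I * ((γ 1 0 : ℂ) * z ^ 2 / moebiusDenom γ τ)))
      0 0 := by
    have : HasDerivAt (fun z : ℂ => Real.pi * I * ((γ 1 0 : ℂ) * z ^ 2 / moebiusDenom γ τ))
        (Real.pi * I * ((γ 1 0 : ℂ) * (2 * 0) / moebiusDenom γ τ)) 0 := by
      have h5 : HasDerivAt (fun z : ℂ => z ^ 2) (2 * 0) 0 := by
        simpa using hasDerivAt_pow 2 (0 : ℂ)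
      exact ((h5.const_mul _).div_const _).const_mul _
    simpa using this.cexp.const_mul (κ * moebiusDenom γ τ ^ (1 / 2 : ℂ))
  have h5 := (h4.mul h2).const_mul
    (cexp (Real.pi * I * ((α * γ 0 0 + β * γ 1 0) * (α * γ 0 1 + β * γ 1 1) - α * β)))
  have h6 := h3.unique (h5.congr_of_eventuallyEq
    (Eventually.of_forall fun z => charTheta_moebius h α β z hτ))
  simp only [zero_mul, zero_add, ne_eq, OfNat.ofNat_ne_zero, not_false_eq_true, zero_pow, mul_zero,
    zero_div, Complex.exp_zero, mul_one] at h6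
  rw [mul_one_div, div_eq_iff hJ] at h6
  rw [h6]
  ring

/-- The available exponential estimate holds only near infinity. On the remaining interval from `t₀`
to `T` monotonicity in `t` bounds the sum by its value at `t₀`, and the factor `exp (p T)` absorbs
the missing decay. -/
theorem exists_tsum_f_int_one_le (a : ℝ) {t₀ : ℝ} (ht₀ : 0 < t₀) :
    ∃ C δ : ℝ, 0 < C ∧ 0 < δ ∧ ∀ t, t₀ ≤ t →
      ∑' n, HurwitzKernelBounds.f_int 1 a t n ≤ C * Real.exp (-δ * t) := by
  obtain ⟨p, hp, hO⟩ := HurwitzKernelBounds.isBigO_atTop_F_int_one (a : UnitAddCircle)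
  obtain ⟨B, hB, hB'⟩ := hO.exists_pos
  obtain ⟨T, hT⟩ := eventually_atTop.1 hB'.bound
  have hF : ∀ t, HurwitzKernelBounds.F_int 1 (a : UnitAddCircle) t =
      ∑' n, HurwitzKernelBounds.f_int 1 a t n := fun t => rfl
  set F : ℝ → ℝ := fun t => ∑' n, HurwitzKernelBounds.f_int 1 a t n with hFd
  have hanti : ∀ t, t₀ ≤ t → F t ≤ F t₀ := fun t ht => by
    refine Summable.tsum_le_tsum (fun n => ?_)
      (HurwitzKernelBounds.summable_f_int 1 a (ht₀.trans_le ht))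
      (HurwitzKernelBounds.summable_f_int 1 a ht₀)
    unfold HurwitzKernelBounds.f_int
    have : 0 ≤ Real.pi * ((n : ℝ) + a) ^ 2 := by positivity
    have h2 := mul_le_mul_of_nonneg_left ht this
    gcongr ?_ * Real.exp ?_
    linarith
  have hF0 : 0 ≤ F t₀ := tsum_nonneg fun n => by unfold HurwitzKernelBounds.f_int; positivity
  refine ⟨B + F t₀ * Real.exp (p * T), p, by positivity, hp, fun t ht => ?_⟩
  rcases le_total T t with h | h
  · have := hT t h
    rw [hF, Real.norm_eq_abs, Real.norm_eq_abs, Real.abs_exp] at this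
    calc F t ≤ B * Real.exp (-p * t) := (le_abs_self _).trans this
      _ ≤ _ := by gcongr; linarith [mul_nonneg hF0 (Real.exp_pos (p * T)).le]
  · calc F t ≤ F t₀ * 1 := by rw [mul_one]; exact hanti t ht
      _ ≤ F t₀ * (Real.exp (p * T) * Real.exp (-p * t)) := by
        gcongr
        rw [← Real.exp_add]
        apply Real.one_le_exp
        nlinarith
      _ ≤ _ := by
        rw [← mul_assoc]; gcongr; linarith

/-- Exponential decay at the cusp `i∞`. -/
theorem exists_norm_charThetaDeriv_le (α β : ℝ) {t₀ : ℝ} (ht₀ : 0 < t₀) :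
    ∃ C δ : ℝ, 0 < C ∧ 0 < δ ∧ ∀ τ : ℂ, t₀ ≤ τ.im →
      ‖charThetaDeriv α β τ‖ ≤ C * Real.exp (-δ * τ.im) := by
  obtain ⟨C, δ, hC, hδ, h⟩ := exists_tsum_f_int_one_le (α + 1 / 2) ht₀
  refine ⟨2 * Real.pi * C, δ, by positivity, hδ, fun τ hτ => ?_⟩
  have hs := HurwitzKernelBounds.summable_f_int 1 (α + 1 / 2) (ht₀.trans_le hτ)
  refine (tsum_of_norm_bounded (hs.hasSum.mul_left (2 * Real.pi))
    fun n => (norm_charThetaDerivTerm α β τ n).le).trans ?_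
  rw [mul_assoc (2 * Real.pi)]
  exact mul_le_mul_of_nonneg_left (h _ hτ) (by positivity)

theorem differentiableOn_charThetaDeriv (α β : ℝ) :
    DifferentiableOn ℂ (charThetaDeriv α β) {τ | 0 < τ.im} := by
  intro τ hτ
  have hτ' : 0 < τ.im := hτ
  have hopen : IsOpen {w : ℂ | τ.im / 2 < w.im} := isOpen_lt continuous_const Complex.continuous_im
  have hd : DifferentiableOn ℂ (fun w => ∑' n : ℤ, charThetaDerivTerm α β w n)
      {w : ℂ | τ.im / 2 < w.im} := by
    refine differentiableOn_tsum_of_summable_norm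
      ((HurwitzKernelBounds.summable_f_int 1 (α + 1 / 2) (half_pos hτ')).mul_left (2 * Real.pi))
      (fun n => ?_) hopen (fun n w hw => ?_)
    · unfold charThetaDerivTerm; fun_prop
    · rw [norm_charThetaDerivTerm]
      unfold HurwitzKernelBounds.f_int
      have hw' : τ.im / 2 ≤ w.im := le_of_lt hw
      have : 0 ≤ Real.pi * ((n : ℝ) + (α + 1 / 2)) ^ 2 := by positivity
      have h2 := mul_le_mul_of_nonneg_left hw' this
      gcongr _ * (_ * Real.exp ?_)
      linarith
  exact (hd.differentiableAt (hopen.mem_nhds (half_lt_self hτ'))).differentiableWithinAt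

/-! ### Modularity with a common multiplier on a congruence subgroup -/

theorem charThetaDeriv_add_int (α β : ℝ) (m n : ℤ) (τ : ℂ) :
    charThetaDeriv (α + m) (β + n) τ =
      cexp (Real.pi * I * (n - m - 2 * m * β)) * charThetaDeriv α β τ := by
  rw [charThetaDeriv, charThetaDeriv, ← tsum_mul_left, ← (Equiv.addRight (-m)).tsum_eq]
  refine tsum_congr fun k => ?_
  simp only [charThetaDerivTerm, Equiv.coe_addRight]
  have h1 : ((k + -m : ℤ) : ℂ) + ((α + m + 1 / 2 : ℝ) : ℂ) = k + ((α + 1 / 2 : ℝ) : ℂ) := by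
    push_cast; ring
  have h2 : cexp (Real.pi * I * ((k + -m : ℤ) + 2 * ((k + -m : ℤ) + 1 / 2) * (β + n : ℝ))) =
      cexp (Real.pi * I * (n - m - 2 * m * β)) * cexp (Real.pi * I * (k + 2 * (k + 1 / 2) * β)) := by
    rw [← Complex.exp_add, Complex.exp_eq_exp_iff_exists_int]
    refine ⟨(k - m) * n, ?_⟩
    push_cast; ring
  rw [h1, h2]
  ring

/-- The level `2 K²` makes `(α, β)γ` differ from `(α, β)` by multiples of `2K`, and the phases from
the Jacobi law and from the integer shift then cancel. So the multiplier does not depend on the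
characteristics, which allows different unary series to be combined. -/
theorem charThetaDeriv_moebius_of_mem_Gamma {γ : Matrix.SpecialLinearGroup (Fin 2) ℤ} {κ : ℂ}
    (h : OddThetaLaw γ κ) {K : ℕ} (hK : K ≠ 0) (p q : ℤ)
    (hγ : γ ∈ CongruenceSubgroup.Gamma (2 * K ^ 2)) {τ : ℂ} (hτ : 0 < τ.im) :
    charThetaDeriv (p / K) (q / K) (moebius γ τ) =
      κ * (moebiusDenom γ τ * moebiusDenom γ τ ^ (1 / 2 : ℂ)) *
        charThetaDeriv (p / K) (q / K) τ := by
  have hK' : (K : ℝ) ≠ 0 := Nat.cast_ne_zero.2 hK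
  rw [CongruenceSubgroup.Gamma_mem] at hγ
  obtain ⟨ha, hb, hc, hd⟩ := hγ
  have dvd : ∀ z : ℤ, ((z : ZMod (2 * K ^ 2)) = 0) → ∃ k : ℤ, z = 2 * K ^ 2 * k := fun z hz => by
    obtain ⟨k, hk⟩ := (ZMod.intCast_zmod_eq_zero_iff_dvd z _).1 hz
    exact ⟨k, by rw [hk]; push_cast; ring⟩
  obtain ⟨a, ha⟩ := dvd (γ 0 0 - 1) (by push_cast; rw [ha]; ring)
  obtain ⟨b, hb⟩ := dvd (γ 0 1) hb
  obtain ⟨c, hc⟩ := dvd (γ 1 0) hc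
  obtain ⟨d, hd⟩ := dvd (γ 1 1 - 1) (by push_cast; rw [hd]; ring)
  have ha' : (γ 0 0 : ℝ) = 1 + 2 * K ^ 2 * a := by
    rw [show γ 0 0 = 1 + 2 * K ^ 2 * a by linarith]; push_cast; ring
  have hd' : (γ 1 1 : ℝ) = 1 + 2 * K ^ 2 * d := by
    rw [show γ 1 1 = 1 + 2 * K ^ 2 * d by linarith]; push_cast; ring
  have hb' : (γ 0 1 : ℝ) = 2 * K ^ 2 * b := by rw [hb]; push_cast; ring
  have hc' : (γ 1 0 : ℝ) = 2 * K ^ 2 * c := by rw [hc]; push_cast; ring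
  have hα : (p / K : ℝ) * γ 0 0 + q / K * γ 1 0 = p / K + ((2 * K * (p * a + q * c) : ℤ) : ℝ) := by
    rw [ha', hc']; push_cast; field_simp; ring
  have hβ : (p / K : ℝ) * γ 0 1 + q / K * γ 1 1 = q / K + ((2 * K * (p * b + q * d) : ℤ) : ℝ) := by
    rw [hb', hd']; push_cast; field_simp; ring
  rw [charThetaDeriv_moebius h _ _ hτ, hα, hβ, charThetaDeriv_add_int]
  have hαc := congrArg (fun r : ℝ => (r : ℂ)) hα
  have hβc := congrArg (fun r : ℝ => (r : ℂ)) hβ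
  simp only [Complex.ofReal_add, Complex.ofReal_mul, Complex.ofReal_intCast] at hαc hβc
  rw [hαc, hβc]
  set m : ℤ := p * a + q * c
  set n : ℤ := p * b + q * d
  have hx : cexp (Real.pi * I * ((((p / K : ℝ) : ℂ) + ((2 * K * m : ℤ) : ℂ)) *
        (((q / K : ℝ) : ℂ) + ((2 * K * n : ℤ) : ℂ)) - ((p / K : ℝ) : ℂ) * ((q / K : ℝ) : ℂ))) *
      cexp (Real.pi * I * (((2 * K * n : ℤ) : ℂ) - ((2 * K * m : ℤ) : ℂ) -
        2 * ((2 * K * m : ℤ) : ℂ) * ((q / K : ℝ) : ℂ))) = 1 := by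
    rw [← Complex.exp_add, Complex.exp_eq_one_iff]
    refine ⟨p * n - m * q + 2 * K ^ 2 * m * n + K * n - K * m, ?_⟩
    have hKc : (K : ℂ) ≠ 0 := Nat.cast_ne_zero.2 hK
    push_cast
    field_simp
    ring
  linear_combination (κ * (moebiusDenom γ τ * moebiusDenom γ τ ^ (1 / 2 : ℂ)) *
        charThetaDeriv (p / K) (q / K) τ) * hx

/-- The multiplier of the odd theta function. -/
def thetaMultiplier (γ : Matrix.SpecialLinearGroup (Fin 2) ℤ) : ℂ :=
  Classical.choose (exists_oddThetaLaw γ)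

theorem norm_thetaMultiplier (γ : Matrix.SpecialLinearGroup (Fin 2) ℤ) :
    ‖thetaMultiplier γ‖ = 1 := (Classical.choose_spec (exists_oddThetaLaw γ)).1

theorem oddThetaLaw_thetaMultiplier (γ : Matrix.SpecialLinearGroup (Fin 2) ℤ) :
    OddThetaLaw γ (thetaMultiplier γ) := (Classical.choose_spec (exists_oddThetaLaw γ)).2

/-- At this `z` the argument of the Jacobi theta function is `0`, and for `τ = i` all its terms are
positive. A nonzero value is needed to read off the multiplier from the transformation law. -/
theorem exists_oddTheta_ne_zero : ∃ z : ℂ, oddTheta z I ≠ 0 := by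
  refine ⟨-(I / 2 + 1 / 2), mul_ne_zero (Complex.exp_ne_zero _) ?_⟩
  rw [show -(I / 2 + 1 / 2) + I / 2 + 1 / 2 = (0 : ℂ) by ring]
  have hs := hasSum_jacobiTheta₂_term 0 (τ := I) (by simp)
  have ht : ∀ n : ℤ, jacobiTheta₂_term n 0 I = ((Real.exp (-Real.pi * n ^ 2) : ℝ) : ℂ) := fun n => by
    rw [jacobiTheta₂_term]
    push_cast
    congr 1
    linear_combination (Real.pi * n ^ 2 : ℂ) * Complex.I_sq
  have hre := Complex.hasSum_re hs
  simp only [ht, Complex.ofReal_re] at hre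
  intro h0
  rw [h0] at hre
  have := hre.tsum_eq ▸ hre.summable.tsum_pos (fun n => (Real.exp_pos _).le) 0 (Real.exp_pos _)
  simp at this

theorem thetaMultiplier_mul (γ₁ γ₂ : Matrix.SpecialLinearGroup (Fin 2) ℤ) :
    ∃ σ : ℂ, starRingEnd ℂ σ = σ ∧
      thetaMultiplier (γ₁ * γ₂) = thetaMultiplier γ₁ * thetaMultiplier γ₂ * σ ∧
      ∀ τ : ℂ, 0 < τ.im →
      moebiusDenom γ₁ (moebius γ₂ τ) ^ (1 / 2 : ℂ) * moebiusDenom γ₂ τ ^ (1 / 2 : ℂ) =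
        σ * moebiusDenom (γ₁ * γ₂) τ ^ (1 / 2 : ℂ) := by
  obtain ⟨σ, -, hσ', hs⟩ := exists_sign_cpow_half γ₁ γ₂
  refine ⟨σ, hσ', ?_, hs⟩
  obtain ⟨z, hz⟩ := exists_oddTheta_ne_zero
  have h12 := oddThetaLaw_thetaMultiplier (γ₁ * γ₂) z I (by simp)
  obtain h12' := (oddThetaLaw_thetaMultiplier γ₁).mul_apply (oddThetaLaw_thetaMultiplier γ₂) hs
    z I (by simp)
  rw [h12] at h12'
  have hne := cpow_half_ne_zero (moebiusDenom_ne_zero (γ₁ * γ₂) (τ := I) (by simp))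
  exact mul_right_cancel₀ hne (mul_right_cancel₀ (Complex.exp_ne_zero _)
    (mul_right_cancel₀ hz h12'))

/-- Conjugation with `diag(2, 1)`, for matrices whose lower left entry is even. -/
def doubleConj (γ : Matrix.SpecialLinearGroup (Fin 2) ℤ) : Matrix.SpecialLinearGroup (Fin 2) ℤ :=
  if h : 2 ∣ γ 1 0 then
    ⟨!![γ 0 0, 2 * γ 0 1; γ 1 0 / 2, γ 1 1], by
      obtain ⟨c, hc⟩ := h
      have := det_entries γ
      rw [Matrix.det_fin_two_of, hc, Int.mul_ediv_cancel_left _ two_ne_zero]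
      rw [hc] at this
      linarith⟩
  -- A default value; every matrix identity below assumes that the lower left entry is even.
  else 1

theorem doubleConj_entries {γ : Matrix.SpecialLinearGroup (Fin 2) ℤ} (h : 2 ∣ γ 1 0) :
    doubleConj γ 0 0 = γ 0 0 ∧ doubleConj γ 0 1 = 2 * γ 0 1 ∧ 2 * doubleConj γ 1 0 = γ 1 0 ∧
      doubleConj γ 1 1 = γ 1 1 := by
  have hd : (doubleConj γ).1 = !![γ 0 0, 2 * γ 0 1; γ 1 0 / 2, γ 1 1] :=
    congrArg Subtype.val (dif_pos h)
  change (doubleConj γ).1 0 0 = _ ∧ (doubleConj γ).1 0 1 = _ ∧ 2 * (doubleConj γ).1 1 0 = _ ∧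
    (doubleConj γ).1 1 1 = _
  rw [hd]
  simp [Int.mul_ediv_cancel' h]

theorem doubleConj_mul {γ₁ γ₂ : Matrix.SpecialLinearGroup (Fin 2) ℤ} (h₁ : 2 ∣ γ₁ 1 0)
    (h₂ : 2 ∣ γ₂ 1 0) : doubleConj (γ₁ * γ₂) = doubleConj γ₁ * doubleConj γ₂ := by
  have h12 : 2 ∣ (γ₁ * γ₂) 1 0 := by
    simp only [Matrix.SpecialLinearGroup.coe_mul, Matrix.mul_apply, Fin.sum_univ_two]
    exact dvd_add (h₁.mul_right _) (h₂.mul_left _)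
  obtain ⟨a1, b1, c1, d1⟩ := doubleConj_entries h₁
  obtain ⟨a2, b2, c2, d2⟩ := doubleConj_entries h₂
  obtain ⟨a, b, c, d⟩ := doubleConj_entries h12
  simp only [Matrix.SpecialLinearGroup.coe_mul, Matrix.mul_apply, Fin.sum_univ_two] at a b c d
  ext i j
  fin_cases i <;> fin_cases j <;>
    simp only [Matrix.SpecialLinearGroup.coe_mul, Matrix.mul_apply, Fin.sum_univ_two,
      Fin.zero_eta, Fin.mk_one, Fin.isValue]
  · rw [a, a1, a2, b1, ← c2]; ring
  · rw [b, a1, b2, b1, d2]; ring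
  · have : 2 * doubleConj (γ₁ * γ₂) 1 0 =
        2 * (doubleConj γ₁ 1 0 * doubleConj γ₂ 0 0 + doubleConj γ₁ 1 1 * doubleConj γ₂ 1 0) := by
      rw [c, ← c1, ← c2, a2, d1]; ring
    linarith
  · rw [d, ← c1, b2, d1, d2]; ring

theorem moebiusDenom_doubleConj {γ : Matrix.SpecialLinearGroup (Fin 2) ℤ} (h : 2 ∣ γ 1 0) (τ : ℂ) :
    moebiusDenom (doubleConj γ) (2 * τ) = moebiusDenom γ τ := by
  obtain ⟨a, b, c, d⟩ := doubleConj_entries h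
  rw [moebiusDenom, moebiusDenom, d, ← c]; push_cast; ring

theorem moebius_doubleConj {γ : Matrix.SpecialLinearGroup (Fin 2) ℤ} (h : 2 ∣ γ 1 0) (τ : ℂ) :
    moebius (doubleConj γ) (2 * τ) = 2 * moebius γ τ := by
  obtain ⟨a, b, c, d⟩ := doubleConj_entries h
  rw [moebius_eq_div, moebius_eq_div, moebiusDenom_doubleConj h, a, b]; push_cast; ring

/-- The denominator can be a negative real number only if `c = 0` and `d = -1`, which is excluded
modulo `L ≥ 3`. This is what lets complex conjugation commute with the principal square root. -/
theorem moebiusDenom_arg_ne_pi {γ : Matrix.SpecialLinearGroup (Fin 2) ℤ} {L : ℕ} (hL : 3 ≤ L)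
    (hγ : γ ∈ CongruenceSubgroup.Gamma L) {τ : ℂ} (hτ : 0 < τ.im) :
    (moebiusDenom γ τ).arg ≠ Real.pi := by
  intro h
  obtain ⟨hre, him⟩ := Complex.arg_eq_pi_iff.1 h
  rw [moebiusDenom_im] at him
  have hc : γ 1 0 = 0 := by simpa [hτ.ne'] using him
  rw [moebiusDenom_re, hc] at hre
  have hd : γ 1 1 < 0 := by simpa using hre
  have hdet := det_entries γ
  rw [hc, mul_zero, sub_zero] at hdet
  have hd1 : γ 1 1 = -1 := by
    rcases Int.isUnit_iff.1 (IsUnit.of_mul_eq_one_right _ hdet) with h | h <;> omega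
  rw [CongruenceSubgroup.Gamma_mem] at hγ
  have h1 := hγ.2.2.2
  rw [hd1] at h1
  have h2 : (((2 : ℕ) : ZMod L)) = 0 := by
    push_cast at h1 ⊢
    linear_combination -h1
  rw [ZMod.natCast_eq_zero_iff] at h2
  exact absurd (Nat.le_of_dvd two_pos h2) (by omega)

/-! ### Passage to the lower half-plane by complex conjugation. -/

theorem moebius_conj (γ : Matrix.SpecialLinearGroup (Fin 2) ℤ) (z : ℂ) :
    moebius γ (starRingEnd ℂ z) = starRingEnd ℂ (moebius γ z) := by
  simp [moebius]

theorem moebiusDenom_conj (γ : Matrix.SpecialLinearGroup (Fin 2) ℤ) (z : ℂ) :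
    moebiusDenom γ (starRingEnd ℂ z) = starRingEnd ℂ (moebiusDenom γ z) := by
  simp [moebiusDenom]

theorem two_dvd_of_mem_Gamma {γ : Matrix.SpecialLinearGroup (Fin 2) ℤ} {L : ℕ} (hL : 2 ∣ L)
    (hγ : γ ∈ CongruenceSubgroup.Gamma L) : 2 ∣ γ 1 0 := by
  rw [CongruenceSubgroup.Gamma_mem] at hγ
  have := (ZMod.intCast_zmod_eq_zero_iff_dvd _ _).1 hγ.2.2.1
  exact (Int.natCast_dvd_natCast.2 hL).trans this

theorem autFactorLower_half_conj {γ : Matrix.SpecialLinearGroup (Fin 2) ℤ} {L : ℕ} (hL : 3 ≤ L)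
    (hγ : γ ∈ CongruenceSubgroup.Gamma L) {τ : ℂ} (hτ : 0 < τ.im) :
    autFactorLower (1 / 2) γ (starRingEnd ℂ τ) =
      starRingEnd ℂ (moebiusDenom γ τ ^ (1 / 2 : ℂ)) := by
  have h : autFactorLower (1 / 2) γ (starRingEnd ℂ τ) =
      moebiusDenom γ (starRingEnd ℂ τ) ^ (1 / 2 : ℂ) := by
    rw [autFactorLower, moebiusDenom]; push_cast; rfl
  rw [h, moebiusDenom_conj, Complex.conj_cpow _ _ (moebiusDenom_arg_ne_pi hL hγ hτ)]
  simp [Complex.conj_ofNat]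

/-- The automorphy factor on the lower half-plane is the conjugate of the one on the upper
half-plane. The cocycle sign `σ` is real, so conjugation preserves it, and its two occurrences
cancel. The unary series are evaluated at `2τ`, hence the conjugation by `diag(2, 1)`. -/
theorem isMultiplierSystem_doubleConj {L : ℕ} (hL : 3 ≤ L) (hL2 : 2 ∣ L) :
    IsMultiplierSystem (1 / 2) (CongruenceSubgroup.Gamma L)
      fun γ => thetaMultiplier (doubleConj γ) := by
  refine ⟨fun γ _ => norm_thetaMultiplier _, fun γ₁ h₁ γ₂ h₂ z hz => ?_⟩
  obtain ⟨τ, rfl⟩ : ∃ τ, z = starRingEnd ℂ τ := ⟨starRingEnd ℂ z, by simp⟩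
  have hτ : 0 < τ.im := by simpa using hz
  have d₁ := two_dvd_of_mem_Gamma hL2 h₁
  have d₂ := two_dvd_of_mem_Gamma hL2 h₂
  obtain ⟨σ, hσ, hm, hs⟩ := thetaMultiplier_mul (doubleConj γ₁) (doubleConj γ₂)
  have hs' := hs (2 * τ) (by simpa using hτ)
  rw [← doubleConj_mul d₁ d₂, moebius_doubleConj d₂, moebiusDenom_doubleConj d₁,
    moebiusDenom_doubleConj d₂, moebiusDenom_doubleConj
      (two_dvd_of_mem_Gamma hL2 (mul_mem h₁ h₂))] at hs'
  have hs'' := congrArg (starRingEnd ℂ) hs'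
  rw [map_mul, map_mul, hσ] at hs''
  simp only
  rw [moebius_conj, autFactorLower_half_conj hL (mul_mem h₁ h₂) hτ,
    autFactorLower_half_conj hL h₁ (moebius_im_pos γ₂ hτ), autFactorLower_half_conj hL h₂ hτ,
    hs'', doubleConj_mul d₁ d₂, hm]
  ring

/-! ### Unary theta series of weight `3/2` -/

/-- A constant multiple of `∑ (n + a) exp (2πi (n + a)² τ)`. -/
def unaryTheta (a : ℝ) (τ : ℂ) : ℂ := charThetaDeriv (a - 1 / 2) (1 / 2) (2 * τ)

theorem differentiableOn_unaryTheta (a : ℝ) : DifferentiableOn ℂ (unaryTheta a) {τ | 0 < τ.im} :=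
  (differentiableOn_charThetaDeriv _ _).comp (by fun_prop) fun τ hτ => by
    have : 0 < τ.im := hτ
    simpa using this

/-- With denominator `K = 2N` the characteristics are `(j - N)/K` and `N/K`, and level `2 K² = 8 N²`
is needed for `doubleConj γ`. Halving the lower left entry costs one more factor `2`, whence `16
N²`. -/
theorem unaryTheta_moebius {N : ℕ} (hN : N ≠ 0) (j : ℤ)
    {γ : Matrix.SpecialLinearGroup (Fin 2) ℤ}
    (hγ : γ ∈ CongruenceSubgroup.Gamma (16 * N ^ 2)) {τ : ℂ} (hτ : 0 < τ.im) :
    unaryTheta (j / (2 * N)) (moebius γ τ) = thetaMultiplier (doubleConj γ) *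
      (moebiusDenom γ τ * moebiusDenom γ τ ^ (1 / 2 : ℂ)) * unaryTheta (j / (2 * N)) τ := by
  have h2 : 2 ∣ γ 1 0 := two_dvd_of_mem_Gamma (L := 16 * N ^ 2) ⟨8 * N ^ 2, by ring⟩ hγ
  have hN' : (N : ℝ) ≠ 0 := Nat.cast_ne_zero.2 hN
  have hmem : doubleConj γ ∈ CongruenceSubgroup.Gamma (2 * (2 * N) ^ 2) := by
    obtain ⟨a, b, c, d⟩ := doubleConj_entries h2
    rw [CongruenceSubgroup.Gamma_mem] at hγ ⊢
    obtain ⟨ha, hb, hc, hd⟩ := hγ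
    have hdvd : 2 * (2 * N) ^ 2 ∣ 16 * N ^ 2 := ⟨2, by ring⟩
    have red : ∀ z w : ℤ, ((z : ZMod (16 * N ^ 2)) = w) → ((z : ZMod (2 * (2 * N) ^ 2)) = w) := by
      intro z w h
      rw [ZMod.intCast_eq_intCast_iff_dvd_sub] at h ⊢
      exact (Int.natCast_dvd_natCast.2 hdvd).trans h
    refine ⟨?_, ?_, ?_, ?_⟩
    · rw [a]; simpa using red _ 1 (by simpa using ha)
    · rw [b]; push_cast; rw [show ((γ 0 1 : ℤ) : ZMod (2 * (2 * N) ^ 2)) = 0 by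
        simpa using red _ 0 (by simpa using hb)]; ring
    · rw [ZMod.intCast_zmod_eq_zero_iff_dvd] at hc ⊢
      rw [← c, show ((16 * N ^ 2 : ℕ) : ℤ) = 2 * ((2 * (2 * N) ^ 2 : ℕ) : ℤ) by push_cast; ring]
        at hc
      exact Int.dvd_of_mul_dvd_mul_left two_ne_zero hc
    · rw [d]; simpa using red _ 1 (by simpa using hd)
  have key := charThetaDeriv_moebius_of_mem_Gamma (oddThetaLaw_thetaMultiplier (doubleConj γ))
    (K := 2 * N) (by positivity) (j - N) N hmem (τ := 2 * τ) (by simpa using hτ)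
  rw [moebius_doubleConj h2, moebiusDenom_doubleConj h2] at key
  have e1 : ((j - N : ℤ) : ℝ) / ((2 * N : ℕ) : ℝ) = j / (2 * N) - 1 / 2 := by
    push_cast; field_simp
  have e2 : ((N : ℤ) : ℝ) / ((2 * N : ℕ) : ℝ) = 1 / 2 := by
    push_cast; field_simp
  rwa [e1, e2] at key

/-! ### Growth of the unary theta series at the cusps. -/

theorem exists_norm_unaryTheta_le (a : ℝ) {t₀ : ℝ} (ht₀ : 0 < t₀) :
    ∃ C δ : ℝ, 0 < C ∧ 0 < δ ∧ ∀ τ : ℂ, t₀ ≤ τ.im →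
      ‖unaryTheta a τ‖ ≤ C * Real.exp (-δ * τ.im) := by
  obtain ⟨C, δ, hC, hδ, h⟩ := exists_norm_charThetaDeriv_le (a - 1 / 2) (1 / 2) ht₀
  refine ⟨C, δ, hC, hδ, fun τ hτ => ?_⟩
  have h2 : (2 * τ).im = 2 * τ.im := by simp
  refine (h (2 * τ) (by rw [h2]; linarith)).trans ?_
  rw [h2]
  gcongr C * Real.exp ?_
  nlinarith

/-- A matrix `γ` with `γ∞ = x` carries the cusp at `x` to `i∞`. In the cone, `ζ = γu` has `Im u` at
least a constant times `1 / Im ζ`, so the exponential decay at `i∞` beats the automorphy factor,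
which grows only like a power of `1 / Im ζ`. -/
theorem exists_norm_charThetaDeriv_le_of_cone_small (α β : ℝ) (x : ℚ) :
    ∃ C : ℝ, ∀ ζ : ℂ, 0 < ζ.im → ζ.im ≤ 1 → |ζ.re - x| ≤ ζ.im →
      ‖charThetaDeriv α β ζ‖ ≤ C := by
  obtain ⟨γ, h0, h1⟩ := (Rat.isCoprime_num_den x).exists_SL2_col 0
  set c : ℝ := (x.den : ℝ) with hc
  have hc1 : 1 ≤ c := by rw [hc]; exact_mod_cast x.den_pos
  obtain ⟨C, δ, hC, hδ, hb⟩ := exists_norm_charThetaDeriv_le (α * γ 0 0 + β * γ 1 0)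
    (α * γ 0 1 + β * γ 1 1) (t₀ := 1 / (4 * c ^ 2)) (by positivity)
  set η := δ / (4 * c ^ 2) with hη
  have hη0 : 0 < η := by positivity
  refine ⟨C * (2 / η ^ 2), fun ζ hy hy1 hcone => ?_⟩
  set u := moebius γ⁻¹ ζ with hu
  have hu0 : 0 < u.im := moebius_im_pos _ hy
  have hJ' := moebiusDenom_ne_zero γ⁻¹ hy.ne'
  have hζ : ζ = moebius γ u := by
    rw [hu, ← moebius_mul _ _ hJ', mul_inv_cancel, moebius_one]
  have hJ := moebiusDenom_ne_zero γ hu0.ne'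
  -- This is `γu - γ∞ = -1 / (c (cu + d))`; it converts the size of `ζ - x` into the size of the
  -- automorphy factor.
  have hz : (ζ - x) * (c * moebiusDenom γ u) = -1 := by
    have hdet := det_entries_complex γ
    have hx : (x : ℂ) * c = (γ 0 0 : ℂ) := by
      rw [h0, hc]; push_cast
      exact_mod_cast Rat.mul_den_eq_num x
    have hcc : (c : ℂ) = (γ 1 0 : ℂ) := by rw [h1, hc]; simp
    have e : ζ * moebiusDenom γ u = (γ 0 0 : ℂ) * u + γ 0 1 := by
      conv_lhs => rw [hζ]
      rw [moebius_eq_div, div_mul_cancel₀ _ hJ]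
    calc (ζ - x) * (c * moebiusDenom γ u) = c * (ζ * moebiusDenom γ u) -
        x * c * moebiusDenom γ u := by ring
      _ = _ := by rw [e, hx, hcc, moebiusDenom]; linear_combination -hdet
  set r := ‖moebiusDenom γ u‖ with hr
  have hr0 : 0 < r := norm_pos_iff.2 hJ
  have hn : ‖ζ - x‖ * (c * r) = 1 := by
    have := congrArg norm hz
    rwa [norm_mul, norm_mul, Complex.norm_real, Real.norm_eq_abs, abs_of_nonneg (by positivity),
      norm_neg, norm_one] at this
  have hlow : ζ.im ≤ ‖ζ - x‖ := by
    have := Complex.abs_im_le_norm (ζ - x)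
    simp only [sub_im, Complex.ratCast_im, sub_zero] at this
    exact (le_abs_self _).trans this
  have hup : ‖ζ - x‖ ≤ 2 * ζ.im := by
    have := Complex.norm_le_abs_re_add_abs_im (ζ - x)
    simp only [sub_im, sub_re, Complex.ratCast_im, Complex.ratCast_re, sub_zero] at this
    rw [abs_of_pos hy] at this
    linarith
  have hrs : r ≤ 1 / ζ.im := by
    rw [le_div_iff₀ hy]
    calc r * ζ.im ≤ (c * r) * ‖ζ - x‖ := by
          apply mul_le_mul _ hlow hy.le (by positivity)
          nlinarith
      _ = 1 := by rw [mul_comm]; exact hn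
  have him : ζ.im * r ^ 2 = u.im := by
    have := moebius_im γ u
    rw [← hζ, Complex.normSq_eq_norm_sq] at this
    rw [this, div_mul_cancel₀ _ (by positivity)]
  have hru : 1 / (2 * c * ζ.im) ≤ r := by
    rw [div_le_iff₀ (by positivity)]
    calc 1 = ‖ζ - x‖ * (c * r) := hn.symm
      _ ≤ 2 * ζ.im * (c * r) := by gcongr
      _ = _ := by ring
  have himu : 1 / (4 * c ^ 2) * (1 / ζ.im) ≤ u.im := by
    rw [← him]
    calc 1 / (4 * c ^ 2) * (1 / ζ.im) = ζ.im * (1 / (2 * c * ζ.im)) ^ 2 := by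
          field_simp; norm_num
      _ ≤ _ := by gcongr
  set s := 1 / ζ.im with hs
  have hs1 : 1 ≤ s := by rw [hs, le_div_iff₀ hy]; linarith
  -- A crude bound: the square of the left side is `r ≤ s ≤ s²`, because `s ≥ 1`.
  have hhalf : ‖moebiusDenom γ u ^ (1 / 2 : ℂ)‖ ≤ s := by
    have h2 : ‖moebiusDenom γ u ^ (1 / 2 : ℂ)‖ ^ 2 = r := by
      rw [← norm_pow, cpow_half_sq hJ]
    nlinarith [norm_nonneg (moebiusDenom γ u ^ (1 / 2 : ℂ))]
  have hphase : ‖cexp (Real.pi * I * ((α * γ 0 0 + β * γ 1 0) * (α * γ 0 1 + β * γ 1 1) -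
      α * β))‖ = 1 := by
    have := norm_exp_pi_I_mul_ofReal ((α * γ 0 0 + β * γ 1 0) * (α * γ 0 1 + β * γ 1 1) - α * β)
    push_cast at this
    exact this
  have hbu := hb u (le_trans (by
    calc 1 / (4 * c ^ 2) = 1 / (4 * c ^ 2) * 1 := (mul_one _).symm
      _ ≤ _ := by gcongr) himu)
  have hexp : s ^ 2 * Real.exp (-η * s) ≤ 2 / η ^ 2 := by
    have h3 := Real.pow_div_factorial_le_exp (η * s) (by positivity) 2
    rw [neg_mul, Real.exp_neg, ← div_eq_mul_inv, div_le_div_iff₀ (Real.exp_pos _) (by positivity)]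
    norm_num at h3
    nlinarith
  rw [hζ, charThetaDeriv_moebius (oddThetaLaw_thetaMultiplier γ) _ _ hu0, norm_mul, hphase,
    one_mul, norm_mul, norm_mul, norm_thetaMultiplier, one_mul, norm_mul]
  calc r * ‖moebiusDenom γ u ^ (1 / 2 : ℂ)‖ * _ ≤ s * s * (C * Real.exp (-η * s)) := by
        gcongr
        refine hbu.trans ?_
        gcongr C * Real.exp ?_
        have : δ * (1 / (4 * c ^ 2) * s) ≤ δ * u.im := by gcongr
        calc -δ * u.im ≤ -(δ * (1 / (4 * c ^ 2) * s)) := by linarith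
          _ = -η * s := by rw [hη]; ring
    _ = C * (s ^ 2 * Real.exp (-η * s)) := by ring
    _ ≤ _ := by gcongr

/-- In a cone at a rational point, the unary theta series is bounded, and exponentially small
far from the point. -/
theorem exists_norm_unaryTheta_le_of_cone (a : ℝ) (x : ℚ) :
    ∃ C δ : ℝ, 0 < C ∧ 0 < δ ∧ ∀ ζ : ℂ, 0 < ζ.im → |ζ.re - x| ≤ ζ.im →
      ‖unaryTheta a ζ‖ ≤ C * Real.exp (-δ * ζ.im) := by
  -- Doubling maps the cone at `x` to the cone at `2x`, matching the argument `2τ` in `unaryTheta`.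
  obtain ⟨C₁, h₁⟩ := exists_norm_charThetaDeriv_le_of_cone_small (a - 1 / 2) (1 / 2) (2 * x)
  obtain ⟨C₂, δ, hC₂, hδ, h₂⟩ := exists_norm_unaryTheta_le a (t₀ := 1 / 2) (by norm_num)
  refine ⟨C₂ + |C₁| * Real.exp δ, δ, by positivity, hδ, fun ζ hy hcone => ?_⟩
  rcases le_total (1 / 2) ζ.im with h | h
  · refine (h₂ ζ h).trans ?_
    gcongr
    linarith [mul_nonneg (abs_nonneg C₁) (Real.exp_pos δ).le]
  · have him : (2 * ζ).im = 2 * ζ.im := by simp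
    have hre : (2 * ζ).re = 2 * ζ.re := by simp
    have := h₁ (2 * ζ) (by rw [him]; linarith) (by rw [him]; linarith) (by
      rw [him, hre]; push_cast
      rw [← mul_sub, abs_mul, abs_two]; linarith)
    calc ‖unaryTheta a ζ‖ ≤ |C₁| * 1 := by rw [mul_one]; exact this.trans (le_abs_self _)
      _ ≤ |C₁| * (Real.exp δ * Real.exp (-δ * ζ.im)) := by
        gcongr
        rw [← Real.exp_add]
        apply Real.one_le_exp
        nlinarith
      _ ≤ _ := by rw [← mul_assoc]; gcongr; linarith

/-! ### Primitives on the upper half-plane -/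

/-- The Cayley transform `w = (τ - i)/(τ + i)` carries the problem to the unit disc, where
holomorphic functions have primitives. The factor `2i / (1 - w)²` is the derivative of the inverse
transform. -/
theorem exists_primitive_upperHalf {φ : ℂ → ℂ} (hφ : DifferentiableOn ℂ φ {τ | 0 < τ.im}) :
    ∃ P : ℂ → ℂ, ∀ τ : ℂ, 0 < τ.im → HasDerivAt P (φ τ) τ := by
  have hne : ∀ w ∈ Metric.ball (0 : ℂ) 1, (1 : ℂ) - w ≠ 0 := fun w hw h => by
    rw [mem_ball_zero_iff, ← sub_eq_zero.1 h, norm_one] at hw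
    exact lt_irrefl _ hw
  have him : ∀ w ∈ Metric.ball (0 : ℂ) 1, 0 < (I * (1 + w) / (1 - w)).im := fun w hw => by
    have h1 : I * (1 + w) / (1 - w) = I * ((1 + w) * starRingEnd ℂ (1 - w)) / normSq (1 - w) := by
      rw [← Complex.mul_conj]
      have := hne w hw
      have h2 : starRingEnd ℂ (1 - w) ≠ 0 := by simpa using (map_ne_zero (starRingEnd ℂ)).2 this
      field_simp
    rw [h1, Complex.div_ofReal_im]
    refine div_pos ?_ (normSq_pos.2 (hne w hw))
    rw [mem_ball_zero_iff, ← sq_lt_one_iff₀ (norm_nonneg _), ← Complex.normSq_eq_norm_sq,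
      Complex.normSq_apply] at hw
    simp
    linarith
  have hd : DifferentiableOn ℂ (fun w : ℂ => φ (I * (1 + w) / (1 - w)) * (2 * I / (1 - w) ^ 2))
      (Metric.ball 0 1) := by
    refine DifferentiableOn.mul (hφ.comp ?_ him) ?_
    · exact DifferentiableOn.div (by fun_prop) (by fun_prop) hne
    · exact DifferentiableOn.div (by fun_prop) (by fun_prop) fun w hw => pow_ne_zero 2 (hne w hw)
  obtain ⟨Q, hQ⟩ := hd.isExactOn_ball
  refine ⟨fun τ => Q ((τ - I) / (τ + I)), fun τ hτ => ?_⟩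
  have hτI : τ + I ≠ 0 := fun h => by
    have := congrArg Complex.im h
    simp at this; linarith
  have hmem : (τ - I) / (τ + I) ∈ Metric.ball (0 : ℂ) 1 := by
    rw [mem_ball_zero_iff, norm_div, div_lt_one (norm_pos_iff.2 hτI), ← sq_lt_sq₀ (norm_nonneg _)
      (norm_nonneg _), ← Complex.normSq_eq_norm_sq, ← Complex.normSq_eq_norm_sq,
      Complex.normSq_apply, Complex.normSq_apply]
    simp
    nlinarith
  have h1 : HasDerivAt (fun τ : ℂ => (τ - I) / (τ + I)) ((1 * (τ + I) - (τ - I) * 1) / (τ + I) ^ 2)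
      τ := ((hasDerivAt_id τ).sub_const I).div ((hasDerivAt_id τ).add_const I) hτI
  have h2 := (hQ _ hmem).comp τ h1
  refine h2.congr_deriv ?_
  have e1 : (1 : ℂ) - (τ - I) / (τ + I) = 2 * I / (τ + I) := by field_simp; ring
  have e2 : I * (1 + (τ - I) / (τ + I)) / (1 - (τ - I) / (τ + I)) = τ := by
    rw [e1]; field_simp; ring
  simp only [e2]
  rw [e1, mul_assoc]
  have : 2 * I / (2 * I / (τ + I)) ^ 2 * ((1 * (τ + I) - (τ - I) * 1) / (τ + I) ^ 2) = 1 := by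
    field_simp; ring
  rw [this, mul_one]

theorem exists_tendsto_of_hasDerivAt_Ioi {f f' : ℝ → ℂ}
    (hf : ∀ y ∈ Ioi (0 : ℝ), HasDerivAt f (f' y) y)
    (hint : MeasureTheory.IntegrableOn f' (Ioi 0)) :
    ∃ L₀ L₁ : ℂ, Tendsto f (𝓝[>] 0) (𝓝 L₀) ∧ Tendsto f atTop (𝓝 L₁) ∧
      ∫ y in Ioi (0 : ℝ), f' y = L₁ - L₀ := by
  have h1 := MeasureTheory.tendsto_limUnder_of_hasDerivAt_of_integrableOn_Ioi hf hint
  set L₁ := limUnder atTop f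
  have h2 : ∀ y ∈ Ioi (0 : ℝ), f y = L₁ - ∫ s in Ioi y, f' s := fun y hy => by
    rw [MeasureTheory.integral_Ioi_of_hasDerivAt_of_tendsto' (fun x hx => hf x (mem_Ioi.2 (lt_of_lt_of_le hy hx)))
      (hint.mono_set (Ioi_subset_Ioi (le_of_lt hy))) h1]
    ring
  have hcov := (MeasureTheory.aecover_Ioi_of_Ioi (μ := MeasureTheory.volume)
    (show Tendsto (fun y : ℝ => y) (𝓝[>] (0 : ℝ)) (𝓝 0) from
      tendsto_id.mono_left nhdsWithin_le_nhds)).integral_tendsto_of_countably_generated hint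
  refine ⟨L₁ - ∫ y in Ioi (0 : ℝ), f' y, L₁, ?_, h1, by ring⟩
  refine (hcov.const_sub L₁).congr' ?_
  filter_upwards [self_mem_nhdsWithin] with y hy
  rw [h2 y hy, MeasureTheory.Measure.restrict_restrict measurableSet_Ioi,
    Set.inter_eq_left.2 (Ioi_subset_Ioi (le_of_lt hy))]

/-! ### Functions with cuspidal behaviour at all rational points -/

/-- Bounds at rational points that hold for cusp forms multiplied by `(z - x) ^ (-1/2)`. -/
def HasConeBound (φ : ℂ → ℂ) : Prop :=
  ∀ x : ℚ, ∃ C δ : ℝ, 0 < C ∧ 0 < δ ∧ ∀ ζ : ℂ, 0 < ζ.im → |ζ.re - x| ≤ ζ.im →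
    ‖φ ζ‖ ≤ C * (Real.exp (-δ * ζ.im) * ζ.im ^ (-(1 / 2) : ℝ))

theorem integrableOn_exp_mul_rpow_neg_half {δ : ℝ} (hδ : 0 < δ) :
    MeasureTheory.IntegrableOn (fun y : ℝ => Real.exp (-δ * y) * y ^ (-(1 / 2) : ℝ)) (Ioi 0) := by
  have := integrableOn_rpow_mul_exp_neg_mul_rpow (p := 1) (s := -(1 / 2)) (b := δ)
    (by norm_num) one_pos hδ
  refine this.congr_fun (fun y hy => ?_) measurableSet_Ioi
  simp only [Real.rpow_one]
  ring

theorem integrableOn_vertical {φ : ℂ → ℂ} (hd : ContinuousOn φ {τ | 0 < τ.im})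
    (hb : HasConeBound φ) (x : ℚ) :
    MeasureTheory.IntegrableOn (fun y : ℝ => φ (x + I * y)) (Ioi 0) := by
  obtain ⟨C, δ, hC, hδ, h⟩ := hb x
  refine MeasureTheory.Integrable.mono' ((integrableOn_exp_mul_rpow_neg_half hδ).const_mul C) ?_ ?_
  · refine ContinuousOn.aestronglyMeasurable (hd.comp (by fun_prop) fun y hy => ?_)
      measurableSet_Ioi
    have : (0 : ℝ) < y := hy
    simpa using this
  · refine (MeasureTheory.ae_restrict_iff' measurableSet_Ioi).2 (Eventually.of_forall fun y hy => ?_)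
    have hy : (0 : ℝ) < y := hy
    have := h (x + I * y) (by simpa using hy) (by simpa using hy.le)
    simpa using this

theorem hasDerivAt_vertical {φ P : ℂ → ℂ} (hP : ∀ τ : ℂ, 0 < τ.im → HasDerivAt P (φ τ) τ)
    (x : ℂ) (hx : x.im = 0) {y : ℝ} (hy : 0 < y) :
    HasDerivAt (fun y : ℝ => P (x + I * y)) (φ (x + I * y) * I) y := by
  have h1 : HasDerivAt (fun y : ℝ => x + I * y) I y := by
    simpa using ((Complex.ofRealCLM.hasDerivAt (x := y)).const_mul I).const_add x
  exact HasDerivAt.comp y (hP _ (by simpa [hx] using hy)) h1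

/-- The difference of a primitive between two points of a cone at the same height. -/
theorem norm_primitive_sub_le {φ P : ℂ → ℂ} (hP : ∀ τ : ℂ, 0 < τ.im → HasDerivAt P (φ τ) τ)
    {x C δ : ℝ} (h : ∀ ζ : ℂ, 0 < ζ.im → |ζ.re - x| ≤ ζ.im →
    ‖φ ζ‖ ≤ C * (Real.exp (-δ * ζ.im) * ζ.im ^ (-(1 / 2) : ℝ))) {u : ℂ} (hu : 0 < u.im)
    (hcone : |u.re - x| ≤ u.im) :
    ‖P u - P (x + I * u.im)‖ ≤
      C * (Real.exp (-δ * u.im) * u.im ^ (-(1 / 2) : ℝ)) * |u.re - x| := by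
  have hs : Convex ℝ {ζ : ℂ | ζ.im = u.im ∧ |ζ.re - x| ≤ u.im} := by
    have : {ζ : ℂ | ζ.im = u.im ∧ |ζ.re - x| ≤ u.im} =
        {ζ : ℂ | ζ.im = u.im} ∩ {ζ : ℂ | ζ.re ≤ x + u.im} ∩ {ζ : ℂ | x - u.im ≤ ζ.re} := by
      ext ζ
      simp only [mem_ofPred_eq, mem_inter_iff, abs_le]
      constructor
      · rintro ⟨h1, h2, h3⟩; exact ⟨⟨h1, by linarith⟩, by linarith⟩
      · rintro ⟨⟨h1, h2⟩, h3⟩; exact ⟨h1, by linarith, by linarith⟩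
    rw [this]
    refine ((?_ : Convex ℝ _).inter (convex_halfSpace_re_le _)).inter (convex_halfSpace_re_ge _)
    exact convex_hyperplane (f := Complex.im) ⟨fun _ _ => rfl, fun _ _ => by simp⟩ _
  have key := hs.norm_image_sub_le_of_norm_hasDerivWithin_le (f := P) (f' := φ)
    (C := C * (Real.exp (-δ * u.im) * u.im ^ (-(1 / 2) : ℝ))) (x := (x : ℂ) + I * u.im) (y := u)
    (fun ζ hζ => (hP ζ (by rw [hζ.1]; exact hu)).hasDerivWithinAt)
    (fun ζ hζ => by
      have := h ζ (by rw [hζ.1]; exact hu) (by rw [hζ.1]; exact hζ.2)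
      rwa [hζ.1] at this)
    (by constructor <;> simp [hu.le]) ⟨rfl, hcone⟩
  refine key.trans (le_of_eq ?_)
  congr 1
  have : u - (x + I * u.im) = ((u.re - x : ℝ) : ℂ) := by
    apply Complex.ext <;> simp
  rw [this, Complex.norm_real, Real.norm_eq_abs]

/-- A primitive has the same limit at a cusp along any curve in a cone. -/
theorem tendsto_primitive_of_cone {φ P : ℂ → ℂ} (hP : ∀ τ : ℂ, 0 < τ.im → HasDerivAt P (φ τ) τ)
    (hb : HasConeBound φ) {x : ℚ} {L : ℂ}
    (hL : Tendsto (fun y : ℝ => P (x + I * y)) (𝓝[>] 0) (𝓝 L)) {l : Filter ℝ} {u : ℝ → ℂ}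
    (hu : ∀ᶠ η in l, 0 < (u η).im ∧ |(u η).re - x| ≤ (u η).im)
    (hu0 : Tendsto (fun η => (u η).im) l (𝓝 0)) :
    Tendsto (fun η => P (u η)) l (𝓝 L) := by
  obtain ⟨C, δ, hC, hδ, h⟩ := hb x
  have h1 : Tendsto (fun η => (u η).im) l (𝓝[>] 0) :=
    tendsto_nhdsWithin_iff.2 ⟨hu0, hu.mono fun η h => h.1⟩
  have h2 := hL.comp h1
  -- The horizontal distance to the vertical line is at most `Im u`, and the integrand is at most a
  -- constant times `(Im u) ^ (-1/2)`. The product `(Im u) ^ (1/2)` tends to zero.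
  have h3 : Tendsto (fun η => C * (u η).im ^ (1 / 2 : ℝ)) l (𝓝 0) := by
    have := (hu0.rpow_const (p := 1 / 2) (Or.inr (by norm_num))).const_mul C
    simpa using this
  have h4 : Tendsto (fun η => P (u η) - P (x + I * (u η).im)) l (𝓝 0) := by
    refine squeeze_zero_norm' ?_ h3
    filter_upwards [hu] with η hη
    have := norm_primitive_sub_le hP (x := (x : ℝ)) h hη.1 hη.2
    push_cast at this
    refine this.trans ?_
    have e : (u η).im ^ (1 / 2 : ℝ) = 1 * (u η).im ^ (-(1 / 2) : ℝ) * (u η).im := by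
      rw [one_mul, ← Real.rpow_add_one hη.1.ne']; norm_num
    rw [e, mul_assoc C]
    have hr := Real.rpow_nonneg hη.1.le (-(1 / 2) : ℝ)
    refine mul_le_mul_of_nonneg_left (mul_le_mul (mul_le_mul_of_nonneg_right ?_ hr) hη.2
      (abs_nonneg _) (by positivity)) hC.le
    rw [Real.exp_le_one_iff]
    nlinarith [hη.1]
  simpa using h4.add h2

/-- Two vertical lines are joined at height `y` by a segment of fixed length, which lies in the cone
at `x` once `y` is large. The derivative is exponentially small there, so the two limits at `i∞`
agree. -/
theorem tendsto_primitive_atTop {φ P : ℂ → ℂ} (hP : ∀ τ : ℂ, 0 < τ.im → HasDerivAt P (φ τ) τ)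
    (hb : HasConeBound φ) {x x' : ℚ} {L : ℂ}
    (hL : Tendsto (fun y : ℝ => P (x + I * y)) atTop (𝓝 L)) :
    Tendsto (fun y : ℝ => P (x' + I * y)) atTop (𝓝 L) := by
  obtain ⟨C, δ, hC, hδ, h⟩ := hb x
  have h3 : Tendsto (fun y : ℝ => C * (Real.exp (-δ * y) * 1) * |(x' : ℝ) - x|) atTop (𝓝 0) := by
    have : Tendsto (fun y : ℝ => Real.exp (-δ * y)) atTop (𝓝 0) := by
      refine Real.tendsto_exp_atBot.comp ?_
      exact (tendsto_id).const_mul_atTop_of_neg (by linarith)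
    simpa using ((this.mul_const 1).const_mul C).mul_const |(x' : ℝ) - x|
  have h4 : Tendsto (fun y : ℝ => P (x' + I * y) - P (x + I * y)) atTop (𝓝 0) := by
    refine squeeze_zero_norm' ?_ h3
    filter_upwards [eventually_ge_atTop 1, eventually_ge_atTop |(x' : ℝ) - x|] with y hy1 hy2
    have := norm_primitive_sub_le hP (x := (x : ℝ)) h (u := x' + I * y)
      (by simp; linarith) (by simpa using hy2)
    simp only [add_im, add_re, mul_im, mul_re, Complex.ratCast_im, Complex.ratCast_re, I_re, I_im,
      ofReal_re, ofReal_im, zero_mul, one_mul, zero_add, mul_zero, sub_zero, add_zero,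
      Complex.ofReal_ratCast] at this
    refine this.trans ?_
    gcongr
    exact Real.rpow_le_one_of_one_le_of_nonpos hy1 (by norm_num)
  simpa using h4.add hL

/-! ### The period relation -/

/-- The factor `(-i (u - x)) ^ (-1/2)` of the Eichler integral. -/
def eichlerKernel (x u : ℂ) : ℂ := (-I * (u - x)) ^ ((-(1 / 2) : ℝ) : ℂ)

/-- The Eichler integral of `g` at the rational point `x`, along the vertical line. -/
def eichlerIntegral (g : ℂ → ℂ) (x : ℚ) : ℂ :=
  ∫ y in Ioi (0 : ℝ), g (x + I * y) * ((y ^ (-(1 / 2) : ℝ) : ℝ) : ℂ)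

theorem eichlerKernel_vertical (x : ℂ) {y : ℝ} (hy : 0 < y) :
    eichlerKernel x (x + I * y) = ((y ^ (-(1 / 2) : ℝ) : ℝ) : ℂ) := by
  rw [eichlerKernel, Complex.ofReal_cpow hy.le]
  congr 1
  linear_combination (-(y : ℂ)) * Complex.I_sq

theorem eichlerKernel_base_re {x : ℂ} (hx : x.im = 0) (u : ℂ) : (-I * (u - x)).re = u.im := by
  simp [hx]

theorem differentiableOn_eichlerKernel {x : ℂ} (hx : x.im = 0) :
    DifferentiableOn ℂ (eichlerKernel x) {τ | 0 < τ.im} := by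
  intro u hu
  refine DifferentiableAt.differentiableWithinAt ?_
  unfold eichlerKernel
  refine DifferentiableAt.cpow (by fun_prop) (by fun_prop) (Or.inl ?_)
  rw [eichlerKernel_base_re hx]
  exact hu

theorem norm_eichlerKernel_le {x : ℂ} (hx : x.im = 0) {u : ℂ} (hu : 0 < u.im) :
    ‖eichlerKernel x u‖ ≤ u.im ^ (-(1 / 2) : ℝ) := by
  rw [eichlerKernel, Complex.norm_cpow_real]
  refine Real.rpow_le_rpow_of_nonpos hu ?_ (by norm_num)
  rw [← eichlerKernel_base_re hx u]
  exact Complex.re_le_norm _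

/-- The bounds satisfied by cusp forms in cones at rational points. -/
def IsCuspidal (g : ℂ → ℂ) : Prop :=
  DifferentiableOn ℂ g {τ | 0 < τ.im} ∧
  ∀ x : ℚ, ∃ C δ : ℝ, 0 < C ∧ 0 < δ ∧ ∀ ζ : ℂ, 0 < ζ.im → |ζ.re - x| ≤ ζ.im →
    ‖g ζ‖ ≤ C * Real.exp (-δ * ζ.im)

theorem IsCuspidal.hasConeBound {g : ℂ → ℂ} (hg : IsCuspidal g) {x : ℂ} (hx : x.im = 0) :
    HasConeBound fun u => g u * eichlerKernel x u := by
  intro x₀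
  obtain ⟨C, δ, hC, hδ, h⟩ := hg.2 x₀
  refine ⟨C, δ, hC, hδ, fun ζ hζ hcone => ?_⟩
  rw [norm_mul, ← mul_assoc]
  exact mul_le_mul (h ζ hζ hcone) (norm_eichlerKernel_le hx hζ) (norm_nonneg _) (by positivity)

theorem IsCuspidal.differentiableOn_mul_kernel {g : ℂ → ℂ} (hg : IsCuspidal g) {x : ℂ}
    (hx : x.im = 0) :
    DifferentiableOn ℂ (fun u => g u * eichlerKernel x u) {τ | 0 < τ.im} :=
  hg.1.mul (differentiableOn_eichlerKernel hx)

theorem eichlerIntegral_eq (g : ℂ → ℂ) (x : ℚ) :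
    eichlerIntegral g x = ∫ y in Ioi (0 : ℝ), g (x + I * y) * eichlerKernel x (x + I * y) := by
  refine MeasureTheory.setIntegral_congr_fun measurableSet_Ioi fun y hy => ?_
  rw [eichlerKernel_vertical _ hy]

theorem IsCuspidal.integrableOn_mul_rpow {g : ℂ → ℂ} (hg : IsCuspidal g) (x : ℚ) :
    MeasureTheory.IntegrableOn
      (fun y : ℝ => g (x + I * y) * ((y ^ (-(1 / 2) : ℝ) : ℝ) : ℂ)) (Ioi 0) := by
  refine (integrableOn_vertical (hg.differentiableOn_mul_kernel (x := x) (by simp)).continuousOn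
    (hg.hasConeBound (by simp)) x).congr_fun (fun y hy => ?_) measurableSet_Ioi
  simp only
  rw [eichlerKernel_vertical _ hy]

theorem log_neg_of_im_pos {z : ℂ} (hz : 0 < z.im) : Complex.log (-z) = Complex.log z - Real.pi * I := by
  rw [Complex.log, Complex.log, Complex.arg_neg_eq_arg_sub_pi_of_im_pos hz, norm_neg]
  push_cast; ring

theorem log_neg_of_im_neg {z : ℂ} (hz : z.im < 0) : Complex.log (-z) = Complex.log z + Real.pi * I := by
  rw [Complex.log, Complex.log, Complex.arg_neg_eq_arg_add_pi_of_im_neg hz, norm_neg]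
  push_cast; ring

/-- Comparison of branches along the geodesic that ends in `x`. -/
theorem cpow_eq_autFactorReal (γ : Matrix.SpecialLinearGroup (Fin 2) ℤ) {x : ℝ}
    (hx : (γ 1 0 : ℝ) * x + γ 1 1 ≠ 0) {J : ℂ} (hJ : J ≠ 0) (hJp : 0 < γ 1 0 → 0 < J.im)
    (hJn : ¬ 0 < γ 1 0 → J.im < 0) {η : ℝ} (hη : 0 < η) :
    (η * ((γ 1 0 : ℝ) * x + γ 1 1 : ℝ) * J) ^ ((-(1 / 2) : ℝ) : ℂ) * J ^ (1 / 2 : ℂ) =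
      autFactorReal (-(1 / 2)) γ x * ((η ^ (-(1 / 2) : ℝ) : ℝ) : ℂ) := by
  set j : ℝ := (γ 1 0 : ℝ) * x + γ 1 1 with hj
  have hηc : (η : ℂ) ≠ 0 := Complex.ofReal_ne_zero.2 hη.ne'
  have hjc : (j : ℂ) ≠ 0 := Complex.ofReal_ne_zero.2 hx
  rw [autFactorReal, ← hj, Real.rpow_def_of_pos hη, Complex.cpow_def_of_ne_zero hJ,
    Complex.cpow_def_of_ne_zero (mul_ne_zero (mul_ne_zero hηc hjc) hJ), ← Complex.exp_add]
  rcases hx.lt_or_gt with h | h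
  · rw [if_neg (not_le.2 h), Real.rpow_def_of_pos (neg_pos.2 h)]
    -- For negative `cx + d` the base is a positive multiple of `-J`. Here `log (-J)` differs from
    -- `log J` by `∓πi` according to the sign of `Im J`, hence of `c`; this produces the two cases
    -- of `autFactorReal`.
    have e : (η * j * J : ℂ) = ((η * -j : ℝ) : ℂ) * -J := by push_cast; ring
    rw [e, Complex.log_ofReal_mul (by nlinarith) (neg_ne_zero.2 hJ),
      Real.log_mul hη.ne' (neg_ne_zero.2 h.ne)]
    split_ifs with hc
    · rw [log_neg_of_im_pos (hJp hc)]
      push_cast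
      rw [← Complex.exp_add, ← Complex.exp_add]
      congr 1
      ring
    · rw [log_neg_of_im_neg (hJn hc)]
      push_cast
      rw [← Complex.exp_add, ← Complex.exp_add]
      congr 1
      ring
  · rw [if_pos h.le, Real.rpow_def_of_pos h]
    have e : (η * j * J : ℂ) = ((η * j : ℝ) : ℂ) * J := by push_cast; ring
    rw [e, Complex.log_ofReal_mul (by positivity) hJ, Real.log_mul hη.ne' h.ne']
    push_cast
    rw [← Complex.exp_add]
    congr 1
    ring

/-- The geodesic from `x` to `-d/c` that `γ` maps to the vertical line over `γ x`. -/
def geodesic (c d j η : ℝ) : ℂ := ((j : ℂ) / (1 - I * (η * c * j : ℝ)) - d) / c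

theorem one_sub_I_mul_ne_zero (r : ℝ) : (1 : ℂ) - I * r ≠ 0 := fun h => by
  have := congrArg Complex.re h
  simp at this

theorem geodesic_eq {c : ℝ} (hc : c ≠ 0) (d j η : ℝ) :
    geodesic c d j η = (((j / (1 + (η * c * j) ^ 2) - d) / c : ℝ) : ℂ) +
      ((η * j ^ 2 / (1 + (η * c * j) ^ 2) : ℝ) : ℂ) * I := by
  have h1 := one_sub_I_mul_ne_zero (η * c * j)
  have hcc : (c : ℂ) ≠ 0 := Complex.ofReal_ne_zero.2 hc
  have h2 : (1 + (η * c * j) ^ 2 : ℂ) ≠ 0 := by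
    have : (1 + (η * c * j) ^ 2 : ℝ) ≠ 0 := by positivity
    exact_mod_cast this
  have h3 : (j : ℂ) / (1 - I * (η * c * j : ℝ)) = (j + η * c * j ^ 2 * I) / (1 + (η * c * j) ^ 2) := by
    rw [div_eq_div_iff h1 h2]
    push_cast
    linear_combination (η ^ 2 * c ^ 2 * j ^ 3 : ℂ) * Complex.I_sq
  rw [geodesic, h3]
  push_cast
  field_simp
  ring

theorem geodesic_im {c : ℝ} (hc : c ≠ 0) (d j η : ℝ) :
    (geodesic c d j η).im = η * j ^ 2 / (1 + (η * c * j) ^ 2) := by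
  rw [geodesic_eq hc]; simp [-Complex.ofReal_div, -Complex.ofReal_mul, -Complex.ofReal_sub]

theorem geodesic_re {c : ℝ} (hc : c ≠ 0) (d j η : ℝ) :
    (geodesic c d j η).re = (j / (1 + (η * c * j) ^ 2) - d) / c := by
  rw [geodesic_eq hc]; simp [-Complex.ofReal_div, -Complex.ofReal_mul, -Complex.ofReal_sub]

theorem hasDerivAt_geodesic {c : ℝ} (hc : c ≠ 0) (d j η : ℝ) :
    HasDerivAt (geodesic c d j) (I * ((j : ℂ) / (1 - I * (η * c * j : ℝ))) ^ 2) η := by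
  have h1 := one_sub_I_mul_ne_zero (η * c * j)
  have hcc : (c : ℂ) ≠ 0 := Complex.ofReal_ne_zero.2 hc
  have h0 : HasDerivAt (fun η : ℝ => ((η * c * j : ℝ) : ℂ)) ((1 * c * j : ℝ) : ℂ) η :=
    (((hasDerivAt_id η).mul_const c).mul_const j).ofReal_comp
  have h2 := ((((h0.const_mul I).const_sub 1).fun_inv h1).const_mul (j : ℂ)).sub_const (d : ℂ)
  have h3 := h2.div_const (c : ℂ)
  refine (h3.congr_deriv ?_).congr_of_eventuallyEq (Eventually.of_forall fun η => ?_)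
  · push_cast at h1 ⊢
    field_simp
  · simp only [geodesic, div_eq_mul_inv]

theorem tendsto_geodesic_im_zero {c : ℝ} (hc : c ≠ 0) (d j : ℝ) :
    Tendsto (fun η => (geodesic c d j η).im) (𝓝[>] 0) (𝓝 0) := by
  have : ContinuousAt (fun η : ℝ => η * j ^ 2 / (1 + (η * c * j) ^ 2)) 0 := by
    refine ContinuousAt.div (by fun_prop) (by fun_prop) (by positivity)
  have h := this.tendsto.mono_left (nhdsWithin_le_nhds (s := Ioi 0))
  simp only [geodesic_im hc]
  simpa using h

theorem tendsto_geodesic_im_atTop {c : ℝ} (hc : c ≠ 0) (d : ℝ) {j : ℝ} (hj : j ≠ 0) :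
    Tendsto (fun η => (geodesic c d j η).im) atTop (𝓝 0) := by
  simp only [geodesic_im hc]
  have h : Tendsto (fun η : ℝ => (c ^ 2)⁻¹ * η⁻¹) atTop (𝓝 0) := by
    simpa using tendsto_inv_atTop_zero.const_mul ((c ^ 2)⁻¹)
  refine squeeze_zero' ?_ ?_ h
  · filter_upwards [eventually_ge_atTop 0] with η hη
    positivity
  · filter_upwards [eventually_gt_atTop 0] with η hη
    rw [← mul_inv, div_le_iff₀ (by positivity)]
    have : (c ^ 2 * η)⁻¹ * (1 + (η * c * j) ^ 2) = (c ^ 2 * η)⁻¹ + η * j ^ 2 := by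
      field_simp
    rw [this]
    have : 0 < (c ^ 2 * η)⁻¹ := by positivity
    linarith

/-- The geodesic meets the real axis perpendicularly: its real part deviates from `x` by `-η c j`
times the height. So it enters the cone at `x` as soon as `η |c j| ≤ 1`. -/
theorem geodesic_cone_zero {c : ℝ} (hc : c ≠ 0) (d : ℝ) {j x : ℝ} (hj : j ≠ 0)
    (hx : c * x + d = j) : ∀ᶠ η in 𝓝[>] (0 : ℝ),
      0 < (geodesic c d j η).im ∧ |(geodesic c d j η).re - x| ≤ (geodesic c d j η).im := by
  have hcj : 0 < |c * j| := abs_pos.2 (mul_ne_zero hc hj)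
  filter_upwards [self_mem_nhdsWithin, nhdsWithin_le_nhds (gt_mem_nhds (inv_pos.2 hcj))]
    with η hη hη1
  have hη : 0 < η := hη
  have hS : 0 < 1 + (η * c * j) ^ 2 := by positivity
  have him : 0 < η * j ^ 2 / (1 + (η * c * j) ^ 2) := by positivity
  rw [geodesic_im hc, geodesic_re hc]
  refine ⟨him, ?_⟩
  have e : (j / (1 + (η * c * j) ^ 2) - d) / c - x =
      -(η * (c * j)) * (η * j ^ 2 / (1 + (η * c * j) ^ 2)) := by
    rw [show d = j - c * x by linarith]
    field_simp
    ring
  rw [e, abs_mul, abs_neg, abs_mul, abs_of_pos hη, abs_of_pos him]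
  have : η * |c * j| ≤ 1 := by
    rw [← inv_mul_cancel₀ hcj.ne']
    gcongr
  nlinarith

theorem geodesic_cone_atTop {c : ℝ} (hc : c ≠ 0) (d : ℝ) {j : ℝ} (hj : j ≠ 0) :
    ∀ᶠ η in (atTop : Filter ℝ), 0 < (geodesic c d j η).im ∧
      |(geodesic c d j η).re - -d / c| ≤ (geodesic c d j η).im := by
  have hcj : 0 < |c * j| := abs_pos.2 (mul_ne_zero hc hj)
  filter_upwards [eventually_gt_atTop 0, eventually_ge_atTop |c * j|⁻¹] with η hη hη1
  have hS : 0 < 1 + (η * c * j) ^ 2 := by positivity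
  rw [geodesic_im hc, geodesic_re hc]
  refine ⟨by positivity, ?_⟩
  have e : (j / (1 + (η * c * j) ^ 2) - d) / c - -d / c = j ^ 2 / (1 + (η * c * j) ^ 2) * (c * j)⁻¹ := by
    field_simp
    ring
  rw [e, abs_mul, abs_of_nonneg (by positivity), abs_inv]
  calc j ^ 2 / (1 + (η * c * j) ^ 2) * |c * j|⁻¹ ≤ j ^ 2 / (1 + (η * c * j) ^ 2) * η := by gcongr
    _ = _ := by ring

/-- The part of the period integral of `g` over the vertical line at `-d/c`, as a function of `x`,
is real-analytic away from `-d/c`. -/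
theorem analyticOnNhd_periodIntegral {g : ℂ → ℂ} (hg : IsCuspidal g) (x₀ : ℚ) :
    AnalyticOnNhd ℝ (fun x : ℝ => ∫ y in Ioi (0 : ℝ), g (x₀ + I * y) *
      eichlerKernel x (x₀ + I * y)) {x | x ≠ x₀} := by
  -- The integral is extended to complex `ξ` off the vertical line `Re ξ = x₀`. There the base of
  -- the kernel has imaginary part `Re ξ - x₀ ≠ 0` for every `y`, so it avoids the branch cut, and
  -- differentiation under the integral applies.
  have hd : DifferentiableOn ℂ (fun ξ : ℂ => ∫ y in Ioi (0 : ℝ), g (x₀ + I * y) *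
      eichlerKernel ξ (x₀ + I * y)) {ξ | ξ.re ≠ x₀} := by
    intro ξ₀ hξ₀
    refine DifferentiableAt.differentiableWithinAt ?_
    have hξ₀' : ξ₀.re - x₀ ≠ 0 := sub_ne_zero.2 hξ₀
    set ρ := |ξ₀.re - x₀| / 2 with hρ
    have hρ0 : 0 < ρ := half_pos (abs_pos.2 hξ₀')
    have him : ∀ (ξ : ℂ) (y : ℝ), (-I * (x₀ + I * y - ξ)).im = ξ.re - x₀ := fun ξ y => by simp
    have hlow : ∀ ξ ∈ Metric.ball ξ₀ ρ, ρ ≤ |ξ.re - x₀| := fun ξ hξ => by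
      have h1 : |(ξ - ξ₀).re| ≤ ‖ξ - ξ₀‖ := Complex.abs_re_le_norm _
      have h2 : ‖ξ - ξ₀‖ < ρ := by rwa [← dist_eq_norm]
      have h3 : |ξ₀.re - x₀| ≤ |ξ.re - x₀| + |(ξ - ξ₀).re| := by
        have := abs_sub_le ξ₀.re ξ.re x₀
        rw [Complex.sub_re, abs_sub_comm ξ.re ξ₀.re]
        linarith
      linarith
    have hslit : ∀ ξ ∈ Metric.ball ξ₀ ρ, ∀ y : ℝ, -I * (x₀ + I * y - ξ) ∈ slitPlane :=
      fun ξ hξ y => Or.inr (by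
        rw [him]
        exact abs_pos.1 (hρ0.trans_le (hlow ξ hξ)))
    have hnorm : ∀ ξ ∈ Metric.ball ξ₀ ρ, ∀ y : ℝ, ∀ p : ℝ, p ≤ 0 →
        ‖(-I * (x₀ + I * y - ξ)) ^ (p : ℂ)‖ ≤ ρ ^ p := fun ξ hξ y p hp => by
      rw [Complex.norm_cpow_real]
      refine Real.rpow_le_rpow_of_nonpos hρ0 ((hlow ξ hξ).trans ?_) hp
      rw [← him ξ y]
      exact Complex.abs_im_le_norm _
    obtain ⟨C, δ, hC, hδ, hb⟩ := hg.2 x₀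
    have hgb : ∀ y ∈ Ioi (0 : ℝ), ‖g (x₀ + I * y)‖ ≤ C * Real.exp (-δ * y) := fun y hy => by
      have hy : (0 : ℝ) < y := hy
      have := hb (x₀ + I * y) (by simpa using hy) (by simpa using hy.le)
      simpa using this
    have hgc : ContinuousOn (fun y : ℝ => g (x₀ + I * y)) (Ioi 0) := by
      refine hg.1.continuousOn.comp (by fun_prop) fun y hy => ?_
      have : (0 : ℝ) < y := hy
      simpa using this
    have hmeas : ∀ ξ ∈ Metric.ball ξ₀ ρ, ∀ p : ℝ, MeasureTheory.AEStronglyMeasurable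
        (fun y : ℝ => g (x₀ + I * y) * (-I * (x₀ + I * y - ξ)) ^ (p : ℂ))
        (MeasureTheory.volume.restrict (Ioi 0)) := fun ξ hξ p => by
      refine ContinuousOn.aestronglyMeasurable (hgc.mul ?_) measurableSet_Ioi
      refine ContinuousOn.cpow (by fun_prop) (by fun_prop) fun y _ => hslit ξ hξ y
    have hexp : MeasureTheory.IntegrableOn (fun y : ℝ => Real.exp (-δ * y)) (Ioi 0) :=
      integrableOn_exp_mul_Ioi (by linarith) 0
    have hself := Metric.mem_ball_self (x := ξ₀) hρ0
    refine (hasDerivAt_integral_of_dominated_loc_of_deriv_le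
      (F := fun ξ (y : ℝ) => g (x₀ + I * y) * eichlerKernel ξ (x₀ + I * y))
      (F' := fun ξ (y : ℝ) => g (x₀ + I * y) * (-I * (x₀ + I * y - ξ)) ^ ((-(1 / 2) - 1 : ℝ) : ℂ) *
        (((-(1 / 2) : ℝ) : ℂ) * I))
      (bound := fun y => C * Real.exp (-δ * y) * ρ ^ (-(1 / 2) - 1 : ℝ) * (1 / 2))
      (Metric.ball_mem_nhds ξ₀ hρ0) ?_ ?_ ?_ ?_ ?_ ?_).2.differentiableAt
    · filter_upwards [Metric.ball_mem_nhds ξ₀ hρ0] with ξ hξ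
      exact hmeas ξ hξ _
    · refine MeasureTheory.Integrable.mono' ((hexp.const_mul C).mul_const (ρ ^ (-(1 / 2) : ℝ)))
        (hmeas ξ₀ hself _) ?_
      refine (MeasureTheory.ae_restrict_iff' measurableSet_Ioi).2 (Eventually.of_forall fun y hy => ?_)
      rw [norm_mul]
      exact mul_le_mul (hgb y hy) (hnorm ξ₀ hself y _ (by norm_num)) (norm_nonneg _)
        (by positivity)
    · exact (hmeas ξ₀ hself _).mul_const _
    · refine (MeasureTheory.ae_restrict_iff' measurableSet_Ioi).2
        (Eventually.of_forall fun y hy ξ hξ => ?_)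
      rw [norm_mul, norm_mul]
      refine mul_le_mul (mul_le_mul (hgb y hy) (hnorm ξ hξ y _ (by norm_num)) (norm_nonneg _)
        (by positivity)) ?_ (norm_nonneg _) (by positivity)
      rw [norm_mul, Complex.norm_I, Complex.norm_real]
      norm_num
    · exact ((hexp.const_mul C).mul_const _).mul_const _
    · refine (MeasureTheory.ae_restrict_iff' measurableSet_Ioi).2
        (Eventually.of_forall fun y hy ξ hξ => ?_)
      have h1 : HasDerivAt (fun ξ : ℂ => -I * (x₀ + I * y - ξ)) (-I * -1) ξ :=
        ((hasDerivAt_id ξ).const_sub _).const_mul _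
      have h2 := (h1.cpow_const (c := ((-(1 / 2) : ℝ) : ℂ)) (hslit ξ hξ y)).const_mul
        (g (x₀ + I * y))
      refine h2.congr_deriv ?_
      push_cast
      ring
  have hopen : IsOpen {ξ : ℂ | ξ.re ≠ x₀} :=
    isOpen_ne_fun Complex.continuous_re continuous_const
  intro x hx
  have h1 := (hd.analyticOnNhd hopen (x : ℂ) (by simpa using hx)).restrictScalars (𝕜 := ℝ)
  exact h1.comp (f := fun x : ℝ => (x : ℂ)) (Complex.ofRealCLM.analyticAt x)

/-- The period relation for Eichler integrals of cusp forms of weight `3/2`. -/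
theorem eichlerIntegral_sub_eq {g : ℂ → ℂ} (hg : IsCuspidal g)
    {γ : Matrix.SpecialLinearGroup (Fin 2) ℤ} {v : ℂ} (hv : v ≠ 0)
    (hmod : ∀ τ : ℂ, 0 < τ.im → g (moebius γ τ) =
      v * (moebiusDenom γ τ * moebiusDenom γ τ ^ (1 / 2 : ℂ)) * g τ) (hc : γ 1 0 ≠ 0) {x : ℚ}
    (hx : (γ 1 0 : ℚ) * x + γ 1 1 ≠ 0) :
    eichlerIntegral g x - v⁻¹ * autFactorReal (-(1 / 2)) γ x * eichlerIntegral g (moebius γ x) =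
      ∫ y in Ioi (0 : ℝ), g ((-(γ 1 1 : ℚ) / (γ 1 0 : ℚ) : ℚ) + I * y) *
        eichlerKernel (x : ℝ) ((-(γ 1 1 : ℚ) / (γ 1 0 : ℚ) : ℚ) + I * y) := by
  set c : ℝ := (γ 1 0 : ℝ) with hcd
  set d : ℝ := (γ 1 1 : ℝ) with hdd
  set j : ℝ := c * x + d with hj
  have hc0 : c ≠ 0 := Int.cast_ne_zero.2 hc
  have hj0 : j ≠ 0 := by rw [hj, hcd, hdd]; exact_mod_cast hx
  have hcc : (c : ℂ) ≠ 0 := Complex.ofReal_ne_zero.2 hc0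
  have hjc : (j : ℂ) ≠ 0 := Complex.ofReal_ne_zero.2 hj0
  set x₀ : ℚ := -(γ 1 1 : ℚ) / (γ 1 0 : ℚ) with hx₀
  have hx₀r : (x₀ : ℝ) = -d / c := by rw [hx₀]; push_cast; rfl
  set φ : ℂ → ℂ := fun u => g u * eichlerKernel x u with hφ
  have hφb : HasConeBound φ := hg.hasConeBound (by simp)
  have hφd : DifferentiableOn ℂ φ {τ | 0 < τ.im} := hg.differentiableOn_mul_kernel (by simp)
  obtain ⟨P, hP⟩ := exists_primitive_upperHalf hφd
  have vert : ∀ r : ℚ, ∃ L₀ L₁ : ℂ, Tendsto (fun y : ℝ => P (r + I * y)) (𝓝[>] 0) (𝓝 L₀) ∧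
      Tendsto (fun y : ℝ => P (r + I * y)) atTop (𝓝 L₁) ∧
      (∫ y in Ioi (0 : ℝ), φ (r + I * y)) * I = L₁ - L₀ := fun r => by
    obtain ⟨L₀, L₁, h1, h2, h3⟩ := exists_tendsto_of_hasDerivAt_Ioi
      (fun y hy => hasDerivAt_vertical hP (r : ℂ) (by simp) hy)
      ((integrableOn_vertical hφd.continuousOn hφb r).mul_const I)
    rw [MeasureTheory.integral_mul_const] at h3
    exact ⟨L₀, L₁, h1, h2, h3⟩
  obtain ⟨A₀, A₁, hA0, hA1, hA⟩ := vert x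
  obtain ⟨B₀, B₁, hB0, hB1, hB⟩ := vert x₀
  -- The verticals at `x` and at `x₀ = -d/c` both end in `i∞`, so the contributions of that end
  -- cancel in the difference.
  have hAB : B₁ = A₁ := tendsto_nhds_unique hB1 (tendsto_primitive_atTop hP hφb hA1)
  set u := geodesic c d j with hu
  have him : ∀ η : ℝ, 0 < η → 0 < (u η).im := fun η hη => by
    rw [hu, geodesic_im hc0]
    have := hj0
    positivity
  have hJ : ∀ η : ℝ, moebiusDenom γ (u η) = (j : ℂ) / (1 - I * (η * c * j : ℝ)) := fun η => by
    rw [moebiusDenom, hu, geodesic, show (γ 1 0 : ℂ) = (c : ℂ) by rw [hcd]; simp,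
      show (γ 1 1 : ℂ) = (d : ℂ) by rw [hdd]; simp, mul_div_cancel₀ _ hcc]
    ring
  have hux : ∀ η : ℝ, -I * (u η - x) = η * j * moebiusDenom γ (u η) := fun η => by
    have h1 := one_sub_I_mul_ne_zero (η * c * j)
    have hxc : (x : ℂ) = (j - d) / c := by
      rw [eq_div_iff hcc, hj]; push_cast; ring
    rw [hJ, hu, geodesic, hxc]
    generalize hE : (1 : ℂ) - I * (η * c * j : ℝ) = E at h1
    push_cast at hE
    field_simp
    linear_combination (-I * j) * hE - (η * c * j ^ 2 : ℂ) * Complex.I_sq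
  have hmx : ((moebius γ x : ℚ) : ℂ) = moebius γ (x : ℂ) := by simp [moebius]
  have hγu : ∀ η : ℝ, moebius γ (u η) = (moebius γ x : ℚ) + I * η := fun η => by
    have h1 := one_sub_I_mul_ne_zero (η * c * j)
    have hxJ : moebiusDenom γ (x : ℂ) = j := by
      rw [moebiusDenom, hj, hcd, hdd]; push_cast; rfl
    have hdet := det_entries_complex γ
    have hxc : (x : ℂ) = (j - d) / c := by
      rw [eq_div_iff hcc, hj]; push_cast; ring
    rw [hmx, moebius_eq_div, moebius_eq_div, hxJ, hJ, hu, geodesic, hxc]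
    rw [show (γ 1 0 : ℂ) = (c : ℂ) by rw [hcd]; simp,
      show (γ 1 1 : ℂ) = (d : ℂ) by rw [hdd]; simp] at hdet
    generalize hE : (1 : ℂ) - I * (η * c * j : ℝ) = E at h1
    push_cast at hE
    field_simp
    linear_combination (1 - E) * hdet + hE
  -- Change of variables `u = γ⁻¹(γx + iη)`. The derivative of the curve is `i J²`, modularity of
  -- `g` supplies `J ^ (3/2)`, and the kernel at `u` contributes the remaining `J ^ (-1/2)` together
  -- with the automorphy factor at `x`.
  have hder : ∀ η ∈ Ioi (0 : ℝ), HasDerivAt (fun η => P (u η))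
      (v⁻¹ * autFactorReal (-(1 / 2)) γ x * (g ((moebius γ x : ℚ) + I * η) *
        ((η ^ (-(1 / 2) : ℝ) : ℝ) : ℂ)) * I) η := fun η hη => by
    have hη : (0 : ℝ) < η := hη
    have h1 := HasDerivAt.comp η (hP _ (him η hη)) (hasDerivAt_geodesic hc0 d j η)
    refine h1.congr_deriv ?_
    have hJ0 := moebiusDenom_ne_zero γ (him η hη).ne'
    have hJim := moebiusDenom_im γ (u η)
    have hb := cpow_eq_autFactorReal γ (x := x) (by rw [← hcd, ← hdd, ← hj]; exact hj0) hJ0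
      (fun h => by
        rw [hJim]; exact mul_pos (Int.cast_pos.2 h) (him η hη))
      (fun h => by
        rw [hJim]
        exact mul_neg_of_neg_of_pos (Int.cast_lt_zero.2 (lt_of_le_of_ne (not_lt.1 h) hc))
          (him η hη)) hη
    rw [← hcd, ← hdd, ← hj] at hb
    rw [← hJ, hφ]
    simp only
    rw [← hγu, hmod _ (him η hη), eichlerKernel, hux]
    have hs := cpow_half_mul_self hJ0
    have hvv : v⁻¹ * v = 1 := inv_mul_cancel₀ hv
    generalize moebiusDenom γ (u η) ^ (1 / 2 : ℂ) = s at *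
    generalize moebiusDenom γ (u η) = J at *
    generalize (η * j * J : ℂ) ^ ((-(1 / 2) : ℝ) : ℂ) = K at *
    generalize autFactorReal (-(1 / 2)) γ x = B at *
    generalize ((η ^ (-(1 / 2) : ℝ) : ℝ) : ℂ) = r at *
    linear_combination (J * s * g (u η) * I) * hb - (K * g (u η) * I * J) * hs -
      (B * r * J * s * g (u η) * I) * hvv
  have hint : MeasureTheory.IntegrableOn (fun η : ℝ => v⁻¹ * autFactorReal (-(1 / 2)) γ x *
      (g ((moebius γ x : ℚ) + I * η) * ((η ^ (-(1 / 2) : ℝ) : ℝ) : ℂ)) * I) (Ioi 0) :=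
    ((hg.integrableOn_mul_rpow (moebius γ x)).const_mul _).mul_const _
  obtain ⟨D₀, D₁, hD0, hD1, hD⟩ := exists_tendsto_of_hasDerivAt_Ioi hder hint
  -- The geodesic reaches `x` and `-d/c` inside cones, so its endpoint limits agree with the
  -- vertical ones. The relation is then `(A₁ - A₀) - (B₀ - A₀) = B₁ - B₀`.
  have e0 : D₀ = A₀ := tendsto_nhds_unique hD0
    (tendsto_primitive_of_cone hP hφb hA0 (geodesic_cone_zero hc0 d hj0 rfl)
      (tendsto_geodesic_im_zero hc0 d j))
  have e1 : D₁ = B₀ := tendsto_nhds_unique hD1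
    (tendsto_primitive_of_cone hP hφb hB0 (by
      have := geodesic_cone_atTop hc0 d hj0
      rwa [← hx₀r] at this) (tendsto_geodesic_im_atTop hc0 d hj0))
  rw [MeasureTheory.integral_mul_const, MeasureTheory.integral_const_mul, e0, e1] at hD
  rw [eichlerIntegral_eq g x]
  refine mul_right_cancel₀ Complex.I_ne_zero ?_
  rw [Complex.ofReal_ratCast]
  change _ = (∫ y in Ioi (0 : ℝ), φ (x₀ + I * y)) * I
  rw [sub_mul, hB, hAB]
  change (∫ y in Ioi (0 : ℝ), φ (x + I * y)) * I - _ = _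
  rw [hA]
  unfold eichlerIntegral
  linear_combination -hD

/-! ### False theta functions as Eichler integrals -/

/-- The false theta function `∑ sgn(n + a) q^{(n + a)²}`. -/
def signedTheta (a : ℝ) (τ : ℂ) : ℂ :=
  ∑' n : ℤ, ((Real.sign (n + a) : ℝ) : ℂ) * qPow τ ((n + a) ^ 2)

theorem norm_qPow (τ : ℂ) (r : ℝ) : ‖qPow τ r‖ = Real.exp (-2 * Real.pi * r * τ.im) := by
  rw [qPow, Complex.norm_exp]
  congr 1
  rw [show (2 * Real.pi * I * r * τ : ℂ) = ((2 * Real.pi * r : ℝ) : ℂ) * (I * τ) by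
    push_cast; ring, Complex.re_ofReal_mul]
  simp

theorem qPow_add (τ : ℂ) (r s : ℝ) : qPow τ (r + s) = qPow τ r * qPow τ s := by
  rw [qPow, qPow, qPow, ← Complex.exp_add]; push_cast; ring_nf

theorem qPow_zero (τ : ℂ) : qPow τ 0 = 1 := by simp [qPow]

theorem summable_exp_sq (a : ℝ) {t : ℝ} (ht : 0 < t) :
    Summable fun n : ℤ => Real.exp (-2 * Real.pi * (n + a) ^ 2 * t) := by
  refine (HurwitzKernelBounds.summable_f_int 0 a (t := 2 * t) (by positivity)).congr fun n => ?_
  rw [HurwitzKernelBounds.f_int, pow_zero, one_mul]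
  ring_nf

theorem unaryTheta_eq_tsum (a : ℝ) (τ : ℂ) :
    unaryTheta a τ = ∑' n : ℤ, (-2 * Real.pi * (n + a) : ℝ) * qPow τ ((n + a) ^ 2) := by
  rw [unaryTheta, charThetaDeriv]
  refine tsum_congr fun n => ?_
  -- For `β = 1/2` the phase is `exp (πi (2n + 1/2)) = i` for every `n`, so no alternating signs
  -- remain.
  have h1 : cexp (Real.pi * I * (n + 2 * (n + 1 / 2) * ((1 / 2 : ℝ) : ℂ))) = I := by
    rw [show (Real.pi * I * (n + 2 * (n + 1 / 2) * ((1 / 2 : ℝ) : ℂ)) : ℂ) =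
      Real.pi / 2 * I + n * (2 * Real.pi * I) by push_cast; ring, Complex.exp_add,
      Complex.exp_int_mul_two_pi_mul_I, Complex.exp_pi_div_two_mul_I, mul_one]
  rw [charThetaDerivTerm, h1, qPow, show a - 1 / 2 + 1 / 2 = a by ring]
  have h2 : (Real.pi * I * (n + (a : ℂ)) ^ 2 * (2 * τ) : ℂ) =
      2 * Real.pi * I * (((n + a) ^ 2 : ℝ) : ℂ) * τ := by push_cast; ring
  rw [h2]
  push_cast
  linear_combination (2 * Real.pi * (n + a) *
    cexp (2 * Real.pi * I * ((n + a) ^ 2) * τ) : ℂ) * Complex.I_sq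

theorem isCuspidal_unaryTheta (a : ℝ) : IsCuspidal (unaryTheta a) :=
  ⟨differentiableOn_unaryTheta a, exists_norm_unaryTheta_le_of_cone a⟩

theorem qPow_vertical (τ : ℂ) (r y : ℝ) :
    qPow (τ + I * y) r = qPow τ r * ((Real.exp (-2 * Real.pi * r * y) : ℝ) : ℂ) := by
  rw [qPow, qPow, mul_add, Complex.exp_add]
  push_cast
  congr 2
  linear_combination (2 * Real.pi * r * y : ℂ) * Complex.I_sq

theorem integral_exp_mul_rpow_neg_half {α : ℝ} (hα : α ≠ 0) :
    ∫ y in Ioi (0 : ℝ), Real.exp (-2 * Real.pi * α ^ 2 * y) * y ^ (-(1 / 2) : ℝ) =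
      1 / (√2 * |α|) := by
  have h := Real.integral_rpow_mul_exp_neg_mul_Ioi (a := 1 / 2) (r := 2 * Real.pi * α ^ 2)
    (by norm_num) (by positivity)
  rw [Real.Gamma_one_half_eq] at h
  have e : ∫ y in Ioi (0 : ℝ), Real.exp (-2 * Real.pi * α ^ 2 * y) * y ^ (-(1 / 2) : ℝ) =
      ∫ t in Ioi (0 : ℝ), t ^ ((1 / 2 : ℝ) - 1) * Real.exp (-(2 * Real.pi * α ^ 2 * t)) := by
    refine MeasureTheory.setIntegral_congr_fun measurableSet_Ioi fun y _ => ?_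
    rw [mul_comm]
    norm_num
  rw [e, h, ← Real.sqrt_eq_rpow, Real.sqrt_div zero_le_one, Real.sqrt_one,
    Real.sqrt_mul (by positivity), Real.sqrt_mul zero_le_two, Real.sqrt_sq_eq_abs]
  have := Real.sqrt_ne_zero'.2 Real.pi_pos
  field_simp

theorem integrableOn_qPow_mul_rpow (τ : ℂ) {α : ℝ} (hα : α ≠ 0) :
    MeasureTheory.IntegrableOn
      (fun y : ℝ => qPow (τ + I * y) (α ^ 2) * ((y ^ (-(1 / 2) : ℝ) : ℝ) : ℂ)) (Ioi 0) := by
  have hi := integrableOn_exp_mul_rpow_neg_half (δ := 2 * Real.pi * α ^ 2) (by positivity)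
  have := (MeasureTheory.Integrable.ofReal (𝕜 := ℂ) hi).const_mul (qPow τ (α ^ 2))
  refine this.congr (Eventually.of_forall fun y => ?_)
  simp only [qPow_vertical]
  change qPow τ (α ^ 2) * ((Real.exp (-(2 * Real.pi * α ^ 2) * y) * y ^ (-(1 / 2) : ℝ) : ℝ) : ℂ) = _
  rw [Complex.ofReal_mul, ← mul_assoc]
  ring_nf

/-- The Eichler integral over the vertical half-line above a point of the upper half-plane. -/
theorem signedTheta_eq_integral (a : ℝ) {τ : ℂ} (hτ : 0 < τ.im) :
    signedTheta a τ = -(1 / (√2 * Real.pi) : ℝ) *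
      ∫ y in Ioi (0 : ℝ), unaryTheta a (τ + I * y) * ((y ^ (-(1 / 2) : ℝ) : ℝ) : ℂ) := by
  set F : ℤ → ℝ → ℂ := fun n y => ((-2 * Real.pi * (n + a) : ℝ) : ℂ) *
    (qPow (τ + I * y) ((n + a) ^ 2) * ((y ^ (-(1 / 2) : ℝ) : ℝ) : ℂ)) with hF
  have hint : ∀ n : ℤ, MeasureTheory.IntegrableOn (F n) (Ioi 0) := fun n => by
    -- If `n + a = 0` the exponential does not decay, but the coefficient vanishes; the formula
    -- stays valid because `Real.sign 0 = 0`.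
    rcases eq_or_ne ((n : ℝ) + a) 0 with h | h
    · simp only [hF, h]
      simp
    · exact (integrableOn_qPow_mul_rpow τ h).const_mul _
  have hnorm : ∀ n : ℤ, ∫ y in Ioi (0 : ℝ), ‖F n y‖ ≤
      2 * Real.pi * Real.exp (-2 * Real.pi * (n + a) ^ 2 * τ.im) := fun n => by
    rcases eq_or_ne ((n : ℝ) + a) 0 with h | h
    · simp only [hF, h]
      simp
      positivity
    · have e : ∀ y ∈ Ioi (0 : ℝ), ‖F n y‖ =
          2 * Real.pi * |n + a| * Real.exp (-2 * Real.pi * (n + a) ^ 2 * τ.im) *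
            (Real.exp (-2 * Real.pi * (n + a) ^ 2 * y) * y ^ (-(1 / 2) : ℝ)) := fun y hy => by
        have hy : (0 : ℝ) < y := hy
        simp only [hF]
        rw [norm_mul, norm_mul, qPow_vertical, norm_mul, norm_qPow, Complex.norm_real,
          Complex.norm_real, Complex.norm_real, Real.norm_of_nonneg (Real.rpow_nonneg hy.le _),
          Real.norm_eq_abs, Real.norm_eq_abs, Real.abs_exp, abs_mul, abs_mul, abs_neg, abs_two,
          abs_of_pos Real.pi_pos]
        ring
      rw [MeasureTheory.setIntegral_congr_fun measurableSet_Ioi e,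
        MeasureTheory.integral_const_mul, integral_exp_mul_rpow_neg_half h]
      have h1 : 1 ≤ √2 := Real.one_le_sqrt.2 (by norm_num)
      have h2 : 2 * Real.pi * |n + a| * Real.exp (-2 * Real.pi * (n + a) ^ 2 * τ.im) *
          (1 / (√2 * |n + a|)) =
          2 * Real.pi * Real.exp (-2 * Real.pi * (n + a) ^ 2 * τ.im) / √2 := by
        have := abs_ne_zero.2 h
        field_simp
      rw [h2]
      exact div_le_self (by positivity) h1
  have hsum : Summable fun n : ℤ => ∫ y in Ioi (0 : ℝ), ‖F n y‖ :=
    Summable.of_nonneg_of_le (fun n => MeasureTheory.integral_nonneg fun y => norm_nonneg _) hnorm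
      ((summable_exp_sq a hτ).mul_left _)
  have key := MeasureTheory.integral_tsum_of_summable_integral_norm hint hsum
  have e1 : ∫ y in Ioi (0 : ℝ), unaryTheta a (τ + I * y) * ((y ^ (-(1 / 2) : ℝ) : ℝ) : ℂ) =
      ∫ y in Ioi (0 : ℝ), ∑' n, F n y := by
    refine MeasureTheory.setIntegral_congr_fun measurableSet_Ioi fun y hy => ?_
    simp only [unaryTheta_eq_tsum, hF, ← tsum_mul_right, mul_assoc]
  rw [e1, ← key, signedTheta, ← tsum_mul_left]
  refine tsum_congr fun n => ?_
  rcases eq_or_ne ((n : ℝ) + a) 0 with h | h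
  · simp only [hF, h]
    simp
  · simp only [hF]
    rw [MeasureTheory.integral_const_mul]
    have hI : ∫ y in Ioi (0 : ℝ), qPow (τ + I * y) ((n + a) ^ 2) *
        ((y ^ (-(1 / 2) : ℝ) : ℝ) : ℂ) =
        qPow τ ((n + a) ^ 2) * ((1 / (√2 * |n + a|) : ℝ) : ℂ) := by
      rw [← integral_exp_mul_rpow_neg_half h, ← integral_complex_ofReal,
        ← MeasureTheory.integral_const_mul]
      refine MeasureTheory.setIntegral_congr_fun measurableSet_Ioi fun y _ => ?_
      simp only [qPow_vertical]
      push_cast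
      ring
    rw [hI]
    have hpi := Real.pi_ne_zero
    have hs : (√2) ^ 2 = (2 : ℝ) := Real.sq_sqrt (by norm_num)
    have : Real.sign (n + a) = -(1 / (√2 * Real.pi)) * (-2 * Real.pi * (n + a) *
        (1 / (√2 * |n + a|))) := by
      have ha := abs_ne_zero.2 h
      rw [show -(1 / (√2 * Real.pi)) * (-2 * Real.pi * (n + a) * (1 / (√2 * |n + a|))) =
        2 * (n + a) / ((√2) ^ 2 * |n + a|) by field_simp, hs]
      rcases h.lt_or_gt with h' | h'
      · rw [Real.sign_of_neg h', abs_of_neg h']; field_simp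
      · rw [Real.sign_of_pos h', abs_of_pos h']; field_simp
    rw [this]
    push_cast
    ring

/-- Moving the base point to height `t` replaces `g(x + iy)` by `g(x + i(t + y))` and leaves the
factor `y ^ (-1/2)` alone. The cone bound at `x` dominates all these integrands, so the limit may be
taken under the integral. -/
theorem tendsto_signedTheta (a : ℝ) (x : ℚ) :
    Tendsto (fun t : ℝ => signedTheta a (x + I * t)) (𝓝[>] 0)
      (𝓝 (-(1 / (√2 * Real.pi) : ℝ) * eichlerIntegral (unaryTheta a) x)) := by
  have hev : ∀ᶠ t : ℝ in 𝓝[>] 0, -(1 / (√2 * Real.pi) : ℝ) *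
      (∫ y in Ioi (0 : ℝ), unaryTheta a (x + I * t + I * y) * ((y ^ (-(1 / 2) : ℝ) : ℝ) : ℂ)) =
      signedTheta a (x + I * t) := by
    filter_upwards [self_mem_nhdsWithin] with t ht
    have ht : (0 : ℝ) < t := ht
    rw [signedTheta_eq_integral a (by simpa using ht)]
  refine Tendsto.congr' hev (Tendsto.const_mul _ ?_)
  obtain ⟨C, δ, hC, hδ, hb⟩ := exists_norm_unaryTheta_le_of_cone a x
  have hpt : ∀ t y : ℝ, (x + I * t + I * y : ℂ) = x + I * ((t + y : ℝ) : ℂ) := fun t y => by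
    push_cast; ring
  have hcont : ContinuousOn (unaryTheta a) {τ | 0 < τ.im} :=
    (differentiableOn_unaryTheta a).continuousOn
  refine MeasureTheory.tendsto_integral_filter_of_dominated_convergence
    (fun y => C * (Real.exp (-δ * y) * y ^ (-(1 / 2) : ℝ))) ?_ ?_
    ((integrableOn_exp_mul_rpow_neg_half hδ).const_mul C) ?_
  · filter_upwards [self_mem_nhdsWithin] with t ht
    have ht : (0 : ℝ) < t := ht
    refine ContinuousOn.aestronglyMeasurable (ContinuousOn.mul ?_ ?_) measurableSet_Ioi
    · refine hcont.comp (by fun_prop) fun y hy => ?_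
      have hy : (0 : ℝ) < y := hy
      simp
      linarith
    · refine Complex.continuous_ofReal.comp_continuousOn ?_
      refine ContinuousOn.rpow_const continuousOn_id fun y hy => Or.inl (ne_of_gt hy)
  · filter_upwards [self_mem_nhdsWithin] with t ht
    have ht : (0 : ℝ) < t := ht
    refine (MeasureTheory.ae_restrict_iff' measurableSet_Ioi).2 (Eventually.of_forall fun y hy => ?_)
    have hy : (0 : ℝ) < y := hy
    rw [norm_mul, Complex.norm_real, Real.norm_of_nonneg (Real.rpow_nonneg hy.le _), ← mul_assoc,
      hpt]
    have h0 := Real.rpow_nonneg hy.le (-(1 / 2) : ℝ)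
    refine mul_le_mul_of_nonneg_right ?_ h0
    refine (hb _ (by simp; linarith) (by simp; linarith)).trans ?_
    refine mul_le_mul_of_nonneg_left (Real.exp_le_exp.2 ?_) hC.le
    simp
    nlinarith
  · refine (MeasureTheory.ae_restrict_iff' measurableSet_Ioi).2 (Eventually.of_forall fun y hy => ?_)
    have hy : (0 : ℝ) < y := hy
    refine Tendsto.mul_const _ ?_
    have hc : ContinuousAt (fun t : ℝ => unaryTheta a (x + I * t + I * y)) 0 := by
      refine ContinuousAt.comp (f := fun t : ℝ => (x + I * t + I * y : ℂ)) (g := unaryTheta a)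
        ((hcont _ ?_).continuousAt ?_) (by fun_prop)
      · simpa using hy
      · exact (isOpen_lt continuous_const Complex.continuous_im).mem_nhds (by simpa using hy)
    have := hc.tendsto.mono_left (nhdsWithin_le_nhds (s := Ioi 0))
    simpa using this

/-! ### Quantum modularity -/

theorem entries_of_mem_Gamma {γ : Matrix.SpecialLinearGroup (Fin 2) ℤ} {L : ℕ} (hL : 3 ≤ L)
    (hγ : γ ∈ CongruenceSubgroup.Gamma L) (hc : γ 1 0 = 0) : γ 0 0 = 1 ∧ γ 1 1 = 1 := by
  have hdet := det_entries γ
  rw [hc, mul_zero, sub_zero] at hdet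
  have h := moebiusDenom_arg_ne_pi hL hγ (τ := I) (by simp)
  rcases Int.isUnit_iff.1 (IsUnit.of_mul_eq_one_right _ hdet) with h1 | h1
  · exact ⟨by simpa [h1] using hdet, h1⟩
  · exfalso
    apply h
    rw [moebiusDenom, hc, h1]
    simp

/-- The case `c = 0`, where there is no point `-d/c`. Then `γ` is a translation, `g` is
quasi-periodic with factor `v`, and the obstruction vanishes. -/
theorem eichlerIntegral_translate {g : ℂ → ℂ} {γ : Matrix.SpecialLinearGroup (Fin 2) ℤ} {v : ℂ}
    (hv : v ≠ 0) (hmod : ∀ τ : ℂ, 0 < τ.im → g (moebius γ τ) =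
      v * (moebiusDenom γ τ * moebiusDenom γ τ ^ (1 / 2 : ℂ)) * g τ) (ha : γ 0 0 = 1)
    (hc : γ 1 0 = 0) (hd : γ 1 1 = 1) (x : ℚ) :
    eichlerIntegral g x - v⁻¹ * autFactorReal (-(1 / 2)) γ x * eichlerIntegral g (moebius γ x) =
      0 := by
  have h1 : autFactorReal (-(1 / 2)) γ x = 1 := by simp [autFactorReal, hc, hd]
  have hJ : ∀ τ : ℂ, moebiusDenom γ τ = 1 := fun τ => by simp [moebiusDenom, hc, hd]
  have hm : ∀ τ : ℂ, moebius γ τ = τ + γ 0 1 := fun τ => by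
    rw [moebius_eq_div, hJ, ha]; simp
  have hmx : moebius γ x = x + γ 0 1 := by simp [moebius, ha, hc, hd]
  have h2 : eichlerIntegral g (moebius γ x) = v * eichlerIntegral g x := by
    rw [hmx, eichlerIntegral, eichlerIntegral, ← MeasureTheory.integral_const_mul]
    refine MeasureTheory.setIntegral_congr_fun measurableSet_Ioi fun y hy => ?_
    have hy : (0 : ℝ) < y := hy
    have := hmod (x + I * y) (by simpa using hy)
    rw [hm, hJ, one_cpow, mul_one, mul_one] at this
    rw [← mul_assoc, ← this]
    push_cast
    ring_nf
  rw [h1, h2]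
  field_simp
  ring

/-- Near `x` the sign of `cx + d` is constant, so only one branch of the definition is relevant, and
it is a constant times a real power of a positive analytic function. -/
theorem analyticAt_autFactorReal (k : ℝ) (γ : Matrix.SpecialLinearGroup (Fin 2) ℤ) {x : ℝ}
    (hx : (γ 1 0 : ℝ) * x + γ 1 1 ≠ 0) : AnalyticAt ℝ (autFactorReal k γ) x := by
  have hlin : AnalyticAt ℝ (fun x : ℝ => (γ 1 0 : ℝ) * x + γ 1 1) x := by fun_prop
  have hrpow : ∀ f : ℝ → ℝ, AnalyticAt ℝ f x → 0 < f x →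
      AnalyticAt ℝ (fun y => ((f y ^ k : ℝ) : ℂ)) x := fun f hf h0 => by
    refine (Complex.ofRealCLM.analyticAt _).comp (f := fun y => f y ^ k) ?_
    refine ((((hf.log h0).mul analyticAt_const).rexp : AnalyticAt ℝ
      (fun y => Real.exp (Real.log (f y) * k)) x)).congr ?_
    filter_upwards [hf.continuousAt.eventually_mem (isOpen_Ioi.mem_nhds h0)] with y hy
    rw [Real.rpow_def_of_pos hy]
    rfl
  rcases hx.lt_or_gt with h | h
  · refine ((hrpow (fun x => -((γ 1 0 : ℝ) * x + γ 1 1)) hlin.neg (neg_pos.2 h)).mul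
      (analyticAt_const (v := if 0 < γ 1 0 then cexp (-(Real.pi * k * I))
        else cexp (Real.pi * k * I)))).congr ?_
    filter_upwards [hlin.continuousAt.eventually_mem (isOpen_Iio.mem_nhds h)] with y hy
    have hy : (γ 1 0 : ℝ) * y + γ 1 1 < 0 := hy
    rw [autFactorReal, if_neg (not_le.2 hy)]
    rfl
  · refine (hrpow _ hlin h).congr ?_
    filter_upwards [hlin.continuousAt.eventually_mem (isOpen_Ioi.mem_nhds h)] with y hy
    have hy : 0 < (γ 1 0 : ℝ) * y + γ 1 1 := hy
    rw [autFactorReal, if_pos hy.le]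

theorem analyticAt_qPow_moebius (r : ℝ) (γ : Matrix.SpecialLinearGroup (Fin 2) ℤ) {x : ℝ}
    (hx : (γ 1 0 : ℝ) * x + γ 1 1 ≠ 0) :
    AnalyticAt ℝ (fun x : ℝ => qPow ((moebius γ x : ℝ) : ℂ) r) x := by
  have h1 : AnalyticAt ℝ (fun x : ℝ => moebius γ x) x := by
    unfold moebius
    exact AnalyticAt.div (by fun_prop) (by fun_prop) hx
  have h2 : AnalyticAt ℝ (fun z : ℝ => qPow (z : ℂ) r) (moebius γ x) := by
    have h3 : AnalyticAt ℝ (fun z : ℂ => qPow z r) ((moebius γ x : ℝ) : ℂ) := by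
      refine AnalyticAt.restrictScalars (𝕜' := ℂ) ?_
      unfold qPow
      exact (analyticAt_const.mul analyticAt_id).cexp
    exact h3.comp (Complex.ofRealCLM.analyticAt _)
  exact h2.comp h1

/-- The signed theta series share one multiplier on `Γ(16 N²)`, so their period functions may be
added. The monomial `q^r` needs no modular behaviour: its own obstruction is analytic wherever `cx +
d ≠ 0`. -/
theorem isQuantumModularForm_signedTheta {N : ℕ} (hN : N ≠ 0) (j₁ j₂ : ℤ) (k₁ k₂ k₃ : ℂ) (r : ℝ)
    {Φ : ℂ → ℂ} (hΦ : ∀ τ : ℂ, 0 < τ.im → Φ τ = k₁ * signedTheta (j₁ / (2 * N)) τ +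
      k₂ * signedTheta (j₂ / (2 * N)) τ + k₃ * qPow τ r) :
    IsQuantumModularForm (1 / 2) Set.univ Φ := by
  set E : ℤ → ℚ → ℂ := fun j x =>
    -(1 / (√2 * Real.pi) : ℝ) * eichlerIntegral (unaryTheta (j / (2 * N))) x with hE
  set L := 16 * N ^ 2 with hL
  have hL0 : 0 < N ^ 2 := by positivity
  have hL3 : 3 ≤ L := by omega
  have hL2 : 2 ∣ L := ⟨8 * N ^ 2, by rw [hL]; ring⟩
  have hper : ∀ γ ∈ CongruenceSubgroup.Gamma L, ∀ j : ℤ, ∃ h : ℝ → ℂ,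
      AnalyticOnNhd ℝ h {x : ℝ | (γ 1 0 : ℝ) * x + (γ 1 1 : ℝ) ≠ 0} ∧
      ∀ x : ℚ, (γ 1 0 : ℚ) * x + (γ 1 1 : ℚ) ≠ 0 →
        E j x - (thetaMultiplier (doubleConj γ))⁻¹ * autFactorReal (-(1 / 2)) γ x *
          E j (moebius γ x) = h x := by
    intro γ hγ j
    have hv : thetaMultiplier (doubleConj γ) ≠ 0 := fun h => by
      have := norm_thetaMultiplier (doubleConj γ)
      simp [h] at this
    have hmod := fun τ hτ => unaryTheta_moebius hN j hγ (τ := τ) hτ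
    by_cases hc : γ 1 0 = 0
    · obtain ⟨ha, hd⟩ := entries_of_mem_Gamma hL3 hγ hc
      refine ⟨fun _ => 0, analyticOnNhd_const, fun x _ => ?_⟩
      have := eichlerIntegral_translate hv hmod ha hc hd x
      simp only [hE]
      linear_combination (-(1 / (√2 * Real.pi) : ℝ) : ℂ) * this
    · refine ⟨fun x => -(1 / (√2 * Real.pi) : ℝ) * ∫ y in Ioi (0 : ℝ),
        unaryTheta (j / (2 * N)) ((-(γ 1 1 : ℚ) / (γ 1 0 : ℚ) : ℚ) + I * y) *
        eichlerKernel (x : ℝ) ((-(γ 1 1 : ℚ) / (γ 1 0 : ℚ) : ℚ) + I * y), ?_, fun x hx => ?_⟩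
      · refine analyticOnNhd_const.mul ((analyticOnNhd_periodIntegral
          (isCuspidal_unaryTheta (j / (2 * N))) (-(γ 1 1 : ℚ) / (γ 1 0 : ℚ))).mono fun x hx => ?_)
        intro h
        apply hx
        have hc' : (γ 1 0 : ℝ) ≠ 0 := Int.cast_ne_zero.2 hc
        rw [h]; push_cast
        field_simp
        ring
      · have := eichlerIntegral_sub_eq (isCuspidal_unaryTheta (j / (2 * N))) hv hmod hc hx
        simp only [hE]
        linear_combination (-(1 / (√2 * Real.pi) : ℝ) : ℂ) * this
  refine ⟨fun x => k₁ * E j₁ x + k₂ * E j₂ x + k₃ * qPow ((x : ℝ) : ℂ) r, fun x _ => ?_,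
    CongruenceSubgroup.Gamma L, ⟨L, by omega, le_rfl⟩,
    fun γ => thetaMultiplier (doubleConj γ), isMultiplierSystem_doubleConj hL3 hL2,
    fun γ hγ => ?_⟩
  · have h3 : Tendsto (fun t : ℝ => qPow ((x : ℂ) + I * t) r) (𝓝[>] 0)
        (𝓝 (qPow ((x : ℝ) : ℂ) r)) := by
      have : Continuous fun t : ℝ => qPow ((x : ℂ) + I * t) r := by unfold qPow; fun_prop
      have := (this.tendsto 0).mono_left (nhdsWithin_le_nhds (s := Ioi 0))
      simpa using this
    have := (((tendsto_signedTheta (j₁ / (2 * N)) x).const_mul k₁).add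
      ((tendsto_signedTheta (j₂ / (2 * N)) x).const_mul k₂)).add (h3.const_mul k₃)
    refine this.congr' ?_
    filter_upwards [self_mem_nhdsWithin] with t ht
    have ht : (0 : ℝ) < t := ht
    rw [hΦ _ (by simpa using ht)]
  · obtain ⟨h₁, ha₁, he₁⟩ := hper γ hγ j₁
    obtain ⟨h₂, ha₂, he₂⟩ := hper γ hγ j₂
    refine ⟨fun x => k₁ * h₁ x + k₂ * h₂ x + k₃ * (qPow (x : ℂ) r -
      (thetaMultiplier (doubleConj γ))⁻¹ * autFactorReal (-(1 / 2)) γ x *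
        qPow ((moebius γ x : ℝ) : ℂ) r), ?_, fun x _ hx => ⟨mem_univ _, ?_⟩⟩
    · refine ((analyticOnNhd_const.mul ha₁).add (analyticOnNhd_const.mul ha₂)).add
        (analyticOnNhd_const.mul fun x hx => ?_)
      refine AnalyticAt.sub ?_ ((analyticAt_const.mul (analyticAt_autFactorReal _ γ hx)).mul
        (analyticAt_qPow_moebius r γ hx))
      have := analyticAt_qPow_moebius r 1 (x := x) (by simp)
      simpa [moebius] using this
    · have hm : ((moebius γ x : ℚ) : ℝ) = moebius γ (x : ℝ) := by simp [moebius]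
      beta_reduce
      rw [hm]
      linear_combination k₁ * he₁ x hx + k₂ * he₂ x hx

/-! ### The truncated integrals of a plumbing graph -/

/-- Every edge contributes one inverse factor at each of its two ends. Exchanging the products over
edges and vertices collects as many at a vertex as its degree. -/
theorem prod_edgeFinset_edgeFactor {n : ℕ} (G : SimpleGraph (Fin n)) [DecidableRel G.Adj]
    (w : Fin n → ℂ) :
    ∏ e ∈ G.edgeFinset,
      Sym2.lift ⟨fun k l => edgeFactor (w k) (w l), fun _ _ => edgeFactor_comm _ _⟩ e =
      ∏ j, ((w j - (w j)⁻¹)⁻¹) ^ G.degree j := by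
  have h1 : ∀ e ∈ G.edgeFinset,
      Sym2.lift ⟨fun k l => edgeFactor (w k) (w l), fun _ _ => edgeFactor_comm _ _⟩ e =
      ∏ j ∈ Finset.univ.filter (· ∈ e), (w j - (w j)⁻¹)⁻¹ := fun e he => by
    induction e using Sym2.ind with
    | _ k l =>
      have hkl : k ≠ l := by
        rintro rfl
        simp at he
      have : Finset.univ.filter (· ∈ s(k, l)) = {k, l} := by
        ext j; simp
      rw [this, Finset.prod_pair hkl, Sym2.lift_mk, ← mul_inv, ← one_div]
      rfl
  rw [Finset.prod_congr rfl h1, Finset.prod_comm' (t' := Finset.univ)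
    (s' := fun j => G.incidenceFinset j)]
  · refine Finset.prod_congr rfl fun j _ => ?_
    rw [Finset.prod_const, SimpleGraph.card_incidenceFinset_eq_degree]
  · intro e j
    simp [SimpleGraph.mem_incidenceFinset, SimpleGraph.incidenceSet]

/-- The angles that belong to the truncated unit circle. -/
def truncArc (ε : ℝ) : Set ℝ := {θ | ε ≤ ‖cexp (θ * I) - 1‖ ∧ ε ≤ ‖cexp (θ * I) + 1‖}

/-- The contribution `(w - w⁻¹) ^ (2 - d)` of a vertex of degree `d`, for `w = exp (iθ)`. -/
def vertexPower (d : ℕ) (θ : ℝ) : ℂ :=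
  vertexFactor (cexp (θ * I)) * ((cexp (θ * I) - (cexp (θ * I))⁻¹)⁻¹) ^ d

/-- The Fourier coefficients of the truncated contribution of a vertex. -/
def truncCoeff (ε : ℝ) (d : ℕ) (m : ℤ) : ℂ :=
  1 / (2 * Real.pi) * ∫ θ in Icc 0 (2 * Real.pi),
    (truncArc ε).indicator (vertexPower d) θ * cexp (θ * I) ^ m

theorem measurableSet_truncArc (ε : ℝ) : MeasurableSet (truncArc ε) :=
  (measurableSet_le (f := fun _ => ε) (g := fun θ : ℝ => ‖cexp (θ * I) - 1‖) (by fun_prop)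
    (by fun_prop)).inter
    (measurableSet_le (f := fun _ => ε) (g := fun θ : ℝ => ‖cexp (θ * I) + 1‖) (by fun_prop)
      (by fun_prop))

theorem norm_exp_sub_inv (θ : ℝ) :
    ‖cexp (θ * I) - (cexp (θ * I))⁻¹‖ = ‖cexp (θ * I) - 1‖ * ‖cexp (θ * I) + 1‖ := by
  have h : cexp (θ * I) ≠ 0 := Complex.exp_ne_zero _
  have h2 : cexp (θ * I) - (cexp (θ * I))⁻¹ =
      (cexp (θ * I) - 1) * (cexp (θ * I) + 1) * (cexp (θ * I))⁻¹ := by field_simp; ring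
  rw [h2, norm_mul, norm_mul, norm_inv, Complex.norm_exp_ofReal_mul_I, inv_one, mul_one]

theorem le_norm_exp_sub_inv {ε θ : ℝ} (hε : 0 < ε) (h : θ ∈ truncArc ε) :
    ε ^ 2 ≤ ‖cexp (θ * I) - (cexp (θ * I))⁻¹‖ := by
  rw [norm_exp_sub_inv, sq]
  exact mul_le_mul h.1 h.2 hε.le (norm_nonneg _)

theorem norm_exp_sub_inv_le (θ : ℝ) : ‖cexp (θ * I) - (cexp (θ * I))⁻¹‖ ≤ 2 := by
  refine (norm_sub_le _ _).trans ?_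
  rw [norm_inv, Complex.norm_exp_ofReal_mul_I]
  norm_num

theorem norm_indicator_vertexPower_le {ε : ℝ} (hε : 0 < ε) (d : ℕ) (θ : ℝ) :
    ‖(truncArc ε).indicator (vertexPower d) θ‖ ≤ 4 * ((ε ^ 2)⁻¹) ^ d := by
  by_cases h : θ ∈ truncArc ε
  · rw [indicator_of_mem h, vertexPower, vertexFactor, norm_mul, norm_pow, norm_pow, norm_inv]
    have h1 := le_norm_exp_sub_inv hε h
    have h2 := norm_exp_sub_inv_le θ
    have h0 : 0 < ε ^ 2 := by positivity
    gcongr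
    nlinarith [norm_nonneg (cexp (θ * I) - (cexp (θ * I))⁻¹)]
  · rw [indicator_of_notMem h, norm_zero]
    positivity

theorem measurable_vertexPower (d : ℕ) : Measurable (vertexPower d) := by
  unfold vertexPower vertexFactor
  fun_prop

theorem integrableOn_indicator_vertexPower {ε : ℝ} (hε : 0 < ε) (d : ℕ) :
    MeasureTheory.IntegrableOn ((truncArc ε).indicator (vertexPower d))
      (Icc 0 (2 * Real.pi)) :=
  MeasureTheory.Measure.integrableOn_of_bounded measure_Icc_lt_top.ne
    ((measurable_vertexPower d).indicator (measurableSet_truncArc ε)).aestronglyMeasurable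
    (Eventually.of_forall fun θ => norm_indicator_vertexPower_le hε d θ)

theorem continuous_exp_mul_I_zpow (m : ℤ) : Continuous fun θ : ℝ => cexp (θ * I) ^ m :=
  Continuous.zpow₀ (by fun_prop) m fun _ => Or.inl (Complex.exp_ne_zero _)

theorem norm_exp_mul_I_zpow (θ : ℝ) (m : ℤ) : ‖cexp (θ * I) ^ m‖ = 1 := by
  rw [norm_zpow, Complex.norm_exp_ofReal_mul_I, one_zpow]

theorem volume_restrict_Icc_pi (n : ℕ) :
    (MeasureTheory.volume : MeasureTheory.Measure (Fin n → ℝ)).restrict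
      (Icc 0 fun _ => 2 * Real.pi) =
    MeasureTheory.Measure.pi fun _ => MeasureTheory.volume.restrict (Icc 0 (2 * Real.pi)) := by
  rw [MeasureTheory.volume_pi, ← Set.pi_univ_Icc, ← MeasureTheory.Measure.restrict_pi_pi]
  rfl

/-! ### Indexing the lattice by integer vectors. -/

theorem det_map_intCast {n : ℕ} {M : Matrix (Fin n) (Fin n) ℤ} (hdet : M.det ≠ 0) :
    (M.map (Int.cast : ℤ → ℝ)).det ≠ 0 := by
  have := (Int.castRingHom ℝ).map_det M
  rw [show M.map (Int.cast : ℤ → ℝ) = (Int.castRingHom ℝ).mapMatrix M from rfl, ← this]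
  simpa using hdet

theorem thetaExponent_mulVec {n : ℕ} {M : Matrix (Fin n) (Fin n) ℤ} (hdet : M.det ≠ 0)
    (x : Fin n → ℤ) : thetaExponent M (M.mulVec x) = 1 / 2 * ((x ⬝ᵥ M.mulVec x : ℤ) : ℝ) := by
  have h : (fun j => ((M.mulVec x j : ℤ) : ℝ)) =
      (M.map (Int.cast : ℤ → ℝ)).mulVec fun j => (x j : ℝ) := by
    ext j
    simp [Matrix.mulVec, dotProduct]
  rw [thetaExponent, h, Matrix.mulVec_mulVec, Matrix.nonsing_inv_mul _
    (isUnit_iff_ne_zero.2 (det_map_intCast hdet)), Matrix.one_mulVec, ← h, dotProduct_comm]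
  simp [dotProduct]

/-- The points of the lattice `M ℤⁿ` are indexed by `ℤⁿ`. -/
def plumbingLatticeEquiv {n : ℕ} {M : Matrix (Fin n) (Fin n) ℤ} (hdet : M.det ≠ 0) :
    (Fin n → ℤ) ≃ plumbingLattice M :=
  Equiv.ofInjective _ (Matrix.mulVec_injective_of_det_ne_zero hdet)

theorem coe_plumbingLatticeEquiv {n : ℕ} {M : Matrix (Fin n) (Fin n) ℤ} (hdet : M.det ≠ 0)
    (x : Fin n → ℤ) : (plumbingLatticeEquiv hdet x : Fin n → ℤ) = M.mulVec x := rfl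

theorem plumbingTheta_eq_tsum {n : ℕ} {M : Matrix (Fin n) (Fin n) ℤ} (hdet : M.det ≠ 0) (τ : ℂ)
    (w : Fin n → ℂ) : plumbingTheta M τ w =
      ∑' x : Fin n → ℤ, thetaTerm M τ w (M.mulVec x) :=
  ((plumbingLatticeEquiv hdet).tsum_eq fun m : plumbingLattice M => thetaTerm M τ w m).symm

theorem norm_thetaTerm {n : ℕ} (M : Matrix (Fin n) (Fin n) ℤ) (τ : ℂ) {w : Fin n → ℂ}
    (hw : ∀ j, ‖w j‖ = 1) (m : Fin n → ℤ) :
    ‖thetaTerm M τ w m‖ = ‖qPow τ (thetaExponent M m)‖ := by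
  simp [thetaTerm, hw]

section Plumbing

variable {n : ℕ} {G : SimpleGraph (Fin n)} [DecidableRel G.Adj] {a : Fin n → ℤ} {τ : ℂ}

/-- The excised region is defined coordinate by coordinate, so its indicator is a product. Apart
from the theta function the integrand splits over the vertices; on the cut-out set one factor is
zero. -/
theorem indicator_plumbingIntegrand (ε : ℝ) (θ : Fin n → ℝ) :
    (pvRegion n ε).indicator (plumbingIntegrand G a τ) (torusMap 0 (fun _ => 1) θ) =
      (∏ j, cexp (θ j * I))⁻¹ * ((∏ j, (truncArc ε).indicator (vertexPower (G.degree j)) (θ j)) *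
        plumbingTheta (plumbingMatrix G a) τ fun j => cexp (θ j * I)) := by
  have hw : torusMap 0 (fun _ => 1) θ = fun j => cexp (θ j * I) := by
    ext j; simp [torusMap]
  rw [hw]
  by_cases h : ∀ j, θ j ∈ truncArc ε
  · rw [indicator_of_mem (show (fun j => cexp (θ j * I)) ∈ pvRegion n ε from h),
      plumbingIntegrand, prod_edgeFinset_edgeFactor,
      Finset.prod_congr rfl fun j _ => indicator_of_mem (h j) (vertexPower (G.degree j))]
    simp only [vertexPower, Finset.prod_mul_distrib, Finset.prod_inv_distrib]
    ring
  · rw [indicator_of_notMem (show (fun j => cexp (θ j * I)) ∉ pvRegion n ε from h)]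
    push Not at h
    obtain ⟨j, hj⟩ := h
    rw [Finset.prod_eq_zero (f := fun j => (truncArc ε).indicator (vertexPower (G.degree j)) (θ j))
      (Finset.mem_univ j) (indicator_of_notMem hj _)]
    simp

theorem summable_thetaTerm (hdet : (plumbingMatrix G a).det ≠ 0)
    (hsum : Summable fun x : Fin n → ℤ =>
      ‖qPow τ (thetaExponent (plumbingMatrix G a) ((plumbingMatrix G a).mulVec x))‖)
    {w : Fin n → ℂ} (hw : ∀ j, ‖w j‖ = 1) :
    Summable fun m : plumbingLattice (plumbingMatrix G a) =>
      thetaTerm (plumbingMatrix G a) τ w m := by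
  rw [← (plumbingLatticeEquiv hdet).summable_iff]
  refine Summable.of_norm (hsum.congr fun x => ?_)
  simp only [Function.comp, coe_plumbingLatticeEquiv]
  rw [norm_thetaTerm _ _ hw]

theorem continuous_plumbingTheta (hdet : (plumbingMatrix G a).det ≠ 0)
    (hsum : Summable fun x : Fin n → ℤ =>
      ‖qPow τ (thetaExponent (plumbingMatrix G a) ((plumbingMatrix G a).mulVec x))‖) :
    Continuous fun θ : Fin n → ℝ =>
      plumbingTheta (plumbingMatrix G a) τ fun j => cexp (θ j * I) := by
  simp only [plumbingTheta_eq_tsum hdet]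
  refine continuous_tsum (fun x => ?_) hsum fun x θ => (norm_thetaTerm _ _ (fun j =>
    Complex.norm_exp_ofReal_mul_I _) _).le
  unfold thetaTerm
  refine continuous_const.mul (continuous_finsetProd _ fun j _ => ?_)
  exact (continuous_exp_mul_I_zpow _).comp (continuous_apply j)

theorem integrableOn_prod_vertexPower (ε : ℝ) (hε : 0 < ε) (d : Fin n → ℕ) :
    MeasureTheory.IntegrableOn
      (fun θ : Fin n → ℝ => ∏ j, (truncArc ε).indicator (vertexPower (d j)) (θ j))
      (Icc 0 fun _ => 2 * Real.pi) := by
  rw [MeasureTheory.IntegrableOn, volume_restrict_Icc_pi]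
  exact MeasureTheory.Integrable.fintype_prod
    (f := fun j => (truncArc ε).indicator (vertexPower (d j)))
    fun j => integrableOn_indicator_vertexPower hε _

theorem torusIntegrable_plumbingIntegrand (hdet : (plumbingMatrix G a).det ≠ 0)
    (hsum : Summable fun x : Fin n → ℤ =>
      ‖qPow τ (thetaExponent (plumbingMatrix G a) ((plumbingMatrix G a).mulVec x))‖)
    {ε : ℝ} (hε : 0 < ε) :
    TorusIntegrable ((pvRegion n ε).indicator (plumbingIntegrand G a τ)) 0 (fun _ => 1) := by
  have hc : Continuous fun θ : Fin n → ℝ => (∏ j, cexp (θ j * I))⁻¹ *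
      plumbingTheta (plumbingMatrix G a) τ fun j => cexp (θ j * I) :=
    (Continuous.inv₀ (by fun_prop) fun θ => Finset.prod_ne_zero_iff.2 fun j _ =>
      Complex.exp_ne_zero _).mul (continuous_plumbingTheta hdet hsum)
  rw [TorusIntegrable]
  refine ((integrableOn_prod_vertexPower ε hε fun j => G.degree j).bdd_mul
    (c := ∑' x : Fin n → ℤ,
      ‖qPow τ (thetaExponent (plumbingMatrix G a) ((plumbingMatrix G a).mulVec x))‖)
    hc.aestronglyMeasurable
    (Eventually.of_forall fun θ => ?_)).congr (Eventually.of_forall fun θ => ?_)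
  · rw [norm_mul, norm_inv, norm_prod, plumbingTheta_eq_tsum hdet]
    simp only [Complex.norm_exp_ofReal_mul_I, Finset.prod_const_one, inv_one, one_mul]
    exact tsum_of_norm_bounded hsum.hasSum fun x => (norm_thetaTerm _ _ (fun j =>
      Complex.norm_exp_ofReal_mul_I _) _).le
  · simp only [indicator_plumbingIntegrand]
    ring

/-- The truncated integral is a sum over the lattice of products of one-dimensional integrals. -/
theorem plumbingZTrunc_eq_tsum (hdet : (plumbingMatrix G a).det ≠ 0)
    (hsum : Summable fun x : Fin n → ℤ =>
      ‖qPow τ (thetaExponent (plumbingMatrix G a) ((plumbingMatrix G a).mulVec x))‖)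
    {ε : ℝ} (hε : 0 < ε) :
    plumbingZTrunc G a τ ε =
      qPow τ ((-3 * (n : ℝ) + ((plumbingMatrix G a).trace : ℝ)) / 2) *
        ∑' x : Fin n → ℤ,
          qPow τ (thetaExponent (plumbingMatrix G a) ((plumbingMatrix G a).mulVec x)) *
            ∏ j, truncCoeff ε (G.degree j) ((plumbingMatrix G a).mulVec x j) := by
  set M := plumbingMatrix G a with hM
  set g : Fin n → ℝ → ℂ := fun j => (truncArc ε).indicator (vertexPower (G.degree j)) with hg
  set F : (Fin n → ℤ) → (Fin n → ℝ) → ℂ := fun x θ =>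
    qPow τ (thetaExponent M (M.mulVec x)) *
      ∏ j, (g j (θ j) * cexp (θ j * I) ^ (M.mulVec x j)) with hF
  have hFi : ∀ x, MeasureTheory.IntegrableOn (F x) (Icc 0 fun _ => 2 * Real.pi) := fun x => by
    refine MeasureTheory.Integrable.const_mul ?_ _
    rw [volume_restrict_Icc_pi]
    refine MeasureTheory.Integrable.fintype_prod
      (f := fun j θ => g j θ * cexp (θ * I) ^ (M.mulVec x j)) fun j => ?_
    exact (integrableOn_indicator_vertexPower hε _).mul_bdd (c := 1)
      (continuous_exp_mul_I_zpow _).aestronglyMeasurable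
      (Eventually.of_forall fun θ => (norm_exp_mul_I_zpow _ _).le)
  have hFn : ∀ x, ∫ θ in Icc 0 fun _ => 2 * Real.pi, ‖F x θ‖ =
      ‖qPow τ (thetaExponent M (M.mulVec x))‖ *
        ∫ θ : Fin n → ℝ in Icc 0 fun _ => 2 * Real.pi, ‖∏ j, g j (θ j)‖ := fun x => by
    rw [← MeasureTheory.integral_const_mul]
    refine MeasureTheory.integral_congr_ae (Eventually.of_forall fun θ => ?_)
    simp only [hF, norm_mul, norm_prod, norm_exp_mul_I_zpow, mul_one]
  have key := MeasureTheory.integral_tsum_of_summable_integral_norm hFi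
    (by simpa only [hFn] using hsum.mul_right _)
  have h1 : torusIntegral ((pvRegion n ε).indicator (plumbingIntegrand G a τ)) 0 (fun _ => 1) =
      I ^ n * ∫ θ in Icc 0 fun _ => 2 * Real.pi, ∑' x, F x θ := by
    rw [torusIntegral, ← MeasureTheory.integral_const_mul]
    refine MeasureTheory.integral_congr_ae (Eventually.of_forall fun θ => ?_)
    simp only [indicator_plumbingIntegrand, smul_eq_mul]
    have h0 : ∏ j, cexp (θ j * I) ≠ 0 := Finset.prod_ne_zero_iff.2 fun j _ =>
      Complex.exp_ne_zero _
    have h2 : ∑' x, F x θ = (∏ j, g j (θ j)) * plumbingTheta M τ fun j => cexp (θ j * I) := by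
      rw [plumbingTheta_eq_tsum hdet, ← tsum_mul_left]
      refine tsum_congr fun x => ?_
      simp only [hF, thetaTerm, Finset.prod_mul_distrib]
      ring
    rw [h2]
    simp only [Finset.prod_mul_distrib, Finset.prod_const, Finset.card_univ, Fintype.card_fin]
    simp only [Complex.ofReal_one, one_pow, one_mul]
    linear_combination (I ^ n * ((∏ j, g j (θ j)) * plumbingTheta M τ fun j =>
      cexp (θ j * I))) * mul_inv_cancel₀ h0
  rw [plumbingZTrunc, h1, ← key, div_mul_eq_mul_div, mul_div_assoc]
  congr 1
  rw [← tsum_mul_left, ← tsum_div_const]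
  refine tsum_congr fun x => ?_
  simp only [hF]
  rw [MeasureTheory.integral_const_mul, volume_restrict_Icc_pi,
    MeasureTheory.integral_fintype_prod_eq_prod
      fun j θ => g j θ * cexp (θ * I) ^ (M.mulVec x j)]
  simp only [truncCoeff, Finset.prod_mul_distrib, Finset.prod_const, Finset.card_univ,
    Fintype.card_fin]
  have hpi : (Real.pi : ℂ) ≠ 0 := by exact_mod_cast Real.pi_ne_zero
  have hI := Complex.I_ne_zero
  have e : I ^ n / (2 * Real.pi * I) ^ n = (1 / (2 * Real.pi : ℂ)) ^ n := by
    rw [← div_pow]; congr 1; field_simp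
  rw [← e]
  ring

end Plumbing

/-! ### The one-dimensional principal values -/

/-- The Fourier coefficients of the truncated unit circle. -/
def arcCoeff (ε : ℝ) (m : ℤ) : ℂ :=
  1 / (2 * Real.pi) * ∫ θ in Icc 0 (2 * Real.pi),
    (truncArc ε).indicator (fun _ => (1 : ℂ)) θ * cexp (θ * I) ^ m

theorem integrableOn_indicator_mul_zpow {ε : ℝ} {f : ℝ → ℂ}
    (hf : MeasureTheory.IntegrableOn ((truncArc ε).indicator f) (Icc 0 (2 * Real.pi))) (m : ℤ) :
    MeasureTheory.IntegrableOn (fun θ => (truncArc ε).indicator f θ * cexp (θ * I) ^ m)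
      (Icc 0 (2 * Real.pi)) :=
  MeasureTheory.Integrable.mul_bdd (c := 1) hf
    (continuous_exp_mul_I_zpow _).aestronglyMeasurable
    (Eventually.of_forall fun _ => (norm_exp_mul_I_zpow _ _).le)

theorem norm_indicator_one_le (ε θ : ℝ) :
    ‖(truncArc ε).indicator (fun _ => (1 : ℂ)) θ‖ ≤ 1 :=
  (norm_indicator_le_norm_self _ _).trans (by simp)

theorem integrableOn_indicator_one (ε : ℝ) :
    MeasureTheory.IntegrableOn ((truncArc ε).indicator fun _ => (1 : ℂ)) (Icc 0 (2 * Real.pi)) :=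
  MeasureTheory.Measure.integrableOn_of_bounded measure_Icc_lt_top.ne
    (measurable_const.indicator (measurableSet_truncArc ε)).aestronglyMeasurable
    (Eventually.of_forall fun θ => norm_indicator_one_le ε θ)

theorem norm_arcCoeff_le (ε : ℝ) (m : ℤ) : ‖arcCoeff ε m‖ ≤ 1 := by
  have h := MeasureTheory.norm_setIntegral_le_of_norm_le_const (μ := MeasureTheory.volume)
    (s := Icc 0 (2 * Real.pi)) (C := 1)
    (f := fun θ => (truncArc ε).indicator (fun _ => (1 : ℂ)) θ * cexp (θ * I) ^ m)
    measure_Icc_lt_top fun θ _ => by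
      rw [norm_mul, norm_exp_mul_I_zpow, mul_one]
      exact norm_indicator_one_le ε θ
  have h2 : (MeasureTheory.volume : MeasureTheory.Measure ℝ).real (Icc 0 (2 * Real.pi)) =
      2 * Real.pi := by
    rw [MeasureTheory.measureReal_def, Real.volume_Icc, sub_zero,
      ENNReal.toReal_ofReal Real.two_pi_pos.le]
  rw [h2, one_mul] at h
  rw [arcCoeff, norm_mul]
  have h3 : ‖(1 / (2 * Real.pi) : ℂ)‖ = 1 / (2 * Real.pi) := by
    rw [norm_div, norm_mul, Complex.norm_real, Real.norm_of_nonneg Real.pi_pos.le]; simp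
  rw [h3, div_mul_eq_mul_div, one_mul]
  exact div_le_one_of_le₀ h Real.two_pi_pos.le

theorem exp_sub_inv_ne_zero {ε θ : ℝ} (hε : 0 < ε) (h : θ ∈ truncArc ε) :
    cexp (θ * I) - (cexp (θ * I))⁻¹ ≠ 0 := by
  have := le_norm_exp_sub_inv hε h
  intro h0
  rw [h0, norm_zero] at this
  exact absurd this (not_le.2 (by positivity))

theorem truncCoeff_two {ε : ℝ} (hε : 0 < ε) (m : ℤ) : truncCoeff ε 2 m = arcCoeff ε m := by
  rw [truncCoeff, arcCoeff]
  congr 2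
  ext θ
  by_cases h : θ ∈ truncArc ε
  · rw [indicator_of_mem h, indicator_of_mem h, vertexPower, vertexFactor, ← mul_pow,
      mul_inv_cancel₀ (exp_sub_inv_ne_zero hε h), one_pow]
  · rw [indicator_of_notMem h, indicator_of_notMem h]

theorem truncCoeff_one {ε : ℝ} (hε : 0 < ε) (m : ℤ) :
    truncCoeff ε 1 m = arcCoeff ε (m + 1) - arcCoeff ε (m - 1) := by
  rw [truncCoeff, arcCoeff, arcCoeff, ← mul_sub, ← MeasureTheory.integral_sub
    (integrableOn_indicator_mul_zpow (integrableOn_indicator_one ε) _)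
    (integrableOn_indicator_mul_zpow (integrableOn_indicator_one ε) _)]
  congr 2
  ext θ
  by_cases h : θ ∈ truncArc ε
  · rw [indicator_of_mem h, indicator_of_mem h, vertexPower, vertexFactor,
      zpow_add_one₀ (Complex.exp_ne_zero _), zpow_sub_one₀ (Complex.exp_ne_zero _), pow_one, sq,
      mul_assoc (cexp (θ * I) - (cexp (θ * I))⁻¹), mul_inv_cancel₀ (exp_sub_inv_ne_zero hε h)]
    ring
  · simp [indicator_of_notMem h]

/-- On the truncated arc, `(w^(m+2) - w^m) / (w - w⁻¹) = w^(m+1)`. A difference of two coefficients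
of the singular factor is thus a coefficient of the bounded indicator, and no singular integral has
to be estimated. -/
theorem truncCoeff_three_add_two {ε : ℝ} (hε : 0 < ε) (m : ℤ) :
    truncCoeff ε 3 (m + 2) = truncCoeff ε 3 m + arcCoeff ε (m + 1) := by
  rw [← sub_eq_iff_eq_add', truncCoeff, arcCoeff, truncCoeff, ← mul_sub,
    ← MeasureTheory.integral_sub
    (integrableOn_indicator_mul_zpow (integrableOn_indicator_vertexPower hε _) _)
    (integrableOn_indicator_mul_zpow (integrableOn_indicator_vertexPower hε _) _)]
  congr 2
  ext θ
  by_cases h : θ ∈ truncArc ε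
  · have h0 := exp_sub_inv_ne_zero hε h
    have he : cexp (θ * I) ≠ 0 := Complex.exp_ne_zero _
    rw [indicator_of_mem h, indicator_of_mem h, vertexPower, vertexFactor]
    have : ∀ s : ℂ, s ≠ 0 → s ^ 2 * s⁻¹ ^ 3 = s⁻¹ := fun s hs => by field_simp
    have h1 : (cexp (θ * I) - (cexp (θ * I))⁻¹) ^ 2 * (cexp (θ * I) - (cexp (θ * I))⁻¹)⁻¹ ^ 3 =
        (cexp (θ * I) - (cexp (θ * I))⁻¹)⁻¹ := by
      exact this _ h0
    rw [h1, show m + 2 = m + 1 + 1 by ring, zpow_add_one₀ he, zpow_add_one₀ he]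
    have h2 : cexp (θ * I) * (cexp (θ * I))⁻¹ = 1 := mul_inv_cancel₀ he
    have h3 := mul_inv_cancel₀ h0
    linear_combination (cexp (θ * I) ^ m * cexp (θ * I)) * h3 + cexp (θ * I) ^ m *
      (cexp (θ * I) - (cexp (θ * I))⁻¹)⁻¹ * h2
  · simp [indicator_of_notMem h]

/-- The reflection `θ ↦ 2π - θ` inverts `w` and preserves the truncated arc, while `1 / (w - w⁻¹)`
changes sign. This symmetry of the excision fixes the starting values of the recursion. -/
theorem truncCoeff_three_neg (ε : ℝ) (m : ℤ) : truncCoeff ε 3 (-m) = -truncCoeff ε 3 m := by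
  rw [truncCoeff, truncCoeff, ← mul_neg, ← MeasureTheory.integral_neg]
  simp only [MeasureTheory.integral_Icc_eq_integral_Ioc,
    ← intervalIntegral.integral_of_le Real.two_pi_pos.le]
  have hsub := intervalIntegral.integral_comp_sub_left (a := 0) (b := 2 * Real.pi)
    (fun θ => (truncArc ε).indicator (vertexPower 3) θ * cexp (θ * I) ^ (-m)) (2 * Real.pi)
  rw [sub_self, sub_zero] at hsub
  rw [← hsub]
  congr 2
  ext θ
  have hw : cexp ((2 * Real.pi - θ : ℝ) * I) = (cexp (θ * I))⁻¹ := by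
    rw [← Complex.exp_neg, show ((2 * Real.pi - θ : ℝ) * I : ℂ) = -(θ * I) + 2 * Real.pi * I by
      push_cast; ring, Complex.exp_add, Complex.exp_two_pi_mul_I, mul_one]
  have hconj : (starRingEnd ℂ) (cexp (θ * I)) = (cexp (θ * I))⁻¹ := by
    rw [← Complex.exp_conj, ← Complex.exp_neg]; simp
  have hmem : 2 * Real.pi - θ ∈ truncArc ε ↔ θ ∈ truncArc ε := by
    simp only [truncArc, Set.mem_ofPred_eq]
    rw [hw, ← hconj]
    have h1 : ‖(starRingEnd ℂ) (cexp (θ * I)) - 1‖ = ‖cexp (θ * I) - 1‖ := by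
      rw [← Complex.norm_conj (cexp (θ * I) - 1)]; simp
    have h2 : ‖(starRingEnd ℂ) (cexp (θ * I)) + 1‖ = ‖cexp (θ * I) + 1‖ := by
      rw [← Complex.norm_conj (cexp (θ * I) + 1)]; simp
    rw [h1, h2]
  by_cases h : θ ∈ truncArc ε
  · rw [indicator_of_mem h, indicator_of_mem (hmem.2 h), vertexPower, vertexPower, hw, vertexFactor,
      vertexFactor, inv_zpow', neg_neg, inv_inv, ← neg_sub (cexp (θ * I)), inv_neg]
    ring
  · rw [indicator_of_notMem h, indicator_of_notMem (mt hmem.1 h)]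
    simp

theorem truncCoeff_three_zero (ε : ℝ) : truncCoeff ε 3 0 = 0 :=
  CharZero.eq_neg_self_iff.1 (truncCoeff_three_neg ε 0)

theorem truncCoeff_three_one {ε : ℝ} (hε : 0 < ε) :
    truncCoeff ε 3 1 = 1 / 2 * arcCoeff ε 0 := by
  have h1 := truncCoeff_three_add_two hε (-1)
  have h2 := truncCoeff_three_neg ε 1
  norm_num at h1
  linear_combination (1 / 2 : ℂ) * h1 + (1 / 2 : ℂ) * h2

/-- Induction with step two: each step adds at most `1`. The bound does not depend on `ε`, as
dominated convergence requires. -/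
theorem norm_truncCoeff_three_le {ε : ℝ} (hε : 0 < ε) (m : ℤ) :
    ‖truncCoeff ε 3 m‖ ≤ |(m : ℝ)| := by
  have hnat : ∀ k : ℕ, ‖truncCoeff ε 3 k‖ ≤ k := fun k => by
    induction k using Nat.twoStepInduction with
    | zero => simp [truncCoeff_three_zero]
    | one =>
      rw [Nat.cast_one, truncCoeff_three_one hε, norm_mul]
      have := norm_arcCoeff_le ε 0
      norm_num
      linarith
    | more k h1 _ =>
      have := truncCoeff_three_add_two hε k
      push_cast at this ⊢
      rw [this]
      refine (norm_add_le _ _).trans ?_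
      linarith [norm_arcCoeff_le ε (k + 1)]
  obtain ⟨k, rfl | rfl⟩ := m.eq_nat_or_neg
  · simpa using hnat k
  · rw [truncCoeff_three_neg, norm_neg]
    simpa using hnat k

theorem integral_exp_mul_I_zpow (m : ℤ) :
    ∫ θ in Icc 0 (2 * Real.pi), cexp (θ * I) ^ m = if m = 0 then (2 * Real.pi : ℂ) else 0 := by
  rw [MeasureTheory.integral_Icc_eq_integral_Ioc,
    ← intervalIntegral.integral_of_le Real.two_pi_pos.le]
  split_ifs with h
  · simp [h]
  · have hm : (m * I : ℂ) ≠ 0 := mul_ne_zero (Int.cast_ne_zero.2 h) Complex.I_ne_zero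
    have := integral_exp_mul_complex (a := 0) (b := 2 * Real.pi) hm
    simp only [← Complex.exp_int_mul]
    rw [show (fun θ : ℝ => cexp (m * (θ * I))) = fun θ : ℝ => cexp (m * I * θ) by
      ext θ; ring_nf, this]
    rw [show (m * I * ((2 * Real.pi : ℝ) : ℂ)) = m * (2 * Real.pi * I) by push_cast; ring,
      Complex.exp_int_mul_two_pi_mul_I]
    simp

theorem tendsto_arcCoeff (m : ℤ) :
    Tendsto (fun ε => arcCoeff ε m) (𝓝[>] 0) (𝓝 (if m = 0 then 1 else 0)) := by
  have hlim : (if m = 0 then 1 else 0 : ℂ) =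
      1 / (2 * Real.pi) * ∫ θ in Icc 0 (2 * Real.pi), cexp (θ * I) ^ m := by
    have hpi : (Real.pi : ℂ) ≠ 0 := by exact_mod_cast Real.pi_ne_zero
    rw [integral_exp_mul_I_zpow]
    split_ifs
    · field_simp
    · simp
  rw [hlim]
  refine Tendsto.const_mul _ ?_
  refine MeasureTheory.tendsto_integral_filter_of_norm_le_const
    (Eventually.of_forall fun ε => ?_) ⟨1, Eventually.of_forall fun ε =>
      Eventually.of_forall fun θ => ?_⟩ ?_
  · exact (integrableOn_indicator_mul_zpow (integrableOn_indicator_one ε) _).1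
  · rw [norm_mul, norm_exp_mul_I_zpow, mul_one]
    exact norm_indicator_one_le ε θ
  · have hc : ({θ : ℝ | Real.sin θ = 0}).Countable := by
      refine (countable_range fun n : ℤ => (n : ℝ) * Real.pi).mono fun θ hθ => ?_
      exact Real.sin_eq_zero_iff.1 hθ
    refine MeasureTheory.ae_restrict_of_ae ?_
    filter_upwards [hc.ae_notMem MeasureTheory.volume] with θ hθ
    have hs : cexp (θ * I) - (cexp (θ * I))⁻¹ ≠ 0 := fun h => hθ (by
      have := Complex.two_sin (θ : ℂ)
      rw [neg_mul, Complex.exp_neg] at this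
      have h2 : Complex.sin θ = 0 := by linear_combination this / 2 - I / 2 * h
      exact_mod_cast h2)
    have h0 := norm_pos_iff.2 hs
    rw [norm_exp_sub_inv] at h0
    have h1 := pos_of_mul_pos_left h0 (norm_nonneg _)
    have h2 := pos_of_mul_pos_right h0 (norm_nonneg _)
    refine tendsto_nhds_of_eventually_eq ?_
    have h3 : ∀ᶠ ε : ℝ in 𝓝[>] 0, ε < min ‖cexp (θ * I) - 1‖ ‖cexp (θ * I) + 1‖ :=
      nhdsWithin_le_nhds (eventually_lt_nhds (lt_min h1 h2))
    filter_upwards [h3] with ε hε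
    rw [indicator_of_mem (show θ ∈ truncArc ε from
      ⟨(hε.trans_le (min_le_left _ _)).le, (hε.trans_le (min_le_right _ _)).le⟩), one_mul]

/-- The limit of the Fourier coefficients of a vertex of degree at most `3`. -/
def vertexCoeff (d : ℕ) (m : ℤ) : ℂ :=
  if d = 1 then (if m = -1 then 1 else 0) - (if m = 1 then 1 else 0)
  else if d = 2 then (if m = 0 then 1 else 0)
  else if Odd m then (m.sign : ℂ) / 2 else 0

theorem tendsto_truncCoeff_three (m : ℤ) :
    Tendsto (fun ε => truncCoeff ε 3 m) (𝓝[>] 0) (𝓝 (vertexCoeff 3 m)) := by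
  have hnat : ∀ k : ℕ, Tendsto (fun ε => truncCoeff ε 3 k) (𝓝[>] 0) (𝓝 (vertexCoeff 3 k)) :=
      fun k => by
    induction k using Nat.twoStepInduction with
    | zero => simp [truncCoeff_three_zero, vertexCoeff]
    | one =>
      have h := (tendsto_arcCoeff 0).const_mul (1 / 2)
      rw [show vertexCoeff 3 (1 : ℕ) = 1 / 2 * if (0 : ℤ) = 0 then 1 else 0 by
        simp [vertexCoeff]]
      refine h.congr' ?_
      filter_upwards [self_mem_nhdsWithin] with ε hε
      rw [Nat.cast_one, truncCoeff_three_one hε]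
    | more k h1 _ =>
      have h := h1.add (tendsto_arcCoeff (k + 1))
      have hv : vertexCoeff 3 ((k + 2 : ℕ) : ℤ) =
          vertexCoeff 3 k + if (k + 1 : ℤ) = 0 then 1 else 0 := by
        rw [if_neg (by omega), add_zero, vertexCoeff, vertexCoeff]
        have hp : Odd ((k + 2 : ℕ) : ℤ) ↔ Odd (k : ℤ) := by
          push_cast
          simp [parity_simps]
        simp only [hp]
        norm_num
        split_ifs with hk
        · have hk0 : k ≠ 0 := by rintro rfl; simp at hk
          rw [Int.sign_eq_one_of_pos (by omega), Int.sign_eq_one_of_pos (by omega)]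
        · rfl
      rw [hv]
      refine h.congr' ?_
      filter_upwards [self_mem_nhdsWithin] with ε hε
      rw [← truncCoeff_three_add_two hε]
      push_cast
      rfl
  obtain ⟨k, rfl | rfl⟩ := m.eq_nat_or_neg
  · exact hnat k
  · simp only [truncCoeff_three_neg]
    rw [show vertexCoeff 3 (-(k : ℤ)) = -vertexCoeff 3 k by
      simp only [vertexCoeff, odd_neg, Int.sign_neg]
      norm_num
      split_ifs <;> ring]
    exact (hnat k).neg

theorem tendsto_truncCoeff {d : ℕ} (hd : d = 1 ∨ d = 2 ∨ d = 3) (m : ℤ) :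
    Tendsto (fun ε => truncCoeff ε d m) (𝓝[>] 0) (𝓝 (vertexCoeff d m)) := by
  rcases hd with rfl | rfl | rfl
  · have h := (tendsto_arcCoeff (m + 1)).sub (tendsto_arcCoeff (m - 1))
    rw [vertexCoeff, if_pos rfl]
    simp only [← eq_neg_iff_add_eq_zero, sub_eq_zero] at h
    refine h.congr' ?_
    filter_upwards [self_mem_nhdsWithin] with ε hε
    rw [truncCoeff_one hε]
  · rw [vertexCoeff, if_neg (by norm_num), if_pos rfl]
    refine (tendsto_arcCoeff m).congr' ?_
    filter_upwards [self_mem_nhdsWithin] with ε hε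
    rw [truncCoeff_two hε]
  · exact tendsto_truncCoeff_three m

theorem norm_truncCoeff_le {d : ℕ} (hd : d = 1 ∨ d = 2 ∨ d = 3) {ε : ℝ} (hε : 0 < ε) (m : ℤ) :
    ‖truncCoeff ε d m‖ ≤ if d = 3 then |(m : ℝ)| else 2 := by
  rcases hd with rfl | rfl | rfl
  · rw [truncCoeff_one hε, if_neg (by norm_num)]
    have h1 := norm_arcCoeff_le ε (m + 1)
    have h2 := norm_arcCoeff_le ε (m - 1)
    exact (norm_sub_le _ _).trans (by linarith)
  · rw [truncCoeff_two hε, if_neg (by norm_num)]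
    linarith [norm_arcCoeff_le ε m]
  · rw [if_pos rfl]
    exact norm_truncCoeff_three_le hε m

/-- The principal value of a plumbing graph all of whose vertices have degree `1`, `2` or `3`. -/
theorem tendsto_plumbingZTrunc {n : ℕ} {G : SimpleGraph (Fin n)} [DecidableRel G.Adj]
    {a : Fin n → ℤ} {τ : ℂ} (hdet : (plumbingMatrix G a).det ≠ 0)
    (hdeg : ∀ j, G.degree j = 1 ∨ G.degree j = 2 ∨ G.degree j = 3)
    (hsum : Summable fun x : Fin n → ℤ =>
      ‖qPow τ (thetaExponent (plumbingMatrix G a) ((plumbingMatrix G a).mulVec x))‖)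
    (hsum' : Summable fun x : Fin n → ℤ =>
      ‖qPow τ (thetaExponent (plumbingMatrix G a) ((plumbingMatrix G a).mulVec x))‖ *
        ∏ j, if G.degree j = 3 then |((plumbingMatrix G a).mulVec x j : ℝ)| else 2) :
    Tendsto (plumbingZTrunc G a τ) (𝓝[>] 0)
      (𝓝 (qPow τ ((-3 * (n : ℝ) + ((plumbingMatrix G a).trace : ℝ)) / 2) *
        ∑' x : Fin n → ℤ,
          qPow τ (thetaExponent (plumbingMatrix G a) ((plumbingMatrix G a).mulVec x)) *
            ∏ j, vertexCoeff (G.degree j) ((plumbingMatrix G a).mulVec x j))) := by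
  have h := (eventually_mem_nhdsWithin (a := (0 : ℝ)) (s := Ioi 0)).mono fun ε hε =>
    (plumbingZTrunc_eq_tsum (τ := τ) hdet hsum hε).symm
  refine Tendsto.congr' h (Tendsto.const_mul _ ?_)
  refine tendsto_tsum_of_dominated_convergence hsum' (fun x => Tendsto.const_mul _ ?_) ?_
  · exact tendsto_finsetProd _ fun j _ => tendsto_truncCoeff (hdeg j) _
  · filter_upwards [self_mem_nhdsWithin] with ε hε x
    rw [norm_mul, norm_prod]
    gcongr with j
    exact norm_truncCoeff_le (hdeg j) hε _

/-! ### The quadratic form of the Dynkin diagram -/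

/-- The Cartan matrix of the Dynkin diagram `D_{N+2}`. -/
abbrev cartanD (N : ℕ) : Matrix (Fin (N + 2)) (Fin (N + 2)) ℤ :=
  plumbingMatrix (dynkinD N) fun _ => 2

/-- Each of the four alternatives in the adjacency relation determines the neighbour uniquely and
excludes the others. With labels in `ℕ`, the neighbours of path vertices become plain index shifts.
-/
theorem sum_adj_dynkinD {R : Type*} [Ring R] (N : ℕ) (hN : 1 ≤ N) (X : ℕ → R) (j : Fin (N + 2)) :
    (∑ k : Fin (N + 2), if (dynkinD N).Adj j k then X k else 0) =
      (if 1 ≤ j.val ∧ j.val ≤ N then X (j.val - 1) else 0) +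
      (if j.val + 1 ≤ N then X (j.val + 1) else 0) +
      (if j.val + 1 = N then X (N + 1) else 0) + (if j.val = N + 1 then X (N - 1) else 0) := by
  have hj := j.isLt
  have hs : ∀ (P : Prop) [Decidable P] (i : ℕ), (P → i < N + 2) →
      (∑ k : Fin (N + 2), if P ∧ k.val = i then X k else 0) = if P then X i else 0 := by
    intro P _ i hi
    split_ifs with hP
    · rw [Finset.sum_eq_single (⟨i, hi hP⟩ : Fin (N + 2))]
      · simp [hP]
      · intro b _ hb
        rw [if_neg]
        rintro ⟨_, h⟩
        exact hb (Fin.ext h)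
      · simp
    · simp [hP]
  rw [← hs _ _ (fun h => by omega), ← hs _ _ (fun h => by omega), ← hs _ _ (fun h => by omega),
    ← hs _ _ (fun h => by omega), ← Finset.sum_add_distrib, ← Finset.sum_add_distrib,
    ← Finset.sum_add_distrib]
  refine Finset.sum_congr rfl fun k _ => ?_
  have hk := k.isLt
  have ha : (dynkinD N).Adj j k ↔ (j.val + 1 = k.val ∧ k.val ≤ N) ∨
    (k.val + 1 = j.val ∧ j.val ≤ N) ∨ (j.val + 1 = N ∧ k.val = N + 1) ∨
    (k.val + 1 = N ∧ j.val = N + 1) := Iff.rfl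
  rw [if_congr ha rfl rfl]
  by_cases h1 : j.val + 1 = k.val ∧ k.val ≤ N
  · rw [if_pos (Or.inl h1), if_neg (by omega), if_pos (by omega), if_neg (by omega),
      if_neg (by omega)]
    simp
  by_cases h2 : k.val + 1 = j.val ∧ j.val ≤ N
  · rw [if_pos (Or.inr (Or.inl h2)), if_pos (by omega), if_neg (by omega), if_neg (by omega),
      if_neg (by omega)]
    simp
  by_cases h3 : j.val + 1 = N ∧ k.val = N + 1
  · rw [if_pos (Or.inr (Or.inr (Or.inl h3))), if_neg (by omega), if_neg (by omega),
      if_pos (by omega), if_neg (by omega)]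
    simp
  by_cases h4 : k.val + 1 = N ∧ j.val = N + 1
  · rw [if_pos (Or.inr (Or.inr (Or.inr h4))), if_neg (by omega), if_neg (by omega),
      if_neg (by omega), if_pos (by omega)]
    simp
  rw [if_neg (by omega), if_neg (by omega), if_neg (by omega), if_neg (by omega),
    if_neg (by omega)]
  simp

theorem degree_dynkinD {N : ℕ} (hN : 2 ≤ N) (j : Fin (N + 2)) :
    (dynkinD N).degree j = if j.val + 1 = N then 3
      else if j.val = 0 ∨ j.val = N ∨ j.val = N + 1 then 1 else 2 := by
  have h := sum_adj_dynkinD N (by omega) (fun _ => (1 : ℤ)) j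
  have hd : ((dynkinD N).degree j : ℤ) =
      ∑ k : Fin (N + 2), if (dynkinD N).Adj j k then (1 : ℤ) else 0 := by
    rw [Finset.sum_boole, ← SimpleGraph.card_neighborFinset_eq_degree]
    congr 2
    ext k
    simp
  rw [← hd] at h
  have hj := j.isLt
  split_ifs at h ⊢ <;> omega

theorem trace_cartanD (N : ℕ) : (cartanD N).trace = 2 * ((N : ℤ) + 2) := by
  simp [Matrix.trace, plumbingMatrix]
  ring

/-- The extension by zero of a vector to the natural numbers. -/
def extendZero {n : ℕ} (x : Fin n → ℤ) (k : ℕ) : ℤ := if h : k < n then x ⟨k, h⟩ else 0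

theorem extendZero_val {n : ℕ} (x : Fin n → ℤ) (j : Fin n) : extendZero x j = x j := by
  simp [extendZero]

theorem cartanD_mulVec {N : ℕ} (hN : 1 ≤ N) (X : ℕ → ℤ) (j : Fin (N + 2)) :
    (cartanD N).mulVec (fun k => X k) j = 2 * X j -
      ((if 1 ≤ j.val ∧ j.val ≤ N then X (j.val - 1) else 0) +
      (if j.val + 1 ≤ N then X (j.val + 1) else 0) +
      (if j.val + 1 = N then X (N + 1) else 0) + (if j.val = N + 1 then X (N - 1) else 0)) := by
  rw [← sum_adj_dynkinD N hN X j, Matrix.mulVec, dotProduct]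
  have h : ∀ k : Fin (N + 2), cartanD N j k * X k =
      (if j = k then 2 * X k else 0) - if (dynkinD N).Adj j k then X k else 0 := fun k => by
    simp only [cartanD, plumbingMatrix, Matrix.of_apply]
    by_cases hjk : j = k
    · subst hjk; simp
    · simp only [hjk, if_false]
      split_ifs <;> ring
  rw [Finset.sum_congr rfl fun k _ => h k, Finset.sum_sub_distrib]
  simp

/-- Four times the quadratic form is a sum of squares. -/
theorem cartanD_form {K : ℕ} (X : ℕ → ℤ) :
    2 * ((fun k : Fin (K + 1 + 2) => X k) ⬝ᵥ (cartanD (K + 1)).mulVec fun k => X k) =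
      2 * X 0 ^ 2 + 2 * ∑ j ∈ Finset.range K, (X j - X (j + 1)) ^ 2 +
        (X K - 2 * X (K + 1)) ^ 2 + (X K - 2 * X (K + 2)) ^ 2 := by
  rw [dotProduct]
  simp only [cartanD_mulVec (Nat.le_add_left 1 K)]
  rw [Fin.sum_univ_eq_sum_range (fun j => X j * (2 * X j -
      ((if 1 ≤ j ∧ j ≤ K + 1 then X (j - 1) else 0) +
      (if j + 1 ≤ K + 1 then X (j + 1) else 0) +
      (if j + 1 = K + 1 then X (K + 1 + 1) else 0) +
      (if j = K + 1 + 1 then X (K + 1 - 1) else 0)))) (K + 1 + 2), Finset.sum_range_succ,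
    Finset.sum_range_succ, Finset.sum_range_succ]
  have hpath : ∑ j ∈ Finset.range K, X j * (2 * X j -
      ((if 1 ≤ j ∧ j ≤ K + 1 then X (j - 1) else 0) +
      (if j + 1 ≤ K + 1 then X (j + 1) else 0) +
      (if j + 1 = K + 1 then X (K + 1 + 1) else 0) +
      (if j = K + 1 + 1 then X (K + 1 - 1) else 0))) =
      ∑ j ∈ Finset.range K, (2 * X j ^ 2 - X j * X (j + 1) -
        X j * if 1 ≤ j then X (j - 1) else 0) := by
    refine Finset.sum_congr rfl fun j hj => ?_
    have hj := Finset.mem_range.1 hj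
    rw [if_pos (show j + 1 ≤ K + 1 by omega), if_neg (show ¬ j + 1 = K + 1 by omega),
      if_neg (show ¬ j = K + 1 + 1 by omega), if_congr (show 1 ≤ j ∧ j ≤ K + 1 ↔ 1 ≤ j by omega)
        rfl rfl]
    ring
  -- Completing squares along the path leaves a boundary term at its last vertex, which is kept on
  -- the left for the induction; the two leaves at the fork use it up.
  have htel : ∀ K : ℕ, ∑ j ∈ Finset.range K, (2 * X j ^ 2 - X j * X (j + 1) -
        X j * if 1 ≤ j then X (j - 1) else 0) + X K ^ 2 - X K * (if 1 ≤ K then X (K - 1) else 0) =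
      X 0 ^ 2 + ∑ j ∈ Finset.range K, (X j - X (j + 1)) ^ 2 := fun K => by
    induction K with
    | zero => simp
    | succ k ih =>
      rw [Finset.sum_range_succ, Finset.sum_range_succ, ← add_assoc, ← ih]
      simp only [Nat.le_add_left, if_true, Nat.add_sub_cancel]
      ring
  have := htel K
  rw [hpath]
  generalize ∑ j ∈ Finset.range K, (2 * X j ^ 2 - X j * X (j + 1) -
        X j * if 1 ≤ j then X (j - 1) else 0) = S at this ⊢
  have hK : ¬ K = K + 1 + 1 := by omega
  have hi : (if 1 ≤ K then X K * X (K - 1) else 0) = X K * if 1 ≤ K then X (K - 1) else 0 := by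
    split_ifs <;> simp
  norm_num [hK] at this ⊢
  rw [hi] at this
  linear_combination 2 * this

/-- The linear forms whose squares make up the quadratic form. -/
def cartanDForms (K : ℕ) (x : Fin (K + 1 + 2) → ℤ) (k : Fin (K + 1 + 2)) : ℤ :=
  if k.val = 0 then x 0
  else if k.val ≤ K then extendZero x (k.val - 1) - extendZero x k.val
  else extendZero x K - 2 * x k

/-- The system is triangular: the entries up to index `K` are recovered successively from the start
of the path, and then the two leaves from the entry at `K`. -/
theorem cartanDForms_injective (K : ℕ) : Function.Injective (cartanDForms K) := by
  intro x y hxy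
  have hk : ∀ k, cartanDForms K x k = cartanDForms K y k := fun k => congrFun hxy k
  have hpath : ∀ k : ℕ, k ≤ K → extendZero x k = extendZero y k := fun k => by
    induction k with
    | zero =>
      intro _
      have := hk 0
      simpa [cartanDForms, extendZero] using this
    | succ k ih =>
      intro hkK
      have := hk ⟨k + 1, by omega⟩
      simp only [cartanDForms, Nat.add_eq_zero_iff, one_ne_zero, and_false, if_false, if_pos hkK,
        Nat.add_sub_cancel, ih (by omega)] at this
      linarith
  ext k
  rcases le_or_gt k.val K with h | h
  · rw [← extendZero_val x, ← extendZero_val y, hpath _ h]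
  · have := hk k
    simp only [cartanDForms, if_neg (show ¬ k.val = 0 by omega), if_neg (not_le.2 h),
      hpath K le_rfl] at this
    linarith

theorem sum_cartanDForms_sq_le (K : ℕ) (x : Fin (K + 1 + 2) → ℤ) :
    ∑ k, cartanDForms K x k ^ 2 ≤ 2 * (x ⬝ᵥ (cartanD (K + 1)).mulVec x) := by
  have h := cartanD_form (K := K) (extendZero x)
  simp only [extendZero_val] at h
  rw [h]
  have h1 : ∀ k : Fin (K + 1 + 2), cartanDForms K x k ^ 2 = (fun j : ℕ =>
      (if j = 0 then extendZero x 0 else if j ≤ K then extendZero x (j - 1) - extendZero x j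
        else extendZero x K - 2 * extendZero x j) ^ 2) k := fun k => by
    simp only [cartanDForms, extendZero_val]
    congr 1
  rw [Finset.sum_congr rfl fun k _ => h1 k, Fin.sum_univ_eq_sum_range (fun j : ℕ =>
      (if j = 0 then extendZero x 0 else if j ≤ K then extendZero x (j - 1) - extendZero x j
        else extendZero x K - 2 * extendZero x j) ^ 2), Finset.sum_range_succ,
    Finset.sum_range_succ, Finset.sum_range_succ']
  have h2 : ∑ j ∈ Finset.range K, (if j + 1 = 0 then extendZero x 0 else
      if j + 1 ≤ K then extendZero x (j + 1 - 1) - extendZero x (j + 1)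
        else extendZero x K - 2 * extendZero x (j + 1)) ^ 2 =
      ∑ j ∈ Finset.range K, (extendZero x j - extendZero x (j + 1)) ^ 2 := by
    refine Finset.sum_congr rfl fun j hj => ?_
    have hj := Finset.mem_range.1 hj
    rw [if_neg (by omega), if_pos (by omega), Nat.add_sub_cancel]
  rw [h2]
  have h3 : 0 ≤ ∑ j ∈ Finset.range K, (extendZero x j - extendZero x (j + 1)) ^ 2 :=
    Finset.sum_nonneg fun j _ => sq_nonneg _
  have hK : ¬ K + 1 + 1 ≤ K := by omega
  norm_num [hK]
  nlinarith [sq_nonneg (extendZero x 0)]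

theorem det_cartanD_ne_zero (K : ℕ) : (cartanD (K + 1)).det ≠ 0 := by
  intro h
  obtain ⟨x, hx, h0⟩ := Matrix.exists_mulVec_eq_zero_iff.2 h
  apply hx
  apply cartanDForms_injective K
  have h1 := sum_cartanDForms_sq_le K x
  rw [h0, dotProduct_zero, mul_zero] at h1
  have h2 := (Finset.sum_eq_zero_iff_of_nonneg fun k _ => sq_nonneg (cartanDForms K x k)).1
    (le_antisymm h1 (Finset.sum_nonneg fun k _ => sq_nonneg _))
  ext k
  have h3 := h2 k (Finset.mem_univ k)
  rw [pow_eq_zero_iff two_ne_zero] at h3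
  rw [h3]
  simp [cartanDForms, extendZero]

/-- The label of the trivalent vertex is bounded by the quadratic form. -/
theorem sq_cartanD_mulVec_le {K : ℕ} (hK : 1 ≤ K) (x : Fin (K + 1 + 2) → ℤ)
    (j : Fin (K + 1 + 2)) (hj : j.val = K) :
    (cartanD (K + 1)).mulVec x j ^ 2 ≤ 2 * (x ⬝ᵥ (cartanD (K + 1)).mulVec x) := by
  have h := cartanD_form (K := K) (extendZero x)
  have hm := cartanD_mulVec (N := K + 1) (by omega) (extendZero x) j
  simp only [extendZero_val] at h hm
  have h3 : (extendZero x (K - 1) - extendZero x K) ^ 2 ≤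
      ∑ j ∈ Finset.range K, (extendZero x j - extendZero x (j + 1)) ^ 2 := by
    have := Finset.single_le_sum (f := fun j => (extendZero x j - extendZero x (j + 1)) ^ 2)
      (fun j _ => sq_nonneg _) (Finset.mem_range.2 (show K - 1 < K by omega))
    simpa [Nat.sub_add_cancel hK] using this
  rw [h, hm, ← extendZero_val x j, hj, if_pos (by omega), if_pos (by omega), if_pos rfl,
    if_neg (by omega)]
  set A := extendZero x (K - 1)
  set B := extendZero x K
  set C := extendZero x (K + 1)
  set D := extendZero x (K + 2)
  -- The label is `(B - A) + (B - 2C)/2 + (B - 2D)/2`. Cauchy–Schwarz bounds its square by `2(B -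
  -- A)² + (B - 2C)² + (B - 2D)²`, and the hints are the squares of the pairwise differences.
  nlinarith [sq_nonneg (extendZero x 0), sq_nonneg ((B - A) - (B - 2 * C)),
    sq_nonneg ((B - A) - (B - 2 * D)), sq_nonneg ((B - 2 * C) - (B - 2 * D))]

/-! ### Convergence of the theta series -/

theorem summable_pi_prod_of_nonneg {n : ℕ} {f : ℤ → ℝ} (hf : Summable f) (h0 : ∀ m, 0 ≤ f m) :
    Summable fun x : Fin n → ℤ => ∏ j, f (x j) := by
  induction n with
  | zero => exact .of_finite
  | succ n ih =>
    rw [← (Fin.consEquiv fun _ => ℤ).summable_iff]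
    refine (hf.mul_of_nonneg ih h0 fun x => Finset.prod_nonneg fun j _ => h0 _).congr fun p => ?_
    simp [Fin.prod_univ_succ, Fin.consEquiv]

/-- The form dominates half the sum of squares of the linear forms `cartanDForms`. Their injectivity
makes the series a subfamily of a product of one-dimensional Gaussian series. -/
theorem summable_exp_cartanD (K : ℕ) {t : ℝ} (ht : 0 < t) :
    Summable fun x : Fin (K + 1 + 2) → ℤ =>
      Real.exp (-t * ((x ⬝ᵥ (cartanD (K + 1)).mulVec x : ℤ) : ℝ)) := by
  have h1 : Summable fun m : ℤ => Real.exp (-(t / 2) * (m : ℝ) ^ 2) := by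
    refine (summable_exp_sq 0 (t := t / 2 / (2 * Real.pi)) (by positivity)).congr fun m => ?_
    congr 1
    field_simp
    ring
  have h2 := (summable_pi_prod_of_nonneg (n := K + 1 + 2) h1 fun m => (Real.exp_pos _).le).comp_injective
    (cartanDForms_injective K)
  refine Summable.of_nonneg_of_le (fun x => (Real.exp_pos _).le) (fun x => ?_) h2
  simp only [Function.comp, ← Real.exp_sum]
  refine Real.exp_le_exp.2 ?_
  rw [← Finset.mul_sum]
  have h3 : ((∑ k, cartanDForms K x k ^ 2 : ℤ) : ℝ) ≤
      ((2 * (x ⬝ᵥ (cartanD (K + 1)).mulVec x) : ℤ) : ℝ) := Int.cast_le.2 (sum_cartanDForms_sq_le K x)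
  push_cast at h3 ⊢
  nlinarith

/-! ### The principal value for the Dynkin diagram -/

theorem thetaExponent_cartanD (K : ℕ) (x : Fin (K + 1 + 2) → ℤ) :
    thetaExponent (cartanD (K + 1)) ((cartanD (K + 1)).mulVec x) =
      1 / 2 * ((x ⬝ᵥ (cartanD (K + 1)).mulVec x : ℤ) : ℝ) :=
  thetaExponent_mulVec (det_cartanD_ne_zero K) x

theorem norm_qPow_cartanD (K : ℕ) (τ : ℂ) (x : Fin (K + 1 + 2) → ℤ) :
    ‖qPow τ (thetaExponent (cartanD (K + 1)) ((cartanD (K + 1)).mulVec x))‖ =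
      Real.exp (-(Real.pi * τ.im) * ((x ⬝ᵥ (cartanD (K + 1)).mulVec x : ℤ) : ℝ)) := by
  rw [thetaExponent_cartanD, norm_qPow]
  ring_nf

theorem summable_norm_qPow_cartanD (K : ℕ) {τ : ℂ} (hτ : 0 < τ.im) :
    Summable fun x : Fin (K + 1 + 2) → ℤ =>
      ‖qPow τ (thetaExponent (cartanD (K + 1)) ((cartanD (K + 1)).mulVec x))‖ := by
  simp only [norm_qPow_cartanD]
  exact summable_exp_cartanD K (by positivity)

/-- The trivalent label is an integer, so its absolute value is at most its square and hence at most
`2Q`. Half of the Gaussian decay absorbs this factor, and the other half is summed. -/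
theorem summable_norm_qPow_mul_label {K : ℕ} (hK : 1 ≤ K) {τ : ℂ} (hτ : 0 < τ.im) :
    Summable fun x : Fin (K + 1 + 2) → ℤ =>
      ‖qPow τ (thetaExponent (cartanD (K + 1)) ((cartanD (K + 1)).mulVec x))‖ *
        ∏ j, if (dynkinD (K + 1)).degree j = 3 then
          |((cartanD (K + 1)).mulVec x j : ℝ)| else 2 := by
  set s := Real.pi * τ.im / 2 with hs
  have hs0 : 0 < s := by positivity
  refine Summable.of_nonneg_of_le (fun x => by positivity) (fun x => ?_)
    ((summable_exp_cartanD K hs0).mul_right (2 / s * 2 ^ (K + 2)))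
  set c : Fin (K + 1 + 2) := ⟨K, by omega⟩ with hc
  set Q : ℝ := ((x ⬝ᵥ (cartanD (K + 1)).mulVec x : ℤ) : ℝ) with hQ
  have hdeg : ∀ j, (dynkinD (K + 1)).degree j = 3 ↔ j = c := fun j => by
    rw [degree_dynkinD (by omega), Fin.ext_iff]
    split_ifs with h1 h2 <;> simp [hc] <;> omega
  have hprod : ∏ j, (if (dynkinD (K + 1)).degree j = 3 then
      |((cartanD (K + 1)).mulVec x j : ℝ)| else 2) =
      |((cartanD (K + 1)).mulVec x c : ℝ)| * 2 ^ (K + 2) := by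
    simp only [hdeg]
    rw [← Finset.mul_prod_erase _ _ (Finset.mem_univ c), if_pos rfl,
      Finset.prod_congr rfl fun j hj => if_neg (Finset.ne_of_mem_erase hj), Finset.prod_const,
      Finset.card_erase_of_mem (Finset.mem_univ c), Finset.card_univ, Fintype.card_fin]
    rfl
  have hlabel : |((cartanD (K + 1)).mulVec x c : ℝ)| ≤ 2 * Q := by
    have h1 := sq_cartanD_mulVec_le hK x c rfl
    have h2 : |(cartanD (K + 1)).mulVec x c| ≤ (cartanD (K + 1)).mulVec x c ^ 2 := by
      rw [← sq_abs]
      exact Int.le_self_sq _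
    rw [hQ]
    exact_mod_cast h2.trans h1
  have hexp : s * Q ≤ Real.exp (s * Q) := by linarith [Real.add_one_le_exp (s * Q)]
  rw [norm_qPow_cartanD, hprod, ← hQ, show -(Real.pi * τ.im) * Q = -s * Q + -(s * Q) by
    rw [hs]; ring, Real.exp_add, mul_assoc]
  refine mul_le_mul_of_nonneg_left ?_ (Real.exp_pos _).le
  rw [← mul_assoc]
  refine mul_le_mul_of_nonneg_right ?_ (by positivity)
  rw [Real.exp_neg, inv_mul_le_iff₀ (Real.exp_pos _)]
  refine hlabel.trans ?_
  rw [← mul_div_assoc, le_div_iff₀ hs0]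
  linarith

theorem degree_dynkinD_mem {N : ℕ} (hN : 2 ≤ N) (j : Fin (N + 2)) :
    (dynkinD N).degree j = 1 ∨ (dynkinD N).degree j = 2 ∨ (dynkinD N).degree j = 3 := by
  rw [degree_dynkinD hN]
  split_ifs <;> simp

theorem tendsto_plumbingZTrunc_dynkinD {K : ℕ} (hK : 1 ≤ K) {τ : ℂ} (hτ : 0 < τ.im) :
    Tendsto (plumbingZTrunc (dynkinD (K + 1)) (fun _ => 2) τ) (𝓝[>] 0)
      (𝓝 (qPow τ (-((K : ℝ) + 3) / 2) * ∑' x : Fin (K + 1 + 2) → ℤ,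
        qPow τ (1 / 2 * ((x ⬝ᵥ (cartanD (K + 1)).mulVec x : ℤ) : ℝ)) *
          ∏ j, vertexCoeff ((dynkinD (K + 1)).degree j) ((cartanD (K + 1)).mulVec x j))) := by
  have h := tendsto_plumbingZTrunc (det_cartanD_ne_zero K) (degree_dynkinD_mem (by omega))
    (summable_norm_qPow_cartanD K hτ) (summable_norm_qPow_mul_label hK hτ)
  simp only [thetaExponent_cartanD, trace_cartanD] at h
  convert h using 4
  push_cast
  ring

theorem ZD_eq_tsum_lattice {K : ℕ} (hK : 1 ≤ K) {τ : ℂ} (hτ : 0 < τ.im) :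
    ZD (K + 1) τ = qPow τ (-((K : ℝ) + 3) / 2) * ∑' x : Fin (K + 1 + 2) → ℤ,
        qPow τ (1 / 2 * ((x ⬝ᵥ (cartanD (K + 1)).mulVec x : ℤ) : ℝ)) *
          ∏ j, vertexCoeff ((dynkinD (K + 1)).degree j) ((cartanD (K + 1)).mulVec x j) :=
  (tendsto_plumbingZTrunc_dynkinD hK hτ).limUnder_eq

theorem plumbingZConverges_dynkinD {N : ℕ} (hN : 2 ≤ N) {τ : ℂ} (hτ : 0 < τ.im) :
    PlumbingZConverges (dynkinD N) (fun _ => 2) τ := by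
  obtain ⟨K, rfl⟩ : ∃ K, N = K + 1 := ⟨N - 1, by omega⟩
  have hs := summable_norm_qPow_cartanD K hτ
  refine ⟨fun w hw => summable_thetaTerm (det_cartanD_ne_zero K) hs hw,
    fun ε hε => torusIntegrable_plumbingIntegrand (det_cartanD_ne_zero K) hs hε, ?_⟩
  have h := tendsto_plumbingZTrunc_dynkinD (K := K) (by omega) hτ
  rwa [← ZD_eq_tsum_lattice (by omega) hτ] at h

/-! ### The points of the lattice that contribute -/

theorem prod_vertexCoeff_dynkinD (L : ℕ) (X : ℕ → ℤ) :
    ∏ j : Fin (L + 1 + 1 + 2), vertexCoeff ((dynkinD (L + 1 + 1)).degree j)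
      ((cartanD (L + 1 + 1)).mulVec (fun k => X k) j) =
      vertexCoeff 1 (2 * X 0 - X 1) *
        (∏ j ∈ Finset.range L, vertexCoeff 2 (2 * X (j + 1) - X j - X (j + 2))) *
        vertexCoeff 3 (2 * X (L + 1) - X L - X (L + 2) - X (L + 3)) *
        vertexCoeff 1 (2 * X (L + 2) - X (L + 1)) * vertexCoeff 1 (2 * X (L + 3) - X (L + 1)) := by
  simp only [cartanD_mulVec (show 1 ≤ L + 1 + 1 by omega),
    degree_dynkinD (show 2 ≤ L + 1 + 1 by omega)]
  rw [Fin.prod_univ_eq_prod_range (fun j : ℕ => vertexCoeff (if j + 1 = L + 1 + 1 then 3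
      else if j = 0 ∨ j = L + 1 + 1 ∨ j = L + 1 + 1 + 1 then 1 else 2) (2 * X j -
      ((if 1 ≤ j ∧ j ≤ L + 1 + 1 then X (j - 1) else 0) +
      (if j + 1 ≤ L + 1 + 1 then X (j + 1) else 0) +
      (if j + 1 = L + 1 + 1 then X (L + 1 + 1 + 1) else 0) +
      (if j = L + 1 + 1 + 1 then X (L + 1 + 1 - 1) else 0)))) (L + 1 + 1 + 2),
    Finset.prod_range_succ, Finset.prod_range_succ, Finset.prod_range_succ,
    Finset.prod_range_succ']
  have hmid : ∀ j ∈ Finset.range L, vertexCoeff (if j + 1 + 1 = L + 1 + 1 then 3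
      else if j + 1 = 0 ∨ j + 1 = L + 1 + 1 ∨ j + 1 = L + 1 + 1 + 1 then 1 else 2)
      (2 * X (j + 1) - ((if 1 ≤ j + 1 ∧ j + 1 ≤ L + 1 + 1 then X (j + 1 - 1) else 0) +
      (if j + 1 + 1 ≤ L + 1 + 1 then X (j + 1 + 1) else 0) +
      (if j + 1 + 1 = L + 1 + 1 then X (L + 1 + 1 + 1) else 0) +
      (if j + 1 = L + 1 + 1 + 1 then X (L + 1 + 1 - 1) else 0))) =
      vertexCoeff 2 (2 * X (j + 1) - X j - X (j + 2)) := fun j hj => by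
    have hj := Finset.mem_range.1 hj
    rw [if_neg (by omega), if_neg (by omega), if_pos (by omega), if_pos (by omega),
      if_neg (by omega), if_neg (by omega), Nat.add_sub_cancel]
    ring_nf
  rw [Finset.prod_congr rfl hmid]
  have h1 : ¬ L + 1 + 1 + 1 = L + 1 + 1 := by omega
  have h2 : ¬ L + 1 = L + 1 + 1 + 1 := by omega
  have h3 : ¬ L + 1 + 1 + 1 ≤ L + 1 + 1 := by omega
  norm_num [h1, h2, h3]
  simp only [sub_add_eq_sub_sub]
  ring_nf
  simp

theorem vertexCoeff_one_unit (s : ℤˣ) : vertexCoeff 1 s = -((s : ℤ) : ℂ) := by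
  rcases Int.units_eq_one_or s with rfl | rfl <;> norm_num [vertexCoeff]

theorem exists_unit_of_vertexCoeff_one_ne_zero {m : ℤ} (h : vertexCoeff 1 m ≠ 0) :
    ∃ s : ℤˣ, m = s := by
  by_cases h1 : m = 1
  · exact ⟨1, by simp [h1]⟩
  by_cases h2 : m = -1
  · exact ⟨-1, by simp [h2]⟩
  exact absurd (by simp [vertexCoeff, h1, h2]) h

theorem eq_zero_of_vertexCoeff_two_ne_zero {m : ℤ} (h : vertexCoeff 2 m ≠ 0) : m = 0 := by
  by_contra h1
  exact h (by simp [vertexCoeff, h1])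

theorem vertexCoeff_one_eq_zero_of_even {m : ℤ} (h : Even m) : vertexCoeff 1 m = 0 := by
  have h1 : m ≠ 1 := by rintro rfl; simp at h
  have h2 : m ≠ -1 := by rintro rfl; simp at h
  simp [vertexCoeff, h1, h2]

/-- The vectors for which the labels of all vertices but the trivalent one are those of a
contributing term. -/
def contributingVector (L : ℕ) (p : ℤ × ℤˣ × ℤˣ × ℤˣ) (k : ℕ) : ℤ :=
  if k ≤ L + 1 then (k + 1) * p.1 + (p.2.1 : ℤ)
  else if k = L + 2 then ((L + 2) * p.1 + (p.2.1 : ℤ) + (p.2.2.1 : ℤ)) / 2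
  else ((L + 2) * p.1 + (p.2.1 : ℤ) + (p.2.2.2 : ℤ)) / 2

/-- The first two entries determine `a` and `s₁`. For the leaves, `(b + 1)/2` and `(b - 1)/2` differ
by one whatever the parity of `b`, so the rounding in the definition loses nothing. -/
theorem contributingVector_injective (L : ℕ) : Function.Injective
    fun (p : ℤ × ℤˣ × ℤˣ × ℤˣ) (k : Fin (L + 1 + 1 + 2)) => contributingVector L p k := by
  rintro ⟨a, s₁, s₂, s₃⟩ ⟨a', s₁', s₂', s₃'⟩ h
  have hk : ∀ k : ℕ, k < L + 1 + 1 + 2 → contributingVector L (a, s₁, s₂, s₃) k =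
    contributingVector L (a', s₁', s₂', s₃') k := fun k hk => congrFun h ⟨k, hk⟩
  have h0 := hk 0 (by omega)
  have h1 := hk 1 (by omega)
  have h2 := hk (L + 2) (by omega)
  have h3 := hk (L + 3) (by omega)
  simp [contributingVector] at h0 h1 h2 h3
  have ha : a = a' := by linarith
  subst ha
  have hs : s₁ = s₁' := Units.ext (by linarith)
  subst hs
  have hsep : ∀ (b : ℤ) (s s' : ℤˣ), (b + s) / 2 = (b + s') / 2 → s = s' := fun b s s' hb => by
    rcases Int.units_eq_one_or s with rfl | rfl <;> rcases Int.units_eq_one_or s' with rfl | rfl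
    · rfl
    · exfalso; push_cast at hb; omega
    · exfalso; push_cast at hb; omega
    · rfl
  rw [hsep _ _ _ h2, hsep _ _ _ h3]

/-- Zero labels at the vertices of degree two are the recursion of an arithmetic progression,
started by the label `s₁` of the first leaf. The labels of the other leaves then determine their
entries. -/
theorem mem_range_contributingVector {L : ℕ} {x : Fin (L + 1 + 1 + 2) → ℤ}
    (hx : ∏ j, vertexCoeff ((dynkinD (L + 1 + 1)).degree j)
      ((cartanD (L + 1 + 1)).mulVec x j) ≠ 0) :
    ∃ p, (fun k : Fin (L + 1 + 1 + 2) => contributingVector L p k) = x := by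
  set X := extendZero x with hX
  have hXx : (fun k : Fin (L + 1 + 1 + 2) => X k) = x := funext fun k => extendZero_val x k
  rw [← hXx, prod_vertexCoeff_dynkinD] at hx
  have h5 := right_ne_zero_of_mul hx
  have hx := left_ne_zero_of_mul hx
  have h4 := right_ne_zero_of_mul hx
  have hx := left_ne_zero_of_mul (left_ne_zero_of_mul hx)
  have h1 := left_ne_zero_of_mul hx
  have h2 := fun j hj => eq_zero_of_vertexCoeff_two_ne_zero
    (Finset.prod_ne_zero_iff.1 (right_ne_zero_of_mul hx) j hj)
  obtain ⟨s₁, hs₁⟩ := exists_unit_of_vertexCoeff_one_ne_zero h1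
  obtain ⟨s₂, hs₂⟩ := exists_unit_of_vertexCoeff_one_ne_zero h4
  obtain ⟨s₃, hs₃⟩ := exists_unit_of_vertexCoeff_one_ne_zero h5
  have hpath : ∀ k : ℕ, k ≤ L + 1 → X k = (k + 1) * (X 0 - s₁) + s₁ := fun k => by
    induction k using Nat.twoStepInduction with
    | zero => intro _; push_cast; ring
    | one => intro _; push_cast; linarith
    | more k ih1 ih2 =>
      intro hk
      have h := h2 k (Finset.mem_range.2 (by omega))
      have := ih1 (by omega)
      have := ih2 (by omega)
      push_cast at *
      linarith
  refine ⟨(X 0 - s₁, s₁, s₂, s₃), ?_⟩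
  rw [← hXx]
  ext ⟨k, hk⟩
  have hL := hpath (L + 1) le_rfl
  push_cast at hL
  simp only [contributingVector]
  split_ifs with h h'
  · rw [hpath k h]
  · rw [h', show ((L : ℤ) + 2) * (X 0 - s₁) + s₁ + s₂ = 2 * X (L + 2) by linarith]
    omega
  · rw [show k = L + 3 by omega, show ((L : ℤ) + 2) * (X 0 - s₁) + s₁ + s₃ = 2 * X (L + 3) by
      linarith]
    omega

/-- If `N a` is even, where `N = L + 2`, the halves in the definition are exact and the leaf labels
are `s₂` and `s₃`; the trivalent label follows. If `N a` is odd, the rounded leaf entry gives an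
even label, where the leaf coefficient vanishes. -/
theorem prod_vertexCoeff_contributingVector (L : ℕ) (a : ℤ) (s₁ s₂ s₃ : ℤˣ) :
    ∏ j : Fin (L + 1 + 1 + 2), vertexCoeff ((dynkinD (L + 1 + 1)).degree j)
      ((cartanD (L + 1 + 1)).mulVec (fun k => contributingVector L (a, s₁, s₂, s₃) k) j) =
      if Even (((L : ℤ) + 2) * a) then
        -((s₁ : ℤ) * (s₂ : ℤ) * (s₃ : ℤ) * vertexCoeff 3 (a - ((s₂ : ℤ) + (s₃ : ℤ)) / 2) : ℂ)
      else 0 := by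
  rw [prod_vertexCoeff_dynkinD]
  set c : ℤ := ((L : ℤ) + 2) * a with hc
  set X := contributingVector L (a, s₁, s₂, s₃) with hX
  have hX0 : ∀ k : ℕ, k ≤ L + 1 → X k = (k + 1) * a + s₁ := fun k hk => by
    simp [hX, contributingVector, hk]
  have hXc : X (L + 1) = c + s₁ := by
    rw [hX0 _ le_rfl, hc]; push_cast; ring
  have hX2 : X (L + 2) = (c + s₁ + s₂) / 2 := by simp [hX, contributingVector, hc]
  have hX3 : X (L + 3) = (c + s₁ + s₃) / 2 := by simp [hX, contributingVector, hc]
  have hmid : ∏ j ∈ Finset.range L, vertexCoeff 2 (2 * X (j + 1) - X j - X (j + 2)) = 1 := by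
    refine Finset.prod_eq_one fun j hj => ?_
    have hj := Finset.mem_range.1 hj
    rw [hX0 _ (by omega), hX0 _ (by omega), hX0 _ (by omega)]
    push_cast
    rw [show 2 * (((j : ℤ) + 1 + 1) * a + s₁) - ((j + 1) * a + s₁) - ((j + 2 + 1) * a + s₁) = 0 by
      ring]
    simp [vertexCoeff]
  rw [hmid, hXc, hX2, hX3, hX0 0 (by omega), hX0 1 (by omega), hX0 L (by omega)]
  have hleaf : ∀ s : ℤˣ, Even c → 2 * ((c + s₁ + s) / 2) - (c + s₁) = (s : ℤ) := fun s h => by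
    obtain ⟨b, hb⟩ := h
    rcases Int.units_eq_one_or s₁ with rfl | rfl <;> rcases Int.units_eq_one_or s with rfl | rfl <;>
      push_cast <;> omega
  split_ifs with h
  · rw [hleaf s₂ h, hleaf s₃ h, vertexCoeff_one_unit, vertexCoeff_one_unit]
    have h1 : 2 * (((0 : ℕ) + 1) * a + s₁) - (((1 : ℕ) + 1) * a + s₁) = (s₁ : ℤ) := by
      push_cast; ring
    have h2 : 2 * (c + s₁) - ((L + 1) * a + s₁) - (c + s₁ + s₂) / 2 - (c + s₁ + s₃) / 2 =
        a - ((s₂ : ℤ) + s₃) / 2 := by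
      have h3 : ((L : ℤ) + 1) * a = c - a := by rw [hc]; ring
      rw [h3]
      obtain ⟨b, hb⟩ := h
      rcases Int.units_eq_one_or s₁ with h1 | h1 <;> rcases Int.units_eq_one_or s₂ with h2 | h2 <;>
        rcases Int.units_eq_one_or s₃ with h3 | h3 <;> rw [h1, h2, h3] <;> push_cast <;> omega
    rw [h1, h2, vertexCoeff_one_unit]
    ring
  · have h1 : Even (2 * ((c + s₁ + s₂) / 2) - (c + s₁)) := by
      rw [Int.not_even_iff_odd] at h
      have : Odd (s₁ : ℤ) := by rcases Int.units_eq_one_or s₁ with h1 | h1 <;> rw [h1] <;> decide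
      exact (even_two_mul _).sub (h.add_odd this)
    rw [vertexCoeff_one_eq_zero_of_even h1]
    ring

/-- In the sum of squares every path difference is `-a` and the two fork terms are `(-s₂)² = (-s₃)²
= 1`. So the value does not depend on `s₂, s₃`. -/
theorem form_contributingVector (L : ℕ) (a : ℤ) (s₁ s₂ s₃ : ℤˣ) (h : Even (((L : ℤ) + 2) * a)) :
    ((fun k : Fin (L + 1 + 1 + 2) => contributingVector L (a, s₁, s₂, s₃) k) ⬝ᵥ
      (cartanD (L + 1 + 1)).mulVec fun k => contributingVector L (a, s₁, s₂, s₃) k) =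
      ((L : ℤ) + 2) * a ^ 2 + 2 * a * s₁ + 2 := by
  have hform := cartanD_form (K := L + 1) (contributingVector L (a, s₁, s₂, s₃))
  set c : ℤ := ((L : ℤ) + 2) * a with hc
  set X := contributingVector L (a, s₁, s₂, s₃) with hX
  have hX0 : ∀ k : ℕ, k ≤ L + 1 → X k = (k + 1) * a + s₁ := fun k hk => by
    simp [hX, contributingVector, hk]
  have hXc : X (L + 1) = c + s₁ := by
    rw [hX0 _ le_rfl, hc]; push_cast; ring
  have hX2 : X (L + 2) = (c + s₁ + s₂) / 2 := by simp [hX, contributingVector, hc]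
  have hX3 : X (L + 3) = (c + s₁ + s₃) / 2 := by simp [hX, contributingVector, hc]
  have hsum : ∑ j ∈ Finset.range (L + 1), (X j - X (j + 1)) ^ 2 = ((L : ℤ) + 1) * a ^ 2 := by
    rw [Finset.sum_congr rfl fun j hj => by
      have hj := Finset.mem_range.1 hj
      rw [hX0 _ (by omega), hX0 _ (by omega), show ((j : ℤ) + 1) * a + s₁ -
        (((j + 1 : ℕ) + 1) * a + s₁) = -a by push_cast; ring]]
    simp
  have hleaf : ∀ s : ℤˣ, c + s₁ - 2 * ((c + s₁ + s) / 2) = -(s : ℤ) := fun s => by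
    obtain ⟨b, hb⟩ := h
    rcases Int.units_eq_one_or s₁ with rfl | rfl <;> rcases Int.units_eq_one_or s with rfl | rfl <;>
      push_cast <;> omega
  have hsq : ∀ s : ℤˣ, (-(s : ℤ)) ^ 2 = 1 := fun s => by
    rcases Int.units_eq_one_or s with rfl | rfl <;> norm_num
  have hs1 := hsq s₁
  rw [hsum, show L + 1 + 1 = L + 2 from rfl, show L + 1 + 2 = L + 3 from rfl, hXc, hX2, hX3, hleaf,
    hleaf, hsq, hsq, hX0 0 (by omega)] at hform
  push_cast at hform
  rw [show L + 1 + 1 = L + 2 from rfl]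
  linarith

/-- For even `a` only `s₂ = s₃` gives an odd label, namely `a ∓ 1`, and the half signs of `a - 1`
and `a + 1` add up to `sgn a`, also at `a = 0`. For odd `a` only `s₂ = -s₃` contributes, twice `-sgn
a / 2`. -/
theorem sum_vertexCoeff_three (a : ℤ) :
    ∑ s₂ : ℤˣ, ∑ s₃ : ℤˣ, ((s₂ : ℤ) * (s₃ : ℤ) * vertexCoeff 3 (a - ((s₂ : ℤ) + (s₃ : ℤ)) / 2) : ℂ) =
      (if Even a then 1 else -1) * (a.sign : ℂ) := by
  have hu : (Finset.univ : Finset ℤˣ) = {1, -1} := rfl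
  simp only [hu, Finset.sum_pair (show (1 : ℤˣ) ≠ -1 by decide)]
  have hsgn : ∀ b : ℤ, (2 : ℤ) ∣ b → (b - 1).sign + (b + 1).sign = 2 * b.sign := fun b hb => by
    rcases lt_trichotomy b 0 with h | h | h
    · rw [Int.sign_eq_neg_one_of_neg h, Int.sign_eq_neg_one_of_neg (by omega),
        Int.sign_eq_neg_one_of_neg (by omega)]; rfl
    · subst h; rfl
    · rw [Int.sign_eq_one_of_pos h, Int.sign_eq_one_of_pos (by omega),
        Int.sign_eq_one_of_pos (by omega)]; rfl
  by_cases h : Even a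
  · have h1 : Odd (a - 1) := h.sub_odd odd_one
    have h2 : Odd (a + 1) := h.add_odd odd_one
    have h3 : ¬ Odd a := Int.not_odd_iff_even.2 h
    have h4 : (((a - 1).sign : ℂ) + (a + 1).sign) = 2 * a.sign := by
      exact_mod_cast hsgn a h.two_dvd
    norm_num [vertexCoeff, h, h1, h2, h3]
    linear_combination (1 / 2 : ℂ) * h4
  · have h0 : Odd a := Int.not_even_iff_odd.1 h
    have h1 : ¬ Odd (a - 1) := Int.not_odd_iff_even.2 (h0.sub_odd odd_one)
    have h2 : ¬ Odd (a + 1) := Int.not_odd_iff_even.2 (h0.add_odd odd_one)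
    norm_num [vertexCoeff, h, h0, h1, h2]
    ring

/-! ### The principal value as a one-dimensional series -/

theorem norm_vertexCoeff_le {d : ℕ} (hd : d = 1 ∨ d = 2 ∨ d = 3) (m : ℤ) :
    ‖vertexCoeff d m‖ ≤ if d = 3 then |(m : ℝ)| else 2 :=
  le_of_tendsto (tendsto_truncCoeff hd m).norm
    ((eventually_mem_nhdsWithin (a := (0 : ℝ)) (s := Ioi 0)).mono fun _ hε =>
      norm_truncCoeff_le hd hε m)

theorem summable_lattice_terms {K : ℕ} (hK : 1 ≤ K) {τ : ℂ} (hτ : 0 < τ.im) :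
    Summable fun x : Fin (K + 1 + 2) → ℤ =>
      qPow τ (1 / 2 * ((x ⬝ᵥ (cartanD (K + 1)).mulVec x : ℤ) : ℝ)) *
        ∏ j, vertexCoeff ((dynkinD (K + 1)).degree j) ((cartanD (K + 1)).mulVec x j) := by
  refine Summable.of_norm_bounded (summable_norm_qPow_mul_label hK hτ) fun x => ?_
  rw [norm_mul, norm_prod, thetaExponent_cartanD]
  gcongr with j
  exact norm_vertexCoeff_le (degree_dynkinD_mem (by omega) j) _

/-- The terms of the series for `Z`; only those with `N a` even contribute. -/
def seriesTerm (N : ℕ) (τ : ℂ) (a : ℤ) : ℂ :=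
  if Even ((N : ℤ) * a) then
    (if Even a then 1 else -1) * (a.sign : ℂ) * qPow τ (((N * a + 1 : ℝ) ^ 2 - 1) / (2 * N))
  else 0

theorem summable_qPow_sq {N : ℕ} (hN : N ≠ 0) (c r : ℝ) {τ : ℂ} (hτ : 0 < τ.im) :
    Summable fun a : ℤ => ‖qPow τ (((N * a + c : ℝ) ^ 2 - r) / (2 * N))‖ := by
  have hN0 : (0 : ℝ) < N := by positivity
  refine ((summable_exp_sq (c / N) (t := N * τ.im / 2) (by positivity)).mul_left
    (Real.exp (Real.pi * r / N * τ.im))).congr fun a => ?_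
  rw [norm_qPow, ← Real.exp_add]
  congr 1
  field_simp
  ring

theorem norm_intSign_le (a : ℤ) : ‖((a.sign : ℤ) : ℂ)‖ ≤ 1 := by
  rcases Int.sign_trichotomy a with h | h | h <;> rw [h] <;> simp

theorem summable_seriesTerm {N : ℕ} (hN : N ≠ 0) {τ : ℂ} (hτ : 0 < τ.im) :
    Summable (seriesTerm N τ) := by
  refine Summable.of_norm_bounded (summable_qPow_sq hN 1 1 hτ) fun a => ?_
  rw [seriesTerm]
  have h := norm_intSign_le a
  split_ifs
  · rw [norm_mul, norm_mul, norm_one, one_mul]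
    exact mul_le_of_le_one_left (norm_nonneg _) h
  · rw [norm_mul, norm_mul, norm_neg, norm_one, one_mul]
    exact mul_le_of_le_one_left (norm_nonneg _) h
  · simp

theorem ZD_eq_tsum {N : ℕ} (hN : 2 ≤ N) {τ : ℂ} (hτ : 0 < τ.im) :
    ZD N τ = -2 * qPow τ (-(N : ℝ) / 2) * ∑' a : ℤ, seriesTerm N τ a := by
  obtain ⟨L, rfl⟩ : ∃ L, N = L + 1 + 1 := ⟨N - 2, by omega⟩
  have hL : ((L + 1 + 1 : ℕ) : ℤ) = (L : ℤ) + 2 := by push_cast; ring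
  rw [ZD_eq_tsum_lattice (by omega) hτ]
  have hinj := contributingVector_injective L
  have hsum := (summable_lattice_terms (K := L + 1) (by omega) hτ).comp_injective hinj
  -- Only contributing vectors support the sum. For fixed `a` the sign `s₁ = -1` gives the term of
  -- `-a` with `s₁ = 1`; this doubling accounts for the factor `2`.
  rw [← hinj.tsum_eq]
  swap
  · intro x hx
    exact mem_range_contributingVector (right_ne_zero_of_mul hx)
  simp only [Function.comp_def] at hsum
  rw [hsum.tsum_prod]
  have hterm : ∀ a : ℤ, ∑' s : ℤˣ × ℤˣ × ℤˣ,
      qPow τ (1 / 2 * (((fun k : Fin (L + 1 + 1 + 2) => contributingVector L (a, s) k) ⬝ᵥ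
        (cartanD (L + 1 + 1)).mulVec fun k => contributingVector L (a, s) k : ℤ) : ℝ)) *
        ∏ j, vertexCoeff ((dynkinD (L + 1 + 1)).degree j)
          ((cartanD (L + 1 + 1)).mulVec (fun k => contributingVector L (a, s) k) j) =
      -(qPow τ 1 * (seriesTerm (L + 1 + 1) τ a + seriesTerm (L + 1 + 1) τ (-a))) := fun a => by
    rw [tsum_fintype]
    simp only [Fintype.sum_prod_type, prod_vertexCoeff_contributingVector]
    by_cases h : Even (((L : ℤ) + 2) * a)
    · have h' : Even (((L : ℤ) + 2) * -a) := by rw [mul_neg]; exact h.neg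
      simp only [form_contributingVector L a _ _ _ h, if_pos h]
      have hv := sum_vertexCoeff_three a
      have he : ∀ s : ℤˣ, qPow τ (1 / 2 * ((((L : ℤ) + 2) * a ^ 2 + 2 * a * s + 2 : ℤ) : ℝ)) =
          qPow τ 1 * qPow τ ((((L + 1 + 1 : ℕ) * ((s * a : ℤ) : ℝ) + 1 : ℝ) ^ 2 - 1) /
            (2 * (L + 1 + 1 : ℕ))) := fun s => by
        rw [← qPow_add]
        have hs : ((s : ℤ) : ℝ) ^ 2 = 1 := by
          rcases Int.units_eq_one_or s with rfl | rfl <;> norm_num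
        have hL0 : (L : ℝ) + 1 + 1 ≠ 0 := by positivity
        congr 1
        push_cast
        field_simp
        linear_combination (-(L + 1 + 1) ^ 2 * a ^ 2 : ℝ) * hs
      have hS : ∀ s : ℤˣ, ∑ s₂ : ℤˣ, ∑ s₃ : ℤˣ,
          qPow τ (1 / 2 * ((((L : ℤ) + 2) * a ^ 2 + 2 * a * s + 2 : ℤ) : ℝ)) *
            -((s : ℤ) * (s₂ : ℤ) * (s₃ : ℤ) *
              vertexCoeff 3 (a - ((s₂ : ℤ) + (s₃ : ℤ)) / 2) : ℂ) =
          -(qPow τ 1 * ((if Even a then 1 else -1) * ((s * a : ℤ).sign : ℂ) *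
            qPow τ ((((L + 1 + 1 : ℕ) * ((s * a : ℤ) : ℝ) + 1 : ℝ) ^ 2 - 1) /
            (2 * (L + 1 + 1 : ℕ))))) := fun s => by
        have hsa : ((s * a : ℤ).sign : ℂ) = (s : ℤ) * (a.sign : ℂ) := by
          rcases Int.units_eq_one_or s with rfl | rfl <;> simp
        rw [hsa, he]
        have hmul : ∀ (c : ℂ) (f : ℤˣ → ℤˣ → ℂ), ∑ s₂ : ℤˣ, ∑ s₃ : ℤˣ, c * f s₂ s₃ =
            c * ∑ s₂ : ℤˣ, ∑ s₃ : ℤˣ, f s₂ s₃ := fun c f => by simp only [Finset.mul_sum]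
        refine (Finset.sum_congr rfl fun s₂ _ => Finset.sum_congr rfl fun s₃ _ => ?_).trans
          ((hmul (-((s : ℤ) : ℂ) * (qPow τ 1 *
            qPow τ ((((L + 1 + 1 : ℕ) * ((s * a : ℤ) : ℝ) + 1 : ℝ) ^ 2 - 1) /
            (2 * (L + 1 + 1 : ℕ))))) fun s₂ s₃ => ((s₂ : ℤ) * (s₃ : ℤ) *
          vertexCoeff 3 (a - ((s₂ : ℤ) + (s₃ : ℤ)) / 2) : ℂ)).trans ?_)
        · ring
        · rw [hv]; ring
      simp only [hS]
      have hu : (Finset.univ : Finset ℤˣ) = {1, -1} := rfl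
      rw [hu, Finset.sum_pair (show (1 : ℤˣ) ≠ -1 by decide), seriesTerm, seriesTerm, hL, if_pos h,
        if_pos h']
      simp only [even_neg, Units.val_one, one_mul, Units.val_neg, neg_mul]
      push_cast
      ring
    · have h' : ¬ Even (((L : ℤ) + 2) * -a) := by rwa [mul_neg, even_neg]
      simp only [if_neg h]
      rw [seriesTerm, seriesTerm, hL, if_neg h, if_neg h']
      simp
  have hs := summable_seriesTerm (N := L + 1 + 1) (by omega) hτ
  have hs' : Summable fun a => seriesTerm (L + 1 + 1) τ (-a) := hs.comp_injective neg_injective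
  have hneg : ∑' a, seriesTerm (L + 1 + 1) τ (-a) = ∑' a, seriesTerm (L + 1 + 1) τ a :=
    (Equiv.neg ℤ).tsum_eq (seriesTerm (L + 1 + 1) τ)
  rw [tsum_congr hterm, tsum_neg, tsum_mul_left, hs.tsum_add hs', hneg]
  have hq : qPow τ (-((L + 1 : ℕ) + 3 : ℝ) / 2) * qPow τ 1 =
      qPow τ (-((L + 1 + 1 : ℕ) : ℝ) / 2) := by
    rw [← qPow_add]; congr 1; push_cast; ring
  rw [← hq]
  ring

/-! ### The two parts of the series -/

/-- The part of the series for `Z` that belongs to even `a`. -/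
def evenSeries (N : ℕ) (τ : ℂ) : ℂ :=
  ∑' b : ℤ, (b.sign : ℂ) * qPow τ (((2 * N * b + 1 : ℝ) ^ 2 - 1) / (2 * N))

/-- The part of the series for `Z` that belongs to odd `a`, up to sign. -/
def oddSeries (N : ℕ) (τ : ℂ) : ℂ :=
  ∑' b : ℤ, ((2 * b + 1).sign : ℂ) * qPow τ (((2 * N * b + N + 1 : ℝ) ^ 2 - 1) / (2 * N))

theorem tsum_seriesTerm_of_odd {N : ℕ} (hN : Odd N) (τ : ℂ) :
    ∑' a : ℤ, seriesTerm N τ a = evenSeries N τ := by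
  have hinj : Function.Injective fun b : ℤ => 2 * b := fun b c h => by
    have : 2 * b = 2 * c := h
    omega
  rw [← hinj.tsum_eq, evenSeries]
  · refine tsum_congr fun b => ?_
    rw [seriesTerm, if_pos ((even_two_mul b).mul_left _), if_pos (even_two_mul b), one_mul,
      Int.sign_mul, show Int.sign 2 = 1 from rfl, one_mul]
    push_cast
    ring_nf
  · intro a ha
    have h : Even ((N : ℤ) * a) := by
      by_contra h
      exact ha (if_neg h)
    rcases Int.even_mul.1 h with h | h
    · exact absurd ((Int.even_coe_nat N).1 h) (Nat.not_even_iff_odd.2 hN)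
    · obtain ⟨b, hb⟩ := h
      exact ⟨b, by simp; omega⟩

theorem HasSum.int_even_add_odd {f : ℤ → ℂ} {a b : ℂ} (ha : HasSum (fun k => f (2 * k)) a)
    (hb : HasSum (fun k => f (2 * k + 1)) b) : HasSum f (a + b) := by
  have h1 : Function.Injective fun b : ℤ => 2 * b := fun b c h => by
    have : 2 * b = 2 * c := h
    omega
  have h2 : Function.Injective fun b : ℤ => 2 * b + 1 := fun b c h => by
    have : 2 * b + 1 = 2 * c + 1 := h
    omega
  refine HasSum.add_isCompl ?_ (h1.hasSum_range_iff.2 ha) (h2.hasSum_range_iff.2 hb)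
  have hr1 : range (fun b : ℤ => 2 * b) = {n | Even n} := by
    ext n; simp [even_iff_exists_two_mul]
  have hr2 : range (fun b : ℤ => 2 * b + 1) = {n | Odd n} := by
    ext n; simp [Odd]
  rw [hr1, hr2]
  exact Int.isCompl_even_odd

theorem tsum_seriesTerm_of_even {N : ℕ} (hN0 : N ≠ 0) (hN : Even N) {τ : ℂ} (hτ : 0 < τ.im) :
    ∑' a : ℤ, seriesTerm N τ a = evenSeries N τ - oddSeries N τ := by
  have hs := summable_seriesTerm hN0 hτ
  have h1 : Function.Injective fun b : ℤ => 2 * b := fun b c h => by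
    have : 2 * b = 2 * c := h
    omega
  have h2 : Function.Injective fun b : ℤ => 2 * b + 1 := fun b c h => by
    have : 2 * b + 1 = 2 * c + 1 := h
    omega
  have hN' : Even (N : ℤ) := (Int.even_coe_nat N).2 hN
  have h := (HasSum.int_even_add_odd (hs.comp_injective h1).hasSum
    (hs.comp_injective h2).hasSum).tsum_eq
  rw [h, sub_eq_add_neg, evenSeries, oddSeries, ← tsum_neg]
  congr 1
  · refine tsum_congr fun b => ?_
    rw [Function.comp, seriesTerm, if_pos ((even_two_mul b).mul_left _), if_pos (even_two_mul b),
      one_mul, Int.sign_mul, show Int.sign 2 = 1 from rfl, one_mul]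
    push_cast
    ring_nf
  · refine tsum_congr fun b => ?_
    rw [Function.comp, seriesTerm, if_pos (hN'.mul_right _), if_neg (by simp)]
    push_cast
    ring_nf

theorem summable_evenSeries {N : ℕ} (hN : N ≠ 0) {τ : ℂ} (hτ : 0 < τ.im) :
    Summable fun b : ℤ => (b.sign : ℂ) * qPow τ (((2 * N * b + 1 : ℝ) ^ 2 - 1) / (2 * N)) := by
  have h := (summable_qPow_sq hN 1 1 hτ).comp_injective (i := fun b : ℤ => 2 * b) fun b c h => by
    have : 2 * b = 2 * c := h
    omega
  refine Summable.of_norm_bounded h fun b => ?_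
  rw [norm_mul]
  refine (mul_le_of_le_one_left (norm_nonneg _) (norm_intSign_le b)).trans (le_of_eq ?_)
  simp only [Function.comp]
  push_cast
  ring_nf

theorem summable_sgnTerm {N : ℕ} (hN : N ≠ 0) {τ : ℂ} (hτ : 0 < τ.im) :
    Summable fun m : ℤ => sgnTerm N τ m := by
  have hN0 : (0 : ℝ) < N := by positivity
  refine Summable.of_norm_bounded ((summable_exp_sq 0 (t := τ.im / (2 * N))
    (by positivity)).mul_left (Real.exp (Real.pi / N * τ.im))) fun m => ?_
  rw [sgnTerm, norm_mul, norm_qPow, ← Real.exp_add]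
  refine (mul_le_of_le_one_left (Real.exp_pos _).le (norm_intSign_le m)).trans (le_of_eq ?_)
  congr 1
  field_simp
  ring

theorem summable_falseThetaTerm (j p : ℤ) {τ : ℂ} (hτ : 0 < τ.im) :
    Summable fun m : ℤ => falseThetaTerm j p τ m := by
  refine Summable.of_norm_bounded (summable_exp_sq (j / (2 * p)) hτ) fun m => ?_
  rw [falseThetaTerm, norm_mul, norm_qPow]
  refine mul_le_of_le_one_left (Real.exp_pos _).le ?_
  rw [sgnStar]
  split_ifs
  · simp
  · exact norm_intSign_le m

/-! ### Sums over residue classes -/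

/-- The integers of a residue class are indexed by `ℤ`. -/
def residueClassEquiv (r : ℤ) {n : ℤ} (hn : n ≠ 0) : ℤ ≃ {m : ℤ // m ≡ r [ZMOD n]} :=
  Equiv.ofBijective (fun b => ⟨n * b + r, by simp [Int.ModEq]⟩) ⟨fun b c h => by
    have : n * b + r = n * c + r := congrArg Subtype.val h
    exact mul_left_cancel₀ hn (by linarith), fun ⟨m, hm⟩ => by
    obtain ⟨b, hb⟩ := hm.symm.dvd
    exact ⟨b, Subtype.ext (by simp only; linarith)⟩⟩

theorem sgnSum_eq_tsum {N : ℕ} (hN : N ≠ 0) (r : ℤ) (τ : ℂ) :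
    sgnSum N r τ = ∑' b : ℤ, sgnTerm N τ (2 * N * b + r) :=
  ((residueClassEquiv r (n := 2 * (N : ℤ)) (by omega)).tsum_eq
    fun m : {m : ℤ // m ≡ r [ZMOD 2 * (N : ℤ)]} => sgnTerm N τ m).symm

theorem sign_mul_add_of_lt {n b r : ℤ} (h1 : 0 < r) (h2 : r < n) :
    (n * b + r).sign = if 0 ≤ b then 1 else -1 := by
  split_ifs with h
  · exact Int.sign_eq_one_of_pos (by nlinarith)
  · exact Int.sign_eq_neg_one_of_neg (by nlinarith)

/-- The signs of `b` and of `2Nb + 1` differ only at `b = 0`, where the monomial is `q⁰ = 1`. -/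
theorem sgnSum_one {N : ℕ} (hN : N ≠ 0) {τ : ℂ} (hτ : 0 < τ.im) :
    sgnSum N 1 τ = evenSeries N τ + 1 := by
  rw [sgnSum_eq_tsum hN, evenSeries, ← tsum_ite_eq (0 : ℤ) (fun _ => (1 : ℂ)),
    ← (summable_evenSeries hN hτ).tsum_add (hasSum_ite_eq (0 : ℤ) (1 : ℂ)).summable]
  refine tsum_congr fun b => ?_
  rw [sgnTerm, sign_mul_add_of_lt one_pos (by omega)]
  push_cast
  rcases lt_trichotomy b 0 with h | h | h
  · rw [if_neg (not_le.2 h), if_neg h.ne, Int.sign_eq_neg_one_of_neg h, add_zero]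
    simp
  · subst h
    simp [qPow_zero]
  · rw [if_pos h.le, if_neg h.ne', Int.sign_eq_one_of_pos h, add_zero]
    simp

/-- The substitution `b ↦ -1 - b` turns `2Nb + N - 1` into `-(2Nb + N + 1)`: the square is unchanged
and the sign is reversed. -/
theorem sgnSum_sub_one {N : ℕ} (hN : 2 ≤ N) (τ : ℂ) :
    sgnSum N (N - 1) τ = -oddSeries N τ := by
  rw [sgnSum_eq_tsum (by omega), oddSeries, ← tsum_neg, ← (Equiv.subLeft (-1 : ℤ)).tsum_eq]
  refine tsum_congr fun b => ?_
  rw [Equiv.subLeft_apply, sgnTerm, sign_mul_add_of_lt (by omega) (by omega),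
    sign_mul_add_of_lt one_pos (by omega)]
  rw [← neg_mul]
  congr 1
  · split_ifs <;> first | omega | simp
  · congr 2
    push_cast
    ring

/-! ### False theta functions -/

theorem qPow_mul_natCast (N : ℕ) (τ : ℂ) (r : ℝ) :
    qPow (2 * N * τ) r = qPow τ (2 * N * r) := by
  rw [qPow, qPow]; push_cast; ring_nf

theorem qPow_scaled_sq {N : ℕ} (hN : N ≠ 0) (τ : ℂ) (x : ℝ) :
    qPow (2 * N * τ) (x ^ 2) =
      qPow τ (1 / (2 * N)) * qPow τ (((2 * N * x) ^ 2 - 1) / (2 * N)) := by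
  have hN0 : (N : ℝ) ≠ 0 := by positivity
  rw [qPow_mul_natCast, ← qPow_add]
  congr 1
  field_simp
  ring

theorem scaled_im_pos {N : ℕ} (hN : N ≠ 0) {τ : ℂ} (hτ : 0 < τ.im) : 0 < (2 * N * τ : ℂ).im := by
  have hN0 : (0 : ℝ) < N := by positivity
  rw [show (2 * N * τ : ℂ) = ((2 * N : ℝ) : ℂ) * τ by push_cast; ring, Complex.im_ofReal_mul]
  positivity

/-- After `b ↦ -b` in the first series and `b ↦ -1 - b` in the second, both exponents are `(b +
1/(2N))²`. The modified signs add up to `-2 sgn b`; at `b = 0` they cancel precisely because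
`sgn*(0) = 1`. -/
theorem falseTheta_add_falseTheta {N : ℕ} (hN : N ≠ 0) {τ : ℂ} (hτ : 0 < τ.im) :
    falseTheta (-1) N (2 * N * τ) + falseTheta (2 * N - 1) N (2 * N * τ) =
      -2 * qPow τ (1 / (2 * N)) * evenSeries N τ := by
  have hN0 : (N : ℝ) ≠ 0 := by positivity
  have hT := scaled_im_pos hN hτ
  have s1 := (Equiv.neg ℤ).summable_iff.2 (summable_falseThetaTerm (-1) N hT)
  have s2 := (Equiv.subLeft (-1 : ℤ)).summable_iff.2 (summable_falseThetaTerm (2 * N - 1) N hT)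
  rw [falseTheta, falseTheta, ← (Equiv.neg ℤ).tsum_eq, ← (Equiv.subLeft (-1 : ℤ)).tsum_eq
    (falseThetaTerm (2 * N - 1) N (2 * N * τ)), evenSeries, ← tsum_mul_left]
  refine (Summable.tsum_add s1 s2).symm.trans (tsum_congr fun b => ?_)
  simp only [Function.comp, Equiv.neg_apply, Equiv.subLeft_apply, falseThetaTerm]
  have e1 : (((-b : ℤ) : ℝ) + ((-1 : ℤ) : ℝ) / (2 * ((N : ℤ) : ℝ))) ^ 2 =
      ((b : ℝ) + 1 / (2 * N)) ^ 2 := by push_cast; field_simp; ring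
  have e2 : (((-1 - b : ℤ) : ℝ) + ((2 * N - 1 : ℤ) : ℝ) / (2 * ((N : ℤ) : ℝ))) ^ 2 =
      ((b : ℝ) + 1 / (2 * N)) ^ 2 := by push_cast; field_simp; ring
  have e3 : 2 * N * ((b : ℝ) + 1 / (2 * N)) = 2 * N * b + 1 := by field_simp
  have e4 : sgnStar (-b) + sgnStar (-1 - b) = -2 * b.sign := by
    rcases lt_trichotomy b 0 with h | h | h
    · rw [Int.sign_eq_neg_one_of_neg h, sgnStar, sgnStar, if_neg (by omega),
        Int.sign_eq_one_of_pos (by omega)]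
      split_ifs with h1
      · rfl
      · rw [Int.sign_eq_one_of_pos (by omega)]; rfl
    · subst h; rfl
    · rw [Int.sign_eq_one_of_pos h, sgnStar, sgnStar, if_neg (by omega), if_neg (by omega),
        Int.sign_eq_neg_one_of_neg (by omega), Int.sign_eq_neg_one_of_neg (by omega)]; rfl
  have e5 : ((sgnStar (-b) : ℤ) : ℂ) + (sgnStar (-1 - b) : ℤ) = -2 * (b.sign : ℂ) := by
    exact_mod_cast e4
  rw [e1, e2, qPow_scaled_sq hN, e3]
  linear_combination (qPow τ (1 / (2 * N)) * qPow τ (((2 * N * b + 1 : ℝ) ^ 2 - 1) / (2 * N))) * e5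

theorem falseTheta_add_one {N : ℕ} (hN : N ≠ 0) (τ : ℂ) :
    falseTheta (N + 1) N (2 * N * τ) = qPow τ (1 / (2 * N)) * oddSeries N τ := by
  have hN0 : (N : ℝ) ≠ 0 := by positivity
  rw [falseTheta, oddSeries, ← tsum_mul_left]
  refine tsum_congr fun b => ?_
  have e3 : 2 * N * ((b : ℝ) + ((N + 1 : ℤ) : ℝ) / (2 * ((N : ℤ) : ℝ))) = 2 * N * b + N + 1 := by
    push_cast; field_simp
    ring
  have e4 : sgnStar b = (2 * b + 1).sign := by
    rw [sign_mul_add_of_lt one_pos (by norm_num), sgnStar]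
    split_ifs with h1 h2 h2
    · rfl
    · omega
    · exact Int.sign_eq_one_of_pos (by omega)
    · exact Int.sign_eq_neg_one_of_neg (by omega)
  rw [falseThetaTerm, qPow_scaled_sq hN, e3, e4]
  ring

theorem signedTheta_one {N : ℕ} (hN : N ≠ 0) {τ : ℂ} (hτ : 0 < τ.im) :
    signedTheta (1 / (2 * N)) (2 * N * τ) = qPow τ (1 / (2 * N)) * (evenSeries N τ + 1) := by
  have hN0 : (0 : ℝ) < N := by positivity
  have hN1 : (1 : ℝ) ≤ N := by exact_mod_cast Nat.one_le_iff_ne_zero.2 hN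
  rw [← sgnSum_one hN hτ, sgnSum_eq_tsum hN, signedTheta, ← tsum_mul_left]
  refine tsum_congr fun b => ?_
  have e3 : 2 * N * ((b : ℝ) + 1 / (2 * N)) = 2 * N * b + 1 := by field_simp
  have hu : 0 < (1 : ℝ) / (2 * N) := by positivity
  have hu1 : (1 : ℝ) / (2 * N) < 1 := by rw [div_lt_one (by positivity)]; linarith
  have e4 : ((Real.sign (b + 1 / (2 * N)) : ℝ) : ℂ) = (((2 * N * b + 1 : ℤ).sign : ℤ) : ℂ) := by
    rw [sign_mul_add_of_lt one_pos (by omega)]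
    split_ifs with h
    · have : (0 : ℝ) ≤ b := by exact_mod_cast h
      rw [Real.sign_of_pos (by linarith)]; simp
    · have : (b : ℝ) ≤ -1 := by exact_mod_cast (by omega : b ≤ -1)
      rw [Real.sign_of_neg (by linarith)]; simp
  rw [qPow_scaled_sq hN, e3, e4, sgnTerm]
  push_cast
  ring

theorem signedTheta_add_one {N : ℕ} (hN : 2 ≤ N) (τ : ℂ) :
    signedTheta ((N + 1) / (2 * N)) (2 * N * τ) = qPow τ (1 / (2 * N)) * oddSeries N τ := by
  have hN0 : (0 : ℝ) < N := by positivity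
  have hN1 : (2 : ℝ) ≤ N := by exact_mod_cast hN
  rw [signedTheta, oddSeries, ← tsum_mul_left]
  refine tsum_congr fun b => ?_
  have e3 : 2 * N * ((b : ℝ) + (N + 1) / (2 * N)) = 2 * N * b + N + 1 := by field_simp; ring
  have hu : 0 < ((N : ℝ) + 1) / (2 * N) := by positivity
  have hu1 : ((N : ℝ) + 1) / (2 * N) < 1 := by rw [div_lt_one (by positivity)]; linarith
  have e4 : ((Real.sign (b + (N + 1) / (2 * N)) : ℝ) : ℂ) = (((2 * b + 1 : ℤ).sign : ℤ) : ℂ) := by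
    rw [sign_mul_add_of_lt one_pos (by norm_num)]
    split_ifs with h
    · have : (0 : ℝ) ≤ b := by exact_mod_cast h
      rw [Real.sign_of_pos (by linarith)]; simp
    · have : (b : ℝ) ≤ -1 := by exact_mod_cast (by omega : b ≤ -1)
      rw [Real.sign_of_neg (by linarith)]; simp
  rw [qPow_scaled_sq (by omega), e3, e4]
  ring

/-! ### Differences of the Gaussian -/

/-- The Gaussian `exp (-σ x²)` and its first four derivatives. -/
def gaussJet (σ : ℝ) : ℕ → ℝ → ℝ
  | 0, x => Real.exp (-σ * x ^ 2)
  | 1, x => -2 * σ * x * Real.exp (-σ * x ^ 2)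
  | 2, x => (4 * σ ^ 2 * x ^ 2 - 2 * σ) * Real.exp (-σ * x ^ 2)
  | 3, x => (12 * σ ^ 2 * x - 8 * σ ^ 3 * x ^ 3) * Real.exp (-σ * x ^ 2)
  | _, x => (12 * σ ^ 2 - 48 * σ ^ 3 * x ^ 2 + 16 * σ ^ 4 * x ^ 4) * Real.exp (-σ * x ^ 2)

theorem hasDerivAt_gaussJet (σ : ℝ) {i : ℕ} (hi : i < 4) (x : ℝ) :
    HasDerivAt (gaussJet σ i) (gaussJet σ (i + 1) x) x := by
  have hx : HasDerivAt (fun x : ℝ => x) 1 x := hasDerivAt_id x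
  have h0 : HasDerivAt (fun x : ℝ => Real.exp (-σ * x ^ 2))
      (Real.exp (-σ * x ^ 2) * (-σ * (2 * x))) x := by
    refine (((hx.pow 2).const_mul (-σ)).exp).congr_deriv ?_
    simp
  interval_cases i
  · refine h0.congr_deriv ?_
    simp only [gaussJet]; ring
  · refine ((hx.const_mul (-2 * σ)).mul h0).congr_deriv ?_
    simp only [gaussJet]; ring
  · refine ((((hx.pow 2).const_mul (4 * σ ^ 2)).sub_const (2 * σ)).mul h0).congr_deriv ?_
    simp [gaussJet]; ring
  · refine (((hx.const_mul (12 * σ ^ 2)).sub ((hx.pow 3).const_mul (8 * σ ^ 3))).mul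
      h0).congr_deriv ?_
    simp [gaussJet]; ring

theorem pow_mul_exp_neg_le {s : ℝ} (hs : 0 ≤ s) (n : ℕ) :
    s ^ n * Real.exp (-s) ≤ n.factorial := by
  have h := Real.pow_div_factorial_le_exp s hs n
  rw [div_le_iff₀ (by positivity)] at h
  rw [Real.exp_neg, ← div_eq_mul_inv, div_le_iff₀ (Real.exp_pos _)]
  linarith

theorem abs_gaussJet_two_le {σ : ℝ} (h0 : 0 < σ) (h1 : σ ≤ 1) (x : ℝ) :
    |gaussJet σ 2 x| ≤ 16 / (1 + x ^ 2) := by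
  set s := σ * x ^ 2 with hs
  have hs0 : 0 ≤ s := by positivity
  have he := Real.exp_pos (-s)
  have b0 := pow_mul_exp_neg_le hs0 0
  have b1 := pow_mul_exp_neg_le hs0 1
  have b2 := pow_mul_exp_neg_le hs0 2
  simp only [Nat.factorial, pow_zero, one_mul, pow_one] at b0 b1 b2
  push_cast at b0 b1 b2
  have hg : gaussJet σ 2 x = σ * ((4 * s - 2) * Real.exp (-s)) := by
    simp only [gaussJet, hs]; ring_nf
  have ha : |4 * s - 2| ≤ 4 * s + 2 := by
    rw [abs_le]; constructor <;> linarith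
  rw [hg, abs_mul, abs_mul, abs_of_pos h0, abs_of_pos he, le_div_iff₀ (by positivity)]
  calc σ * (|4 * s - 2| * Real.exp (-s)) * (1 + x ^ 2)
      ≤ σ * ((4 * s + 2) * Real.exp (-s)) * (1 + x ^ 2) := by gcongr
    _ = σ * (4 * (s * Real.exp (-s)) + 2 * Real.exp (-s)) +
        (4 * (s ^ 2 * Real.exp (-s)) + 2 * (s * Real.exp (-s))) := by rw [hs]; ring
    _ ≤ 1 * 6 + 10 := by
        refine add_le_add (mul_le_mul h1 ?_ (by positivity) zero_le_one) ?_
        · linarith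
        · linarith
    _ = 16 := by norm_num

/-- In terms of `s = σ x²` the fourth derivative is `σ²` times a polynomial in `s` times `exp (-s)`.
One factor `σ` is spent on the decay in `x`; the other survives the later division by `σ`. -/
theorem abs_gaussJet_four_le {σ : ℝ} (h0 : 0 < σ) (h1 : σ ≤ 1) (x : ℝ) :
    |gaussJet σ 4 x| ≤ 296 * σ / (1 + x ^ 2) := by
  set s := σ * x ^ 2 with hs
  have hs0 : 0 ≤ s := by positivity
  have he := Real.exp_pos (-s)
  have b0 := pow_mul_exp_neg_le hs0 0
  have b1 := pow_mul_exp_neg_le hs0 1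
  have b2 := pow_mul_exp_neg_le hs0 2
  have b3 := pow_mul_exp_neg_le hs0 3
  simp only [Nat.factorial, pow_zero, one_mul, pow_one] at b0 b1 b2 b3
  push_cast at b0 b1 b2 b3
  have hg : gaussJet σ 4 x = σ ^ 2 * ((12 - 48 * s + 16 * s ^ 2) * Real.exp (-s)) := by
    simp only [gaussJet, hs]; ring_nf
  have ha : |12 - 48 * s + 16 * s ^ 2| ≤ 12 + 48 * s + 16 * s ^ 2 := by
    rw [abs_le]; constructor <;> nlinarith
  rw [hg, abs_mul, abs_mul, abs_of_pos (pow_pos h0 2), abs_of_pos he, le_div_iff₀ (by positivity)]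
  calc σ ^ 2 * (|12 - 48 * s + 16 * s ^ 2| * Real.exp (-s)) * (1 + x ^ 2)
      ≤ σ ^ 2 * ((12 + 48 * s + 16 * s ^ 2) * Real.exp (-s)) * (1 + x ^ 2) := by gcongr
    _ = σ * (σ * (12 * Real.exp (-s) + 48 * (s * Real.exp (-s)) + 16 * (s ^ 2 * Real.exp (-s))) +
        (12 * (s * Real.exp (-s)) + 48 * (s ^ 2 * Real.exp (-s)) +
          16 * (s ^ 3 * Real.exp (-s)))) := by rw [hs]; ring
    _ ≤ σ * (1 * 92 + 204) := by
        refine mul_le_mul_of_nonneg_left (add_le_add (mul_le_mul h1 ?_ (by positivity)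
          zero_le_one) ?_) h0.le <;> linarith
    _ = 296 * σ := by ring

theorem abs_shift_sub_le {f f' : ℝ → ℝ} {p q M x δ : ℝ} (hf : ∀ y, HasDerivAt f (f' y) y)
    (hM : ∀ y ∈ Icc p q, |f' y| ≤ M) (hx : x ∈ Icc p q) (hx' : x + δ ∈ Icc p q) :
    |f (x + δ) - f x| ≤ M * |δ| := by
  have := (convex_Icc p q).norm_image_sub_le_of_norm_hasDerivWithin_le
    (fun y _ => (hf y).hasDerivWithinAt) hM hx hx'
  simpa using this

/-- The difference `h(x - u) - h(x + u)` of the Gaussian and its derivatives. -/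
def gaussDiff (σ u : ℝ) (i : ℕ) (x : ℝ) : ℝ := gaussJet σ i (x - u) - gaussJet σ i (x + u)

theorem hasDerivAt_gaussDiff (σ u : ℝ) {i : ℕ} (hi : i < 4) (x : ℝ) :
    HasDerivAt (gaussDiff σ u i) (gaussDiff σ u (i + 1) x) x :=
  ((hasDerivAt_gaussJet σ hi (x - u)).comp_sub_const x u).sub
    ((hasDerivAt_gaussJet σ hi (x + u)).comp_add_const x u)

/-- The third difference with step `1/2`. -/
def thirdDiff (f : ℝ → ℝ) (x : ℝ) : ℝ :=
  f (x + 3 / 2) - 3 * f (x + 1) + 3 * f (x + 1 / 2) - f x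

/-- The mean value theorem is used four times: once for the symmetric difference of width `2u ≤
1/2`, and three times for the step `1/2`. Every step length is at most `1`, so the bound `M`
persists. -/
theorem abs_thirdDiff_gaussDiff_le {σ u M x : ℝ} (hu0 : 0 ≤ u) (hu : u ≤ 1 / 4)
    (hM : ∀ y ∈ Icc (x - 1) (x + 2), |gaussJet σ 4 y| ≤ M) :
    |thirdDiff (gaussDiff σ u 0) x| ≤ M := by
  have hM0 : 0 ≤ M := (abs_nonneg _).trans (hM x ⟨by linarith, by linarith⟩)
  set D : (ℝ → ℝ) → ℝ → ℝ := fun f y => f (y + 1 / 2) - f y with hD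
  have hder : ∀ f f' : ℝ → ℝ, (∀ y, HasDerivAt f (f' y) y) → ∀ y, HasDerivAt (D f) (D f' y) y :=
    fun f f' hf y => ((hf (y + 1 / 2)).comp_add_const y (1 / 2)).sub (hf y)
  have h3 : ∀ y ∈ Icc x (x + 3 / 2), |gaussDiff σ u 3 y| ≤ M := fun y hy => by
    have := abs_shift_sub_le (x := y + u) (δ := -2 * u)
      (hasDerivAt_gaussJet σ (i := 3) (by norm_num)) hM
      ⟨by linarith [hy.1], by linarith [hy.2]⟩ ⟨by linarith [hy.1], by linarith [hy.2]⟩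
    rw [show y + u + -2 * u = y - u by ring] at this
    refine this.trans (mul_le_of_le_one_right hM0 ?_)
    rw [abs_le]; constructor <;> linarith
  have hstep : ∀ (f f' : ℝ → ℝ) (b : ℝ), (∀ y, HasDerivAt f (f' y) y) →
      (∀ y ∈ Icc x (x + b + 1 / 2), |f' y| ≤ M) → ∀ y ∈ Icc x (x + b), |D f y| ≤ M :=
    fun f f' b hf hb y hy => by
      have := abs_shift_sub_le (x := y) (δ := 1 / 2) hf hb ⟨hy.1, by linarith [hy.2]⟩
        ⟨by linarith [hy.1], by linarith [hy.2]⟩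
      refine this.trans (mul_le_of_le_one_right hM0 ?_)
      norm_num [abs_of_pos]
  have h2 := hstep _ _ 1 (hasDerivAt_gaussDiff σ u (i := 2) (by norm_num)) fun y hy =>
    h3 y ⟨hy.1, by linarith [hy.2]⟩
  have h1 := hstep _ _ (1 / 2) (hder _ _ (hasDerivAt_gaussDiff σ u (i := 1) (by norm_num)))
    fun y hy => h2 y ⟨hy.1, by linarith [hy.2]⟩
  have h0 := hstep _ _ 0 (hder _ _ (hder _ _ (hasDerivAt_gaussDiff σ u (i := 0) (by norm_num))))
    (fun y hy => h1 y ⟨hy.1, by linarith [hy.2]⟩) x ⟨le_rfl, by linarith⟩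
  convert h0 using 2
  simp only [thirdDiff, hD]
  rw [show x + 1 / 2 + 1 / 2 = x + 1 by ring, show x + 1 + 1 / 2 = x + 3 / 2 by ring]
  ring

/-- After subtraction of its linear part in `v`, the difference `h(x - v) - h(x + v)` is controlled
by second derivatives. These linear parts cancel in the combination of the steps `u` and `1/2`. -/
theorem abs_gaussDiff_sub_le {σ u M x : ℝ} (hu0 : 0 ≤ u) (hu : u ≤ 1 / 4)
    (hM : ∀ y ∈ Icc (x - 1) (x + 2), |gaussJet σ 2 y| ≤ M) :
    |gaussDiff σ u 0 x - 2 * u * gaussDiff σ (1 / 2) 0 x| ≤ M := by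
  have hM0 : 0 ≤ M := (abs_nonneg _).trans (hM x ⟨by linarith, by linarith⟩)
  set B : ℝ → ℝ := fun v => gaussDiff σ v 0 x + 2 * v * gaussJet σ 1 x with hB
  have hder : ∀ v, HasDerivAt B (-gaussJet σ 1 (x - v) - gaussJet σ 1 (x + v) +
      2 * gaussJet σ 1 x) v := fun v => by
    have h := (((hasDerivAt_gaussJet σ (i := 0) (by norm_num) (x - v)).comp_const_sub x v).sub
      ((hasDerivAt_gaussJet σ (i := 0) (by norm_num) (x + v)).comp_const_add x v)).add
      (((hasDerivAt_id v).const_mul 2).mul_const (gaussJet σ 1 x))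
    refine h.congr_deriv ?_
    ring
  have hb : ∀ v ∈ Icc (0 : ℝ) (1 / 2), |-gaussJet σ 1 (x - v) - gaussJet σ 1 (x + v) +
      2 * gaussJet σ 1 x| ≤ M := fun v hv => by
    have h1 := abs_shift_sub_le (x := x) (δ := v) (hasDerivAt_gaussJet σ (i := 1) (by norm_num)) hM
      ⟨by linarith, by linarith⟩ ⟨by linarith [hv.1], by linarith [hv.2]⟩
    have h2 := abs_shift_sub_le (x := x) (δ := -v) (hasDerivAt_gaussJet σ (i := 1) (by norm_num)) hM
      ⟨by linarith, by linarith⟩ ⟨by linarith [hv.2], by linarith [hv.1]⟩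
    rw [abs_neg, abs_of_nonneg hv.1, ← sub_eq_add_neg] at h2
    rw [abs_of_nonneg hv.1] at h1
    have h3 : M * v ≤ M * (1 / 2) := mul_le_mul_of_nonneg_left hv.2 hM0
    rw [abs_le] at h1 h2 ⊢
    constructor <;> linarith [h1.1, h1.2, h2.1, h2.2]
  have hB0 : B 0 = 0 := by simp [hB, gaussDiff]
  have hBv : ∀ v ∈ Icc (0 : ℝ) (1 / 2), |B v| ≤ M * v := fun v hv => by
    have := abs_shift_sub_le (x := 0) (δ := v) hder hb ⟨le_rfl, by norm_num⟩ (by simpa using hv)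
    rwa [zero_add, hB0, sub_zero, abs_of_nonneg hv.1] at this
  have h1 := hBv u ⟨hu0, by linarith⟩
  have h2 := hBv (1 / 2) ⟨by norm_num, le_rfl⟩
  have h3 : gaussDiff σ u 0 x - 2 * u * gaussDiff σ (1 / 2) 0 x = B u - 2 * u * B (1 / 2) := by
    simp only [hB]; ring
  rw [h3]
  refine (abs_sub _ _).trans ?_
  rw [abs_mul, abs_of_nonneg (by positivity : 0 ≤ 2 * u)]
  nlinarith

theorem one_add_sq_le {x y : ℝ} (hx : 0 ≤ x) (hy : y ∈ Icc (x - 1) (x + 2)) :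
    1 / (1 + y ^ 2) ≤ 3 * (1 / (1 + x ^ 2)) := by
  rw [div_le_iff₀ (by positivity), mul_one_div, div_mul_eq_mul_div, le_div_iff₀ (by positivity)]
  nlinarith [hy.1, hy.2, sq_nonneg (y - 1), sq_nonneg (x - y), sq_nonneg (x - 2 * y)]

theorem summable_one_div_one_add_sq : Summable fun n : ℕ => 1 / (1 + (n : ℝ) ^ 2) := by
  rw [← summable_nat_add_iff 1]
  refine Summable.of_nonneg_of_le (fun n => by positivity) (fun n => ?_)
    ((summable_nat_add_iff 1).2 (Real.summable_one_div_nat_pow.2 (by norm_num : 1 < 2)))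
  exact one_div_le_one_div_of_le (by positivity) (by linarith)

theorem summable_gaussJet_zero {σ : ℝ} (hσ : 0 < σ) (c : ℝ) :
    Summable fun n : ℕ => gaussJet σ 0 (n + c) := by
  have h := (summable_exp_sq c (t := σ / (2 * Real.pi)) (by positivity)).comp_injective
    Nat.cast_injective
  refine h.congr fun n => ?_
  simp only [Function.comp, gaussJet]
  congr 1
  push_cast
  field_simp

theorem summable_gaussDiff_zero {σ : ℝ} (hσ : 0 < σ) (u c : ℝ) :
    Summable fun n : ℕ => gaussDiff σ u 0 (n + c) := by
  refine ((summable_gaussJet_zero hσ (c - u)).sub (summable_gaussJet_zero hσ (c + u))).congr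
    fun n => ?_
  rw [gaussDiff]
  ring_nf

theorem tendsto_gaussJet_zero (x : ℝ) :
    Tendsto (fun σ => gaussJet σ 0 x) (𝓝[>] 0) (𝓝 1) := by
  have : Continuous fun σ : ℝ => gaussJet σ 0 x := by unfold gaussJet; fun_prop
  have h := (this.tendsto 0).mono_left (nhdsWithin_le_nhds (s := Ioi 0))
  simpa [gaussJet] using h

theorem tendsto_gaussDiff_zero (u x : ℝ) :
    Tendsto (fun σ => gaussDiff σ u 0 x) (𝓝[>] 0) (𝓝 0) := by
  simpa [gaussDiff] using (tendsto_gaussJet_zero (x - u)).sub (tendsto_gaussJet_zero (x + u))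

theorem tendsto_gaussDiff_zero_div (u x : ℝ) :
    Tendsto (fun σ => gaussDiff σ u 0 x / σ) (𝓝[>] 0) (𝓝 (4 * u * x)) := by
  have hd : HasDerivAt (fun σ : ℝ => gaussDiff σ u 0 x) (4 * u * x) 0 := by
    have h1 : ∀ c : ℝ, HasDerivAt (fun σ : ℝ => Real.exp (-σ * c)) (-c) 0 := fun c => by
      refine (((hasDerivAt_id (0 : ℝ)).neg.mul_const c).exp).congr_deriv ?_
      simp
    refine ((h1 ((x - u) ^ 2)).sub (h1 ((x + u) ^ 2))).congr_deriv ?_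
    ring
  have h := hd.tendsto_slope.mono_left (nhdsWithin_mono (0 : ℝ) fun σ (hσ : 0 < σ) => hσ.ne')
  refine h.congr fun σ => ?_
  simp [slope, gaussDiff, gaussJet, div_eq_inv_mul]

theorem eventually_Ioc : ∀ᶠ σ : ℝ in 𝓝[>] 0, 0 < σ ∧ σ ≤ 1 := by
  filter_upwards [self_mem_nhdsWithin, nhdsWithin_le_nhds (eventually_le_nhds one_pos)]
    with σ h1 h2 using ⟨h1, h2⟩

/-- For `u = 1/2` the sum telescopes to `h(1/2)`, which tends to `1`. The general sum differs from
`2u` times this one by a series that tends to zero termwise and is dominated by a multiple of `1/(1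
+ x²)`. -/
theorem tendsto_tsum_gaussDiff {u : ℝ} (hu0 : 0 ≤ u) (hu : u ≤ 1 / 4) :
    Tendsto (fun σ => ∑' n : ℕ, gaussDiff σ u 0 (n + 1)) (𝓝[>] 0) (𝓝 (2 * u)) := by
  have htel : ∀ σ : ℝ, 0 < σ → ∑' n : ℕ, gaussDiff σ (1 / 2) 0 (n + 1) = gaussJet σ 0 (1 / 2) :=
    fun σ hσ => by
    have h1 := summable_gaussJet_zero hσ (1 / 2)
    have h2 := summable_gaussJet_zero hσ (3 / 2)
    have h3 := h1.tsum_eq_zero_add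
    have h4 : ∀ n : ℕ, gaussDiff σ (1 / 2) 0 (n + 1) =
        gaussJet σ 0 (n + 1 / 2) - gaussJet σ 0 (n + 3 / 2) := fun n => by
      rw [gaussDiff]; ring_nf
    rw [tsum_congr h4, h1.tsum_sub h2, h3]
    have h5 : ∀ n : ℕ, gaussJet σ 0 ((n + 1 : ℕ) + 1 / 2) = gaussJet σ 0 (n + 3 / 2) := fun n => by
      push_cast; ring_nf
    rw [tsum_congr h5]
    simp
  have hd : Tendsto (fun σ => ∑' n : ℕ, (gaussDiff σ u 0 (n + 1) -
      2 * u * gaussDiff σ (1 / 2) 0 (n + 1))) (𝓝[>] 0) (𝓝 (∑' _ : ℕ, (0 : ℝ))) := by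
    refine tendsto_tsum_of_dominated_convergence
      (((summable_nat_add_iff 1).2 summable_one_div_one_add_sq).mul_left 48) (fun n => ?_) ?_
    · simpa using (tendsto_gaussDiff_zero u (n + 1)).sub
        ((tendsto_gaussDiff_zero (1 / 2) (n + 1)).const_mul (2 * u))
    · filter_upwards [eventually_Ioc] with σ hσ n
      rw [Real.norm_eq_abs]
      refine abs_gaussDiff_sub_le hu0 hu fun y hy => (abs_gaussJet_two_le hσ.1 hσ.2 y).trans ?_
      have := one_add_sq_le (by positivity : (0 : ℝ) ≤ n + 1) hy
      push_cast
      rw [← mul_one_div]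
      linarith
  rw [tsum_zero] at hd
  have h := hd.add ((tendsto_gaussJet_zero (1 / 2)).const_mul (2 * u))
  rw [zero_add, mul_one] at h
  refine h.congr' ?_
  filter_upwards [self_mem_nhdsWithin] with σ hσ
  rw [(summable_gaussDiff_zero hσ u 1).tsum_sub
    ((summable_gaussDiff_zero hσ (1 / 2) 1).mul_left (2 * u)), tsum_mul_left, htel σ hσ]
  ring

/-- Write `g` for the difference function, and `S₁`, `S_{1/2}` for its sums at positive integers and
half-integers. Since `g(0) = 0`, the third differences sum to `4 (S_{1/2} - S₁) - g(1/2)`. Divided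
by `σ`, they tend to zero termwise, because `g(x)/σ` becomes the linear function `4ux`, and the
fourth derivative supplies the domination. What remains is `-g(1/2)/(4σ)`, with limit `-u/2`. -/
theorem tendsto_alternating_tsum_gaussDiff {u : ℝ} (hu0 : 0 ≤ u) (hu : u ≤ 1 / 4) :
    Tendsto (fun σ => (∑' n : ℕ, gaussDiff σ u 0 (n + 1) -
      ∑' n : ℕ, gaussDiff σ u 0 (n + 1 / 2)) / σ) (𝓝[>] 0) (𝓝 (-u / 2)) := by
  have hd : Tendsto (fun σ => ∑' n : ℕ, thirdDiff (gaussDiff σ u 0) n / σ) (𝓝[>] 0)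
      (𝓝 (∑' _ : ℕ, (0 : ℝ))) := by
    refine tendsto_tsum_of_dominated_convergence
      (summable_one_div_one_add_sq.mul_left 888) (fun n => ?_) ?_
    · have h := (((tendsto_gaussDiff_zero_div u (n + 3 / 2)).sub
        ((tendsto_gaussDiff_zero_div u (n + 1)).const_mul 3)).add
        ((tendsto_gaussDiff_zero_div u (n + 1 / 2)).const_mul 3)).sub
        (tendsto_gaussDiff_zero_div u n)
      rw [show 4 * u * ((n : ℝ) + 3 / 2) - 3 * (4 * u * (n + 1)) + 3 * (4 * u * (n + 1 / 2)) -
        4 * u * n = 0 by ring] at h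
      refine h.congr fun σ => ?_
      rw [thirdDiff]
      ring
    · filter_upwards [eventually_Ioc] with σ hσ n
      rw [Real.norm_eq_abs, abs_div, abs_of_pos hσ.1, div_le_iff₀ hσ.1]
      refine abs_thirdDiff_gaussDiff_le hu0 hu fun y hy =>
        (abs_gaussJet_four_le hσ.1 hσ.2 y).trans ?_
      have := one_add_sq_le (by positivity : (0 : ℝ) ≤ n) hy
      rw [← mul_one_div]
      nlinarith [hσ.1]
  rw [tsum_zero] at hd
  have h := (hd.add (tendsto_gaussDiff_zero_div u (1 / 2))).const_mul (-(1 / 4))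
  rw [show -(1 / 4) * (0 + 4 * u * (1 / 2)) = -u / 2 by ring] at h
  refine h.congr' ?_
  filter_upwards [self_mem_nhdsWithin] with σ hσ
  have s0 : Summable fun n : ℕ => gaussDiff σ u 0 n := by
    simpa using summable_gaussDiff_zero hσ u 0
  have s1 := summable_gaussDiff_zero hσ u (1 / 2)
  have s2 := summable_gaussDiff_zero hσ u 1
  have s3 := summable_gaussDiff_zero hσ u (3 / 2)
  have e0 := s0.tsum_eq_zero_add
  have e1 := s1.tsum_eq_zero_add
  have h0 : gaussDiff σ u 0 0 = 0 := by simp [gaussDiff, gaussJet]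
  have h5 : ∀ n : ℕ, gaussDiff σ u 0 ((n + 1 : ℕ) + 1 / 2) = gaussDiff σ u 0 (n + 3 / 2) :=
    fun n => by push_cast; ring_nf
  rw [tsum_congr h5] at e1
  push_cast at e0 e1
  rw [h0, zero_add] at e0
  rw [zero_add] at e1
  have ht : ∑' n : ℕ, thirdDiff (gaussDiff σ u 0) n =
      ∑' n : ℕ, gaussDiff σ u 0 (n + 3 / 2) - 3 * ∑' n : ℕ, gaussDiff σ u 0 (n + 1) +
        3 * ∑' n : ℕ, gaussDiff σ u 0 (n + 1 / 2) - ∑' n : ℕ, gaussDiff σ u 0 n := by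
    rw [← tsum_mul_left, ← tsum_mul_left, ← s3.tsum_sub (s2.mul_left 3),
      ← (s3.sub (s2.mul_left 3)).tsum_add (s1.mul_left 3),
      ← ((s3.sub (s2.mul_left 3)).add (s1.mul_left 3)).tsum_sub s0]
    rfl
  rw [tsum_div_const, ht, e0, e1]
  ring

/-! ### The formulas for `Z` -/

theorem ZD_of_odd {N : ℕ} (hN : 2 ≤ N) (hodd : Odd N) {τ : ℂ} (hτ : 0 < τ.im) :
    ZD N τ = -2 * qPow τ (-(N : ℝ) / 2) * evenSeries N τ := by
  rw [ZD_eq_tsum hN hτ, tsum_seriesTerm_of_odd hodd]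

theorem ZD_of_even {N : ℕ} (hN : 2 ≤ N) (heven : Even N) {τ : ℂ} (hτ : 0 < τ.im) :
    ZD N τ = -2 * qPow τ (-(N : ℝ) / 2) * (evenSeries N τ - oddSeries N τ) := by
  rw [ZD_eq_tsum hN hτ, tsum_seriesTerm_of_even (by omega) heven hτ]

theorem qPow_prefactor (N : ℕ) (τ : ℂ) :
    qPow τ (-(N : ℝ) / 2 - 1 / (2 * N)) * qPow τ (1 / (2 * N)) = qPow τ (-(N : ℝ) / 2) := by
  rw [← qPow_add, sub_add_cancel]

theorem qPow_I_mul_ofReal (t r : ℝ) :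
    qPow (I * t) r = ((Real.exp (-2 * Real.pi * r * t) : ℝ) : ℂ) := by
  rw [qPow]
  push_cast
  congr 1
  linear_combination (2 * Real.pi * r * t : ℂ) * Complex.I_sq

theorem qPow_I_mul_eq_gaussJet {N : ℕ} (hN : N ≠ 0) (t x : ℝ) :
    qPow (I * t) (1 / (2 * N)) * qPow (I * t) (((2 * N * x) ^ 2 - 1) / (2 * N)) =
      ((gaussJet (4 * Real.pi * N * t) 0 x : ℝ) : ℂ) := by
  rw [← qPow_scaled_sq hN, qPow_mul_natCast, qPow_I_mul_ofReal, gaussJet]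
  ring_nf

/-! ### The two series on the imaginary axis as sums of Gaussian differences. -/

theorem hasSum_sign_mul {f : ℤ → ℂ} {g h : ℕ → ℂ} (hg : Summable g) (hh : Summable h)
    (h1 : ∀ n : ℕ, f n = g n) (h2 : ∀ n : ℕ, f (-(n + 1 : ℤ)) = -h n) :
    ∑' b : ℤ, f b = ∑' n, (g n - h n) := by
  have e1 : HasSum (fun n : ℕ => f n) (∑' n, g n) := by simpa only [h1] using hg.hasSum
  have e2 : HasSum (fun n : ℕ => f (-(n + 1 : ℤ))) (-∑' n, h n) := by
    simpa only [h2] using hh.hasSum.neg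
  rw [(e1.of_nat_of_neg_add_one e2).tsum_eq, hg.tsum_sub hh, sub_eq_add_neg]

theorem qPow_mul_oddSeries {N : ℕ} (hN : N ≠ 0) {t : ℝ} (ht : 0 < t) :
    qPow (I * t) (1 / (2 * N)) * oddSeries N (I * t) =
      ((-∑' n : ℕ, gaussDiff (4 * Real.pi * N * t) (1 / (2 * N)) 0 (n + 1 / 2) : ℝ) : ℂ) := by
  have hN0 : (0 : ℝ) < N := by positivity
  set σ := 4 * Real.pi * N * t with hσ
  set u : ℝ := 1 / (2 * N) with hu
  have hσ0 : 0 < σ := by positivity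
  have s1 := (summable_gaussJet_zero hσ0 (1 / 2 + u))
  have s2 := (summable_gaussJet_zero hσ0 (1 / 2 - u))
  rw [oddSeries, ← tsum_mul_left]
  rw [hasSum_sign_mul (g := fun n : ℕ => ((gaussJet σ 0 (n + (1 / 2 + u)) : ℝ) : ℂ))
    (h := fun n : ℕ => ((gaussJet σ 0 (n + (1 / 2 - u)) : ℝ) : ℂ))
    (by exact_mod_cast s1) (by exact_mod_cast s2)]
  · rw [← tsum_neg, Complex.ofReal_tsum]
    refine tsum_congr fun n => ?_
    rw [gaussDiff]
    push_cast
    rw [← add_assoc, ← add_sub_assoc]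
    ring
  · intro n
    rw [Int.sign_eq_one_of_pos (by omega), ← qPow_I_mul_eq_gaussJet hN]
    push_cast
    rw [one_mul, show 2 * (N : ℝ) * (n + (1 / 2 + u)) = 2 * N * n + N + 1 by
      rw [hu]; field_simp; ring]
  · intro n
    rw [Int.sign_eq_neg_one_of_neg (by omega), ← qPow_I_mul_eq_gaussJet hN]
    push_cast
    rw [show (2 * (N : ℝ) * (n + (1 / 2 - u))) ^ 2 = (2 * N * (-1 + -n) + N + 1) ^ 2 by
      rw [hu]; field_simp; ring, hu]
    ring_nf

theorem qPow_mul_evenSeries {N : ℕ} (hN : N ≠ 0) {t : ℝ} (ht : 0 < t) :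
    qPow (I * t) (1 / (2 * N)) * evenSeries N (I * t) =
      ((-∑' n : ℕ, gaussDiff (4 * Real.pi * N * t) (1 / (2 * N)) 0 (n + 1) : ℝ) : ℂ) := by
  have hN0 : (0 : ℝ) < N := by positivity
  set σ := 4 * Real.pi * N * t with hσ
  set u : ℝ := 1 / (2 * N) with hu
  have hσ0 : 0 < σ := by positivity
  have s1 := (summable_gaussJet_zero hσ0 u)
  have s2 := (summable_gaussJet_zero hσ0 (1 - u))
  have s3 := (summable_gaussJet_zero hσ0 (1 + u))
  have s1' : Summable fun n : ℕ => if n = 0 then (0 : ℂ) else ((gaussJet σ 0 (n + u) : ℝ) : ℂ) := by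
    rw [← summable_nat_add_iff 1]
    simpa using (summable_nat_add_iff 1).2 (Complex.ofRealCLM.summable s1)
  rw [evenSeries, ← tsum_mul_left]
  -- The term at `b = 0` is missing because `sgn 0 = 0`, so the nonnegative half starts at `1` and
  -- pairs with the negative half around the positive integers.
  have e1 : ∑' n : ℕ, (if n = 0 then (0 : ℂ) else ((gaussJet σ 0 (n + u) : ℝ) : ℂ)) =
      ∑' n : ℕ, ((gaussJet σ 0 (n + (1 + u)) : ℝ) : ℂ) := by
    rw [s1'.tsum_eq_zero_add, if_pos rfl, zero_add]
    refine tsum_congr fun n => ?_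
    rw [if_neg (by omega)]
    push_cast
    ring_nf
  have s2' : Summable fun n : ℕ => ((gaussJet σ 0 (n + (1 - u)) : ℝ) : ℂ) := by exact_mod_cast s2
  have s3' : Summable fun n : ℕ => ((gaussJet σ 0 (n + (1 + u)) : ℝ) : ℂ) := by exact_mod_cast s3
  rw [hasSum_sign_mul s1' s2', s1'.tsum_sub s2', e1, ← s3'.tsum_sub s2']
  · rw [← tsum_neg, Complex.ofReal_tsum]
    refine tsum_congr fun n => ?_
    rw [gaussDiff]
    push_cast
    rw [← add_assoc, ← add_sub_assoc]
    ring
  · intro n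
    split_ifs with h
    · subst h; simp
    · rw [Int.sign_eq_one_of_pos (by omega), ← qPow_I_mul_eq_gaussJet hN]
      push_cast
      rw [one_mul, show 2 * (N : ℝ) * (n + u) = 2 * N * n + 1 by rw [hu]; field_simp]
  · intro n
    rw [Int.sign_eq_neg_one_of_neg (by omega), ← qPow_I_mul_eq_gaussJet hN]
    push_cast
    rw [show (2 * (N : ℝ) * (n + (1 - u))) ^ 2 = (2 * N * (-1 + -n) + 1) ^ 2 by
      rw [hu]; field_simp; ring, hu]
    ring_nf

theorem tendsto_qPow_I_mul (r : ℝ) :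
    Tendsto (fun t : ℝ => qPow (I * t) r) (𝓝[>] 0) (𝓝 1) := by
  have : Continuous fun t : ℝ => qPow (I * t) r := by unfold qPow; fun_prop
  have h := (this.tendsto 0).mono_left (nhdsWithin_le_nhds (s := Ioi 0))
  simpa [qPow] using h

theorem tendsto_const_mul_nhdsGT {c : ℝ} (hc : 0 < c) :
    Tendsto (fun t : ℝ => c * t) (𝓝[>] 0) (𝓝[>] 0) := by
  refine tendsto_nhdsWithin_iff.2 ⟨?_, ?_⟩
  · have : Continuous fun t : ℝ => c * t := by fun_prop
    simpa using (this.tendsto 0).mono_left (nhdsWithin_le_nhds (s := Ioi 0))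
  · filter_upwards [self_mem_nhdsWithin] with t ht using mul_pos hc ht

theorem isEquivalent_ZD_of_odd {N : ℕ} (hN : 2 ≤ N) (hodd : Odd N) :
    (fun t : ℝ => ZD N (I * (t : ℂ))) ~[𝓝[>] 0] fun _ => 2 / (N : ℂ) := by
  have hN0 : (0 : ℝ) < N := by positivity
  have hN1 : (2 : ℝ) ≤ N := by exact_mod_cast hN
  have hNc : (N : ℂ) ≠ 0 := by exact_mod_cast hN0.ne'
  refine (isEquivalent_const_iff_tendsto (div_ne_zero two_ne_zero hNc)).2 ?_
  have hu : 1 / (2 * (N : ℝ)) ≤ 1 / 4 := one_div_le_one_div_of_le (by norm_num) (by linarith)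
  have h := (tendsto_tsum_gaussDiff (by positivity) hu).comp
    (tendsto_const_mul_nhdsGT (c := 4 * Real.pi * N) (by positivity))
  have h2 := ((Complex.continuous_ofReal.tendsto _).comp h).const_mul 2
  have h3 := (tendsto_qPow_I_mul (-(N : ℝ) / 2 - 1 / (2 * N))).mul h2
  have hlim : (1 : ℂ) * (2 * ((2 * (1 / (2 * (N : ℝ))) : ℝ) : ℂ)) = 2 / N := by
    push_cast; field_simp
  rw [hlim] at h3
  refine h3.congr' ?_
  filter_upwards [self_mem_nhdsWithin] with t ht
  have ht : 0 < t := ht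
  have he := qPow_mul_evenSeries (N := N) (by omega) ht
  rw [ZD_of_odd hN hodd (by simpa using ht), ← qPow_prefactor]
  simp only [Function.comp]
  push_cast at he ⊢
  linear_combination (2 * qPow (I * t) (-(N : ℝ) / 2 - 1 / (2 * N))) * he

theorem isEquivalent_ZD_of_even {N : ℕ} (hN : 2 ≤ N) (heven : Even N) :
    (fun t : ℝ => ZD N (I * (t : ℂ))) ~[𝓝[>] 0] fun t => -2 * (Real.pi : ℂ) * (t : ℂ) := by
  have hN0 : (0 : ℝ) < N := by positivity
  have hN1 : (2 : ℝ) ≤ N := by exact_mod_cast hN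
  have hNc : (N : ℂ) ≠ 0 := by exact_mod_cast hN0.ne'
  have hpi : (Real.pi : ℂ) ≠ 0 := by exact_mod_cast Real.pi_ne_zero
  have hu : 1 / (2 * (N : ℝ)) ≤ 1 / 4 := one_div_le_one_div_of_le (by norm_num) (by linarith)
  have h := (tendsto_alternating_tsum_gaussDiff (by positivity) hu).comp
    (tendsto_const_mul_nhdsGT (c := 4 * Real.pi * N) (by positivity))
  -- With `σ = 4πNt`, dividing by `-2πt` and multiplying by `2` is dividing by `σ` and multiplying
  -- by `-4N`; the limit is `-4N · (-1/(4N)) = 1`.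
  have h2 := ((Complex.continuous_ofReal.tendsto _).comp h).const_mul (-4 * (N : ℂ))
  have h3 := (tendsto_qPow_I_mul (-(N : ℝ) / 2 - 1 / (2 * N))).mul h2
  have hlim : (1 : ℂ) * (-4 * N * ((-(1 / (2 * (N : ℝ))) / 2 : ℝ) : ℂ)) = 1 := by
    push_cast; field_simp; norm_num
  rw [hlim] at h3
  refine isEquivalent_of_tendsto_one (h3.congr' ?_)
  filter_upwards [self_mem_nhdsWithin] with t ht
  have ht : 0 < t := ht
  have htc : (t : ℂ) ≠ 0 := by exact_mod_cast ht.ne'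
  have he := qPow_mul_evenSeries (N := N) (by omega) ht
  have ho := qPow_mul_oddSeries (N := N) (by omega) ht
  simp only [Function.comp, Pi.div_apply]
  rw [ZD_of_even hN heven (by simpa using ht), ← qPow_prefactor]
  set A := ∑' n : ℕ, gaussDiff (4 * Real.pi * N * t) (1 / (2 * N)) 0 (n + 1)
  set B := ∑' n : ℕ, gaussDiff (4 * Real.pi * N * t) (1 / (2 * N)) 0 (n + 1 / 2)
  set P := qPow (I * t) (-(N : ℝ) / 2 - 1 / (2 * N))
  have e : -2 * (P * qPow (I * t) (1 / (2 * N))) * (evenSeries N (I * t) - oddSeries N (I * t)) =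
      2 * P * (A - B) := by
    push_cast at he ho
    linear_combination (-2 * P) * (he - ho)
  rw [e]
  push_cast
  field_simp

/-! ### The main theorem -/

theorem isQuantumModularForm_ZD {N : ℕ} (hN : 2 ≤ N) :
    IsQuantumModularForm (1 / 2) Set.univ
      (fun τ : ℂ => qPow τ (1 / 4 + 1 / (4 * (N : ℝ) ^ 2)) * ZD N (τ / (2 * (N : ℂ)))) := by
  have hN0 : (0 : ℝ) < N := by positivity
  have hNc : (N : ℂ) ≠ 0 := by exact_mod_cast hN0.ne'
  -- The signed theta function with `j = 1` is a power of `q` times `evenSeries + 1`; the last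
  -- coefficient `2` removes the extra `1`. The second series enters only for even `N`.
  refine isQuantumModularForm_signedTheta (N := N) (by omega) 1 (N + 1) (-2)
    (if Even N then 2 else 0) 2 (1 / (4 * (N : ℝ) ^ 2)) fun τ hτ => ?_
  set s := τ / (2 * (N : ℂ)) with hs
  have hsτ : 2 * (N : ℂ) * s = τ := by rw [hs]; field_simp
  have hsim : 0 < s.im := by
    rw [hs, show τ / (2 * (N : ℂ)) = ((1 / (2 * N) : ℝ) : ℂ) * τ by push_cast; field_simp,
      Complex.im_ofReal_mul]
    positivity
  have hq : ∀ r : ℝ, qPow τ r = qPow s (2 * N * r) := fun r => by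
    rw [← qPow_mul_natCast, hsτ]
  have h1 := signedTheta_one (N := N) (by omega) hsim
  have h2 := signedTheta_add_one hN s
  rw [hsτ] at h1 h2
  have e1 : qPow τ (1 / 4 + 1 / (4 * (N : ℝ) ^ 2)) * qPow s (-(N : ℝ) / 2) =
      qPow s (1 / (2 * N)) := by
    rw [hq, ← qPow_add]
    congr 1
    field_simp
    ring
  have e2 : qPow τ (1 / (4 * (N : ℝ) ^ 2)) = qPow s (1 / (2 * N)) := by
    rw [hq]
    congr 1
    field_simp
    ring
  push_cast
  rw [h1, h2, e2]
  split_ifs with heven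
  · rw [ZD_of_even hN heven hsim]
    linear_combination (-2 * (evenSeries N s - oddSeries N s)) * e1
  · rw [ZD_of_odd hN (Nat.not_even_iff_odd.1 heven) hsim]
    linear_combination (-2 * evenSeries N s) * e1

end

theorem proposition5p2 (N : ℕ) (hN : 2 ≤ N) :
    -- all series and integrals involved converge
    (∀ τ : ℂ, 0 < τ.im →
      PlumbingZConverges (dynkinD N) (fun _ => 2) τ ∧
      (∀ j : ℤ, Summable fun m : ℤ => falseThetaTerm j N τ m) ∧
      (Summable fun m : ℤ => sgnTerm N τ m)) ∧
    -- `N` odd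
    (Odd N →
      (∀ τ : ℂ, 0 < τ.im →
        ZD N τ = qPow τ (-(N : ℝ) / 2 - 1 / (2 * (N : ℝ))) *
          (falseTheta (-1) N (2 * (N : ℂ) * τ) +
            falseTheta (2 * (N : ℤ) - 1) N (2 * (N : ℂ) * τ)) ∧
        ZD N τ = -2 * qPow τ (-(N : ℝ) / 2) * sgnSum N 1 τ + 2 * qPow τ (-(N : ℝ) / 2)) ∧
      (fun t : ℝ => ZD N (I * (t : ℂ))) ~[𝓝[>] 0] fun _ => 2 / (N : ℂ)) ∧
    -- `N` even
    (Even N →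
      (∀ τ : ℂ, 0 < τ.im →
        ZD N τ = qPow τ (-(N : ℝ) / 2 - 1 / (2 * (N : ℝ))) *
          (falseTheta (-1) N (2 * (N : ℂ) * τ) +
            2 * falseTheta ((N : ℤ) + 1) N (2 * (N : ℂ) * τ) +
            falseTheta (2 * (N : ℤ) - 1) N (2 * (N : ℂ) * τ)) ∧
        ZD N τ = -2 * qPow τ (-(N : ℝ) / 2) * (sgnSum N 1 τ + sgnSum N ((N : ℤ) - 1) τ) +
          2 * qPow τ (-(N : ℝ) / 2)) ∧
      (fun t : ℝ => ZD N (I * (t : ℂ))) ~[𝓝[>] 0] fun t => -2 * (Real.pi : ℂ) * (t : ℂ)) ∧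
    -- quantum modularity
    IsQuantumModularForm (1 / 2) Set.univ
      (fun τ : ℂ => qPow τ (1 / 4 + 1 / (4 * (N : ℝ) ^ 2)) * ZD N (τ / (2 * (N : ℂ)))) := by
  have hN0 : N ≠ 0 := by omega
  refine ⟨fun τ hτ => ⟨plumbingZConverges_dynkinD hN hτ,
    fun j => summable_falseThetaTerm j N hτ, summable_sgnTerm hN0 hτ⟩,
    fun hodd => ⟨fun τ hτ => ⟨?_, ?_⟩, isEquivalent_ZD_of_odd hN hodd⟩,
    fun heven => ⟨fun τ hτ => ⟨?_, ?_⟩, isEquivalent_ZD_of_even hN heven⟩,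
    isQuantumModularForm_ZD hN⟩
  · rw [falseTheta_add_falseTheta hN0 hτ, ZD_of_odd hN hodd hτ, ← qPow_prefactor]
    ring
  · rw [sgnSum_one hN0 hτ, ZD_of_odd hN hodd hτ]
    ring
  · rw [add_right_comm, falseTheta_add_falseTheta hN0 hτ, falseTheta_add_one hN0,
      ZD_of_even hN heven hτ, ← qPow_prefactor]
    ring
  · rw [sgnSum_one hN0 hτ, sgnSum_sub_one hN, ZD_of_even hN heven hτ]
    ring
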